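/- Let $G=\mathbb C\ltimes_\varphi\mathbb C^2$, $\varphi(z_1)=\mathrm{diag}(e^{z_1},e^{-z_1})$, be the simply connected complex solvable Lie group with global holomorphic coordinates $(z_1,z_2,z_3)$. Let $A\in SL(2,\mathbb Z)$ have distinct real eigenvalues $\lambda,\lambda^{-1}$, put $a=\log\lambda$, and let $\Gamma=\Gamma_1\ltimes_\varphi\Gamma_{\mathbb C^2}$, where $\Gamma_1=a\mathbb Z+2\pi i\mathbb Z$ and $\Gamma_{\mathbb C^2}$ is a lattice in $\mathbb C^2$ preserved by $\varphi(\Gamma_1)$. Let $X=\Gamma\backslash G$ be the holomorphically parallelizable Nakamura manifold, and let $\Delta=\{t\in\mathbb C: |t|<1\}$. For $t\in\Delta$ let $X_t$ be the smooth manifold $\Gamma\backslash G$ with the complex structure whose local holomorphic coordinates are $(z_1-t\bar z_1,\,z_2,\,z_3)$. This is the deformation of $X$ given by $\phi_t=t\,\frac{\partial}{\partial z_1}\otimes d\bar z_1$, in the sense that $T^{0,1}X_t=\{\bar v+\phi_t(\bar v):\bar v\in T^{0,1}X\}$. Then: 1. The $X_t$ are compact complex manifolds. They are the fibres of a holomorphic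 family (proper holomorphic submersion) over $\Delta$ with total space $\Gamma\backslash(\Delta\times G)$, and $X_0=X$. 2. For every $t\in\Delta$, with $\omega_t^1=dz_1-t\,d\bar z_1$, $\omega_t^2=e^{-z_1}dz_2$, $\omega_t^3=e^{z_1}dz_3$, the form $$F_t=i\,\omega_t^1\wedge\overline{\omega_t^1}+e^{2i\,\mathrm{Im}\,z_1}\,\omega_t^2\wedge\overline{\omega_t^3}+e^{-2i\,\mathrm{Im}\,z_1}\,\overline{\omega_t^2}\wedge\omega_t^3$$ on $G$ descends to a pseudo-Kähler metric on $X_t$, i.e. to a smooth real closed non-degenerate $2$-form of type $(1,1)$. 3. Let $h^{1,1}_{\mathrm{BC}}=\dim_{\mathbb C}\,(\ker\partial\cap\ker\bar\partial)/\operatorname{im}\partial\bar\partial$ be computed on smooth forms in bidegree $(1,1)$. Then $h^{1,1}_{\mathrm{BC}}(X)=7$, and there is $\varepsilon>0$ such that $h^{1,1}_{\mathrm{BC}}(X_t)=3$ for all $t\in\Delta$ with $0<|t|<\varepsilon$. -/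

import Mathlib

open scoped Manifold ContDiff ComplexConjugate
open Complex (I)

noncomputable section

/-! ## Differential forms on complex manifolds

`M` is a manifold modelled on a complex normed space `E`.  As everywhere in Mathlib, the tangent
space at `x` is `E`, through the preferred chart at `x`; since the coordinate changes of a complex
manifold are holomorphic, the complex structure of `T_x M` is multiplication by `i` on `E`.
A complex-valued `k`-form is a field of real-multilinear alternating maps. -/

section Forms

/-- Real-multilinear alternating maps of degree `k` with values in `F`. -/
abbrev AltMap (E F : Type*) [NormedAddCommGroup E] [NormedSpace ℂ E] [NormedAddCommGroup F]
    [NormedSpace ℝ F] (k : ℕ) : Type _ :=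
  E [⋀^Fin k]→L[ℝ] F

/-- Complex-valued real-multilinear alternating maps of degree `k`. -/
abbrev CForm (E : Type*) [NormedAddCommGroup E] [NormedSpace ℂ E] (k : ℕ) : Type _ :=
  AltMap E ℂ k

variable {E : Type*} [NormedAddCommGroup E] [NormedSpace ℂ E]
  {E' : Type*} [NormedAddCommGroup E'] [NormedSpace ℂ E']
  {M : Type*} [TopologicalSpace M] [ChartedSpace E M]
  {N : Type*} [TopologicalSpace N] [ChartedSpace E' N] {k : ℕ}

/-- The pull-back `f^* α` of a `k`-form by a (real) differentiable map. -/
def pullbackForm (f : M → N) (α : N → CForm E' k) (x : M) : CForm E k :=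
  (α (f x)).compContinuousLinearMap (mfderiv 𝓘(ℝ, E) 𝓘(ℝ, E') f x : E →L[ℝ] E')

/-- The expression of a form on `M` in the preferred chart at `x`: a form on (an open subset of)
the vector space `E`. -/
def formInChart (α : M → CForm E k) (x : M) : E → CForm E k :=
  pullbackForm (chartAt E x).symm α

/-- A form is smooth if its expressions in charts are `C^∞`. -/
def IsSmoothForm (α : M → CForm E k) : Prop :=
  ∀ x : M, ContDiffOn ℝ ∞ (formInChart α x) (chartAt E x).target

/-- The exterior derivative, computed at `x` in the preferred chart at `x`. -/
def extDerivForm (α : M → CForm E k) (x : M) : CForm E (k + 1) :=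
  extDeriv (formInChart α x) (chartAt E x x)

/-- An alternating form has type `(p, q)`, where `p + q` is its degree, if
`η(c v₁, …, c v_k) = c^p c̄^q η(v₁, …, v_k)` for all complex `c`. -/
def IsOfType (p q : ℕ) (η : CForm E k) : Prop :=
  ∀ (c : ℂ) (v : Fin k → E), η (fun i ↦ c • v i) = c ^ p * conj c ^ q * η v

/-- The `(p, q)`-component of an alternating form of degree `k = p + q`.  A form of type `(a, b)`,
`a + b = k`, is multiplied by `ζ^(a - b)` under `v ↦ ζ v`, `|ζ| = 1`, and the numbers `ζ^(a - b)`
are distinct when `ζ` is a primitive root of unity of order `2k + 1`; so averaging against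
`ζ^(-(p - q))` over the powers of `ζ` extracts the component of type `(p, q)`. -/
def typeComponent (p q : ℕ) (η : CForm E k) : CForm E k :=
  ((2 * k + 1 : ℕ) : ℂ)⁻¹ • ∑ j ∈ Finset.range (2 * k + 1),
    Complex.exp (-(2 * Real.pi * I * j * ((p : ℂ) - q)) / (2 * k + 1 : ℕ)) •
      η.compContinuousLinearMap
        (Complex.exp (2 * Real.pi * I * j / (2 * k + 1 : ℕ)) • ContinuousLinearMap.id ℝ E)

/-- `∂` on forms of type `(p, q)`: the `(p + 1, q)`-component of `d`. -/
def delForm (p q : ℕ) (α : M → CForm E k) (x : M) : CForm E (k + 1) :=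
  typeComponent (p + 1) q (extDerivForm α x)

/-- `∂̄` on forms of type `(p, q)`: the `(p, q + 1)`-component of `d`. -/
def delbarForm (p q : ℕ) (α : M → CForm E k) (x : M) : CForm E (k + 1) :=
  typeComponent p (q + 1) (extDerivForm α x)

/-- A pseudo-Kähler metric, given by its fundamental form: a smooth real closed non-degenerate
`2`-form of type `(1, 1)`. -/
structure IsPseudoKahler (F : M → CForm E 2) : Prop where
  smooth : IsSmoothForm F
  real : ∀ (x : M) (v : Fin 2 → E), conj (F x v) = F x v
  type_one_one : ∀ x : M, IsOfType 1 1 (F x)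
  closed : ∀ x : M, extDerivForm F x = 0
  nondegenerate : ∀ (x : M) (u : E), (∀ v : E, F x ![u, v] = 0) → u = 0

theorem formInChart_add (α η : M → CForm E k) (x : M) :
    formInChart (α + η) x = formInChart α x + formInChart η x := by
  funext y; ext v; rfl

theorem formInChart_smul (c : ℂ) (α : M → CForm E k) (x : M) :
    formInChart (c • α) x = c • formInChart α x := by
  funext y; ext v; rfl

theorem formInChart_zero (x : M) : formInChart (0 : M → CForm E k) x = 0 := by
  funext y; ext v; rfl

theorem IsSmoothForm.differentiableAt {α : M → CForm E k} (h : IsSmoothForm α) (x : M) :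
    DifferentiableAt ℝ (formInChart α x) (chartAt E x x) :=
  ((h x).contDiffAt ((chartAt E x).open_target.mem_nhds
    (mem_chart_target E x))).differentiableAt (by simp)

theorem extDerivForm_add {α η : M → CForm E k} (hα : IsSmoothForm α)
    (hη : IsSmoothForm η) (x : M) :
    extDerivForm (α + η) x = extDerivForm α x + extDerivForm η x := by
  unfold extDerivForm
  rw [formInChart_add, extDeriv_add (hα.differentiableAt x) (hη.differentiableAt x)]

theorem extDerivForm_smul (c : ℂ) {α : M → CForm E k} (hα : IsSmoothForm α) (x : M) :
    extDerivForm (c • α) x = c • extDerivForm α x := by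
  unfold extDerivForm
  rw [formInChart_smul, extDeriv, fderiv_const_smul (hα.differentiableAt x)]
  ext v
  simp [extDeriv, ContinuousAlternatingMap.alternatizeUncurryFin_apply, Finset.mul_sum]

theorem typeComponent_add (p q : ℕ) (η θ : CForm E k) :
    typeComponent p q (η + θ) = typeComponent p q η + typeComponent p q θ := by
  ext v
  simp [typeComponent, Finset.sum_add_distrib, mul_add]

theorem typeComponent_smul (p q : ℕ) (c : ℂ) (η : CForm E k) :
    typeComponent p q (c • η) = c • typeComponent p q η := by
  ext v
  simp [typeComponent, Finset.mul_sum, mul_left_comm]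

variable (E M)

/-- The space `ker ∂ ∩ ker ∂̄` of smooth `(1, 1)`-forms. -/
def closedForms11 : Submodule ℂ (M → CForm E 2) where
  carrier := {α | IsSmoothForm α ∧ (∀ x, IsOfType 1 1 (α x)) ∧
    (∀ x, delForm 1 1 α x = 0) ∧ ∀ x, delbarForm 1 1 α x = 0}
  add_mem' := by
    rintro α η ⟨h1, h2, h3, h4⟩ ⟨g1, g2, g3, g4⟩
    refine ⟨fun x ↦ ?_, fun x c v ↦ ?_, fun x ↦ ?_, fun x ↦ ?_⟩
    · rw [formInChart_add]; exact (h1 x).add (g1 x)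
    · have := h2 x c v
      have := g2 x c v
      simp_all [mul_add]
    · have := h3 x
      have := g3 x
      simp_all [delForm, extDerivForm_add h1 g1, typeComponent_add]
    · have := h4 x
      have := g4 x
      simp_all [delbarForm, extDerivForm_add h1 g1, typeComponent_add]
  zero_mem' := by
    have h0 : ∀ x : M, extDerivForm (0 : M → CForm E 2) x = 0 := by
      intro x
      have h := extDerivForm_smul (0 : ℂ) (α := (0 : M → CForm E 2))
        (fun y ↦ by rw [formInChart_zero]; exact contDiffOn_const) x
      simpa using h
    refine ⟨fun x ↦ ?_, fun x c v ↦ ?_, fun x ↦ ?_, fun x ↦ ?_⟩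
    · rw [formInChart_zero]; exact contDiffOn_const
    · simp
    · ext v; simp [delForm, h0, typeComponent]
    · ext v; simp [delbarForm, h0, typeComponent]
  smul_mem' := by
    rintro a α ⟨h1, h2, h3, h4⟩
    refine ⟨fun x ↦ ?_, fun x c v ↦ ?_, fun x ↦ ?_, fun x ↦ ?_⟩
    · rw [formInChart_smul]; exact (h1 x).const_smul a
    · have := h2 x c v
      simp_all [mul_left_comm]
    · have := h3 x
      simp_all [delForm, extDerivForm_smul a h1, typeComponent_smul]
    · have := h4 x
      simp_all [delbarForm, extDerivForm_smul a h1, typeComponent_smul]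

/-- The space of the forms `∂ ∂̄ f`, where `f` is a smooth function (a `0`-form).  These forms are
a linear subspace already, so that taking the span only supplies the linear structure. -/
def ddbarExactForms11 : Submodule ℂ (M → CForm E 2) :=
  Submodule.span ℂ {α | ∃ f : M → CForm E 0,
    IsSmoothForm f ∧ α = delForm 0 1 (delbarForm 0 0 f)}

/-- The Bott-Chern number `h^{1,1}_BC(M) = dim_ℂ (ker ∂ ∩ ker ∂̄) / im ∂∂̄`, in type `(1, 1)`. -/
def bottChernNumber11 : ℕ :=
  Module.finrank ℂ
    (closedForms11 E M ⧸ (ddbarExactForms11 E M).submoduleOf (closedForms11 E M))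

end Forms

/-! ## Complex manifolds and holomorphic families -/

/-- A complex manifold modelled on `E`. -/
structure IsComplexManifold (E : Type*) [NormedAddCommGroup E] [NormedSpace ℂ E]
    (M : Type*) [TopologicalSpace M] [ChartedSpace E M] : Prop where
  t2 : T2Space M
  secondCountable : SecondCountableTopology M
  holomorphic : IsManifold 𝓘(ℂ, E) ω M

/-- A holomorphic family of compact complex manifolds: a proper holomorphic submersion (here onto
its base) between complex manifolds. -/
structure IsHolomorphicFamily {E F : Type*} [NormedAddCommGroup E] [NormedSpace ℂ E]
    [NormedAddCommGroup F] [NormedSpace ℂ F]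
    {X B : Type*} [TopologicalSpace X] [ChartedSpace E X] [TopologicalSpace B] [ChartedSpace F B]
    (π : X → B) : Prop where
  total : IsComplexManifold E X
  base : IsComplexManifold F B
  surjective : Function.Surjective π
  proper : IsProperMap π
  submersion : Manifold.IsSubmersion 𝓘(ℂ, E) 𝓘(ℂ, F) ω π

/-- `φ` is a conjugate-linear field of endomorphisms of the tangent spaces of `M`, that is, a
section of `T^{1,0} M ⊗ (T^{0,1} M)^*`.  The map `f : M → N` of complex manifolds satisfies the
Beltrami equation of `φ` if `∂̄f + ∂f ∘ φ = 0`, that is, if `df` sends the vectors `v̄ + φ(v̄)`,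
`v̄ ∈ T^{0,1} M`, into `T^{0,1} N`.  For a local diffeomorphism this says that the complex structure
which `f` pulls back from `N` is the deformation by `φ` of the one of `M`. -/
def SatisfiesBeltrami {E E' : Type*} [NormedAddCommGroup E] [NormedSpace ℂ E]
    [NormedAddCommGroup E'] [NormedSpace ℂ E']
    {M N : Type*} [TopologicalSpace M] [ChartedSpace E M] [TopologicalSpace N] [ChartedSpace E' N]
    (φ : M → E → E) (f : M → N) : Prop :=
  ∀ (x : M) (v : E),
    letI L : E →L[ℝ] E' := mfderiv 𝓘(ℝ, E) 𝓘(ℝ, E') f x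
    (2⁻¹ : ℂ) • (L v + I • L (I • v)) + (2⁻¹ : ℂ) • (L (φ x v) - I • L (I • φ x v)) = 0

/-! ## The Nakamura manifold -/

/-- The complex Lie group `G = ℂ ⋉_φ ℂ²`, in the coordinates `(z₁, (z₂, z₃))`. -/
def NakGroup : Type := ℂ × (ℂ × ℂ)

/-- The action `φ(z₁) = diag(e^{z₁}, e^{-z₁})` of `ℂ` on `ℂ²`. -/
def nakPhi (z : ℂ) (v : ℂ × ℂ) : ℂ × ℂ := (Complex.exp z * v.1, Complex.exp (-z) * v.2)

theorem nakPhi_add (z w : ℂ) (v : ℂ × ℂ) : nakPhi (z + w) v = nakPhi z (nakPhi w v) := by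
  ext <;> simp [nakPhi, Complex.exp_add] <;> ring

theorem nakPhi_vadd (z : ℂ) (v w : ℂ × ℂ) : nakPhi z (v + w) = nakPhi z v + nakPhi z w := by
  ext <;> simp [nakPhi, mul_add]

theorem nakPhi_neg (z : ℂ) (v : ℂ × ℂ) : nakPhi z (-v) = -nakPhi z v := by
  ext <;> simp [nakPhi]

theorem nakPhi_zero (v : ℂ × ℂ) : nakPhi 0 v = v := by
  ext <;> simp [nakPhi]

namespace NakGroup

instance : TopologicalSpace NakGroup := inferInstanceAs (TopologicalSpace (ℂ × (ℂ × ℂ)))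
instance : T2Space NakGroup := inferInstanceAs (T2Space (ℂ × (ℂ × ℂ)))
instance : LocallyCompactSpace NakGroup := inferInstanceAs (LocallyCompactSpace (ℂ × (ℂ × ℂ)))

/-- The coordinates `(z₁, (z₂, z₃))`, as a homeomorphism of `G` with `ℂ³`. -/
def coord : NakGroup ≃ₜ ℂ × (ℂ × ℂ) := Homeomorph.refl _

/-- The product of the matrices of `G`. -/
instance : Group NakGroup where
  mul g h := coord.symm
    ((coord g).1 + (coord h).1, (coord g).2 + nakPhi (coord g).1 (coord h).2)
  one := coord.symm (0, 0)
  inv g := coord.symm (-(coord g).1, nakPhi (-(coord g).1) (-(coord g).2))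
  mul_assoc a b c := by
    apply Prod.ext
    · exact add_assoc _ _ _
    · change _ + _ + nakPhi (_ + _) _ = _ + nakPhi _ (_ + _)
      rw [nakPhi_add, nakPhi_vadd, add_assoc]
  one_mul a := by
    apply Prod.ext
    · exact zero_add _
    · exact (zero_add _).trans (nakPhi_zero _)
  mul_one a := by
    apply Prod.ext
    · exact add_zero _
    · change _ + nakPhi _ 0 = _
      have h0 : nakPhi (coord a).1 0 = 0 := by ext <;> simp [nakPhi]
      exact (congrArg _ h0).trans (add_zero _)
  inv_mul_cancel a := by
    apply Prod.ext
    · exact neg_add_cancel _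
    · change nakPhi _ (-_) + nakPhi _ _ = 0
      rw [nakPhi_neg]
      exact neg_add_cancel _

theorem coord_mul (g h : NakGroup) : coord (g * h) =
    ((coord g).1 + (coord h).1, (coord g).2 + nakPhi (coord g).1 (coord h).2) := rfl

theorem coord_one : coord (1 : NakGroup) = 0 := rfl

theorem coord_inv (g : NakGroup) : coord g⁻¹ =
    (-(coord g).1, nakPhi (-(coord g).1) (-(coord g).2)) := rfl

/-- The realization of `G` by complex `4 × 4` matrices. -/
def toMatrix : NakGroup →* Matrix (Fin 4) (Fin 4) ℂ where
  toFun g := !![Complex.exp (coord g).1, 0, 0, (coord g).2.1;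
    0, Complex.exp (-(coord g).1), 0, (coord g).2.2;
    0, 0, 1, (coord g).1;
    0, 0, 0, 1]
  map_one' := by
    ext i j
    fin_cases i <;> fin_cases j <;> simp [coord_one]
  map_mul' g h := by
    ext i j
    fin_cases i <;> fin_cases j <;>
      simp [coord_mul, nakPhi, Matrix.mul_apply, Fin.sum_univ_four, Complex.exp_add, add_comm]

instance : IsTopologicalGroup NakGroup where
  continuous_mul := by
    apply coord.isEmbedding.continuous_iff.2
    change Continuous fun p : NakGroup × NakGroup ↦ ((coord p.1).1 + (coord p.2).1,
      (coord p.1).2 + nakPhi (coord p.1).1 (coord p.2).2)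
    unfold nakPhi
    fun_prop
  continuous_inv := by
    apply coord.isEmbedding.continuous_iff.2
    change Continuous fun p : NakGroup ↦ (-(coord p).1, nakPhi (-(coord p).1) (-(coord p).2))
    unfold nakPhi
    fun_prop

/-- The standard complex structure of `G`, with the single chart `(z₁, (z₂, z₃))`. -/
instance : ChartedSpace (ℂ × (ℂ × ℂ)) NakGroup :=
  coord.toOpenPartialHomeomorph.singletonChartedSpace rfl

end NakGroup

/-- The data of a lattice `Γ = Γ₁ ⋉_φ Γ_{ℂ²}` of `G`, as in the construction of the Nakamura
manifold: a matrix `A ∈ SL(2, ℤ)` with distinct real eigenvalues `lam` and `lam⁻¹`, which gives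
`Γ₁ = aℤ + 2πiℤ` with `a = log lam`, and a lattice `fibre = Γ_{ℂ²}` of `ℂ²` that is preserved by
`φ(Γ₁)`. -/
structure NakamuraLattice where
  A : Matrix.SpecialLinearGroup (Fin 2) ℤ
  lam : ℝ
  lam_ne : lam ≠ lam⁻¹
  eigenvalue : Module.End.HasEigenvalue (Matrix.toLin' (A.1.map (Int.cast : ℤ → ℝ))) lam
  eigenvalue_inv : Module.End.HasEigenvalue (Matrix.toLin' (A.1.map (Int.cast : ℤ → ℝ))) lam⁻¹
  fibre : Submodule ℤ (ℂ × ℂ)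
  [discrete : DiscreteTopology fibre]
  [isLattice : IsZLattice ℝ fibre]
  invariant : ∀ (m n : ℤ) (v : ℂ × ℂ), v ∈ fibre →
    nakPhi (m * Complex.log lam + n * (2 * Real.pi * I)) v ∈ fibre

namespace NakamuraLattice

variable (L : NakamuraLattice)

/-- The lattice `Γ₁ = aℤ + 2πiℤ` of `ℂ`, where `a = log lam`. -/
def base : AddSubgroup ℂ where
  carrier := {z | ∃ m n : ℤ, z = m * Complex.log L.lam + n * (2 * Real.pi * I)}
  add_mem' := by
    rintro _ _ ⟨m, n, rfl⟩ ⟨m', n', rfl⟩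
    exact ⟨m + m', n + n', by push_cast; ring⟩
  zero_mem' := ⟨0, 0, by simp⟩
  neg_mem' := by
    rintro _ ⟨m, n, rfl⟩
    exact ⟨-m, -n, by push_cast; ring⟩

theorem nakPhi_mem {z : ℂ} (hz : z ∈ L.base) {v : ℂ × ℂ} (hv : v ∈ L.fibre) :
    nakPhi z v ∈ L.fibre := by
  obtain ⟨m, n, rfl⟩ := hz
  exact L.invariant m n v hv

/-- The lattice `Γ = Γ₁ ⋉_φ Γ_{ℂ²}` of `G`. -/
def Γ : Subgroup NakGroup where
  carrier := {g | (NakGroup.coord g).1 ∈ L.base ∧ (NakGroup.coord g).2 ∈ L.fibre}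
  mul_mem' := by
    rintro g h ⟨hg, hg'⟩ ⟨hh, hh'⟩
    exact ⟨L.base.add_mem hg hh, L.fibre.add_mem hg' (L.nakPhi_mem hg hh')⟩
  one_mem' := ⟨L.base.zero_mem, L.fibre.zero_mem⟩
  inv_mem' := by
    rintro g ⟨hg, hg'⟩
    exact ⟨L.base.neg_mem hg, L.nakPhi_mem (L.base.neg_mem hg) (L.fibre.neg_mem hg')⟩

theorem log_re_ne_zero : (Complex.log L.lam).re ≠ 0 := by
  have h0 : L.lam ≠ 0 := fun h ↦ L.lam_ne (by simp [h])
  intro h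
  rw [Complex.log_re, Complex.norm_real, Real.norm_eq_abs, Real.log_abs, Real.log_eq_zero] at h
  rcases h with h | h | h
  · exact h0 h
  · exact L.lam_ne (by simp [h])
  · exact L.lam_ne (by rw [h]; norm_num)

instance : DiscreteTopology L.Γ := by
  have := L.discrete
  obtain ⟨U, hU, hU0⟩ := isOpen_induced_iff.1 (isOpen_discrete ({0} : Set L.fibre))
  have hmem : ∀ v : ℂ × ℂ, v ∈ L.fibre → v ∈ U → v = 0 := by
    intro v hv hvU
    have h : (⟨v, hv⟩ : L.fibre) ∈ Subtype.val ⁻¹' U := hvU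
    rw [hU0] at h
    exact congrArg Subtype.val h
  have hU1 : (0 : ℂ × ℂ) ∈ U := by
    have h : (0 : L.fibre) ∈ Subtype.val ⁻¹' U := by rw [hU0]; rfl
    exact h
  apply discreteTopology_of_isOpen_singleton_one
  rw [isOpen_induced_iff]
  have hc : Continuous fun g : NakGroup ↦ (NakGroup.coord g).1 :=
    continuous_fst.comp NakGroup.coord.continuous
  refine ⟨{g | |(NakGroup.coord g).1.re| < |(Complex.log L.lam).re| ∧
    |(NakGroup.coord g).1.im| < 2 * Real.pi ∧ (NakGroup.coord g).2 ∈ U}, ?_, ?_⟩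
  · exact (isOpen_lt (Complex.continuous_re.comp hc).abs continuous_const).inter
      ((isOpen_lt (Complex.continuous_im.comp hc).abs continuous_const).inter
        (hU.preimage (continuous_snd.comp NakGroup.coord.continuous)))
  · ext ⟨g, ⟨m, n, hmn⟩, hg⟩
    constructor
    · rintro ⟨h1, h2, h3⟩
      have hre : (NakGroup.coord g).1.re = m * (Complex.log L.lam).re := by
        rw [hmn]; simp
      have hm : m = 0 := by
        by_contra hm
        have h4 : (1 : ℝ) ≤ |(m : ℝ)| := by exact_mod_cast Int.one_le_abs hm
        change |(NakGroup.coord g).1.re| < _ at h1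
        rw [hre, abs_mul] at h1
        nlinarith [abs_nonneg (Complex.log L.lam).re]
      have him : (NakGroup.coord g).1.im = n * (2 * Real.pi) := by
        rw [hmn, hm]; simp
      have hn : n = 0 := by
        by_contra hn
        have h4 : (1 : ℝ) ≤ |(n : ℝ)| := by exact_mod_cast Int.one_le_abs hn
        change |(NakGroup.coord g).1.im| < _ at h2
        rw [him, abs_mul, abs_of_pos Real.two_pi_pos] at h2
        nlinarith [Real.pi_pos]
      apply Subtype.ext
      apply NakGroup.coord.injective
      rw [hm, hn] at hmn
      exact Prod.ext (hmn.trans (by simp [NakGroup.coord_one])) (hmem _ hg h3)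
    · intro h
      have h' : g = 1 := congrArg Subtype.val h
      subst h'
      refine ⟨?_, ?_, hU1⟩
      · simpa [NakGroup.coord_one] using L.log_re_ne_zero
      · simp [NakGroup.coord_one, Real.pi_pos]

instance : ProperlyDiscontinuousSMul L.Γ NakGroup :=
  Subgroup.properlyDiscontinuousSMul_of_tendsto_cofinite _
    (L.Γ.tendsto_coe_cofinite_of_discrete ⟨inferInstanceAs (DiscreteTopology L.Γ)⟩)

end NakamuraLattice

/-- The holomorphically parallelizable Nakamura manifold `X = Γ \ G`, with the complex structure
for which `G → X` is a local biholomorphism. -/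
abbrev NakamuraManifold (L : NakamuraLattice) : Type :=
  MulAction.orbitRel.Quotient L.Γ NakGroup

/-! ## The deformation -/

/-- The open unit disc `Δ` of `ℂ`, as an open submanifold. -/
def unitDisc : TopologicalSpace.Opens ℂ := ⟨Metric.ball 0 1, Metric.isOpen_ball⟩

/-- The centre `0` of `Δ`. -/
def discZero : unitDisc := ⟨0, by simp [unitDisc]⟩

theorem unitDisc_ne (t : unitDisc) : 1 - (t : ℂ) * conj (t : ℂ) ≠ 0 := by
  have h : ‖(t : ℂ)‖ < 1 := by simpa [unitDisc] using t.2
  intro h'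
  rw [Complex.mul_conj, Complex.normSq_eq_norm_sq, sub_eq_zero] at h'
  have h2 : (1 : ℝ) = ‖(t : ℂ)‖ ^ 2 := by exact_mod_cast h'
  nlinarith [norm_nonneg (t : ℂ)]

/-- The coordinates `(z₁ - t z̄₁, (z₂, z₃))`, for `|t| < 1`, as a homeomorphism of `G` with `ℂ³`. -/
def deformedCoord (t : unitDisc) : NakGroup ≃ₜ ℂ × (ℂ × ℂ) where
  toFun g := ((NakGroup.coord g).1 - t * conj (NakGroup.coord g).1, (NakGroup.coord g).2)
  invFun w := NakGroup.coord.symm ((w.1 + t * conj w.1) / (1 - t * conj (t : ℂ)), w.2)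
  left_inv g := by
    have h := unitDisc_ne t
    apply NakGroup.coord.injective
    apply Prod.ext
    · simp only [Homeomorph.apply_symm_apply, map_sub, map_mul, Complex.conj_conj]
      field_simp
      ring
    · simp
  right_inv w := by
    have h := unitDisc_ne t
    have h' : 1 - conj (t : ℂ) * t ≠ 0 := by rwa [mul_comm]
    apply Prod.ext
    · simp only [Homeomorph.apply_symm_apply, map_sub, map_mul, map_add, map_div₀, map_one,
        Complex.conj_conj]
      field_simp
      ring
    · simp
  continuous_toFun := by fun_prop
  continuous_invFun := by fun_prop

/-- The space `G`, with the complex structure given by the coordinates `(z₁ - t z̄₁, (z₂, z₃))`. -/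
def DeformedGroup (_t : unitDisc) : Type := NakGroup

namespace DeformedGroup

variable (t : unitDisc) (L : NakamuraLattice)

instance : TopologicalSpace (DeformedGroup t) := inferInstanceAs (TopologicalSpace NakGroup)
instance : T2Space (DeformedGroup t) := inferInstanceAs (T2Space NakGroup)
instance : LocallyCompactSpace (DeformedGroup t) := inferInstanceAs (LocallyCompactSpace NakGroup)
instance : MulAction L.Γ (DeformedGroup t) := inferInstanceAs (MulAction L.Γ NakGroup)
instance : ContinuousConstSMul L.Γ (DeformedGroup t) :=
  inferInstanceAs (ContinuousConstSMul L.Γ NakGroup)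
instance : IsCancelSMul L.Γ (DeformedGroup t) := inferInstanceAs (IsCancelSMul L.Γ NakGroup)
instance : ProperlyDiscontinuousSMul L.Γ (DeformedGroup t) :=
  inferInstanceAs (ProperlyDiscontinuousSMul L.Γ NakGroup)

/-- The single chart `(z₁ - t z̄₁, (z₂, z₃))`. -/
instance : ChartedSpace (ℂ × (ℂ × ℂ)) (DeformedGroup t) :=
  OpenPartialHomeomorph.singletonChartedSpace (α := DeformedGroup t)
    (deformedCoord t).toOpenPartialHomeomorph rfl

end DeformedGroup

/-- The deformation `X_t`: the quotient `Γ \ G`, with the complex structure that has the local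
coordinates `(z₁ - t z̄₁, (z₂, z₃))`. -/
abbrev DeformedNakamura (L : NakamuraLattice) (t : unitDisc) : Type :=
  MulAction.orbitRel.Quotient L.Γ (DeformedGroup t)

/-- The projection `G → X = Γ \ G`. -/
def nakProj (L : NakamuraLattice) (g : NakGroup) : NakamuraManifold L :=
  Quotient.mk _ g

/-- The projection `G → X_t`; on the level of points it is the projection `G → Γ \ G`. -/
def deformedProj (L : NakamuraLattice) (t : unitDisc) (g : NakGroup) : DeformedNakamura L t :=
  Quotient.mk (MulAction.orbitRel L.Γ (DeformedGroup t)) g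

/-- The space `Δ × G`, with the complex structure given by `(t, z₁ - t z̄₁, (z₂, z₃))`. -/
def TotalCover : Type := unitDisc × NakGroup

namespace TotalCover

variable (L : NakamuraLattice)

instance : TopologicalSpace TotalCover := inferInstanceAs (TopologicalSpace (unitDisc × NakGroup))
instance : T2Space TotalCover := inferInstanceAs (T2Space (unitDisc × NakGroup))
instance : LocallyCompactSpace TotalCover :=
  haveI : LocallyCompactSpace unitDisc := unitDisc.isOpen.locallyCompactSpace
  inferInstanceAs (LocallyCompactSpace (unitDisc × NakGroup))

/-- `Γ` acts on the second factor. -/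
instance : MulAction L.Γ TotalCover where
  smul γ p := ((p.1, γ • p.2) : unitDisc × NakGroup)
  one_smul p := Prod.ext rfl (one_smul L.Γ (p.2 : NakGroup))
  mul_smul a b p := Prod.ext rfl (mul_smul a b (p.2 : NakGroup))

instance : ContinuousConstSMul L.Γ TotalCover where
  continuous_const_smul γ :=
    (continuous_fst.prodMk (continuous_snd.const_smul γ) :
      Continuous fun p : unitDisc × NakGroup ↦ (p.1, γ • p.2))

instance : IsCancelSMul L.Γ TotalCover where
  right_cancel' a b c h := IsCancelSMul.right_cancel a b (c.2 : NakGroup) (congrArg Prod.snd h)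

instance : ProperlyDiscontinuousSMul L.Γ TotalCover where
  finite_disjoint_inter_image {K K'} hK hK' := by
    have h2 : Continuous fun p : TotalCover ↦ (p.2 : NakGroup) := continuous_snd
    refine (ProperlyDiscontinuousSMul.finite_disjoint_inter_image (Γ := L.Γ) (hK.image h2)
      (hK'.image h2)).subset ?_
    rintro γ ⟨_, ⟨p, hp, rfl⟩, hq⟩
    exact ⟨γ • (p.2 : NakGroup), ⟨p.2, ⟨p, hp, rfl⟩, rfl⟩, ⟨γ • p, hq, rfl⟩⟩

/-- The coordinates `(t, z₁ - t z̄₁, (z₂, z₃))`, an open embedding of `Δ × G` into `ℂ × ℂ³`. -/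
def coord (p : TotalCover) : ℂ × (ℂ × (ℂ × ℂ)) := (p.1, deformedCoord p.1 p.2)

theorem isOpenEmbedding_coord : Topology.IsOpenEmbedding coord := by
  let e : TotalCover ≃ₜ unitDisc × (ℂ × (ℂ × ℂ)) :=
    { toFun := fun p ↦ (p.1, deformedCoord p.1 p.2)
      invFun := fun w ↦ ((w.1, (deformedCoord w.1).symm w.2) : unitDisc × NakGroup)
      left_inv := fun p ↦ Prod.ext rfl ((deformedCoord p.1).symm_apply_apply p.2)
      right_inv := fun w ↦ Prod.ext rfl ((deformedCoord w.1).apply_symm_apply w.2)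
      continuous_toFun := by
        change Continuous fun p : unitDisc × NakGroup ↦
          (p.1, ((NakGroup.coord p.2).1 - (p.1 : ℂ) * conj (NakGroup.coord p.2).1,
            (NakGroup.coord p.2).2))
        fun_prop
      continuous_invFun := by
        change Continuous fun w : unitDisc × (ℂ × (ℂ × ℂ)) ↦
          ((w.1, NakGroup.coord.symm ((w.2.1 + w.1 * conj w.2.1) / (1 - w.1 * conj (w.1 : ℂ)),
            w.2.2)) : unitDisc × NakGroup)
        have h : ∀ w : unitDisc × (ℂ × (ℂ × ℂ)), 1 - (w.1 : ℂ) * conj (w.1 : ℂ) ≠ 0 :=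
          fun w ↦ unitDisc_ne w.1
        fun_prop (disch := assumption) }
  exact (unitDisc.isOpen.isOpenEmbedding_subtypeVal.prodMap .id).comp e.isOpenEmbedding

instance : Nonempty TotalCover :=
  ⟨((discZero, 1) : unitDisc × NakGroup)⟩

/-- The single chart `(t, z₁ - t z̄₁, (z₂, z₃))`. -/
instance : ChartedSpace (ℂ × (ℂ × (ℂ × ℂ))) TotalCover :=
  isOpenEmbedding_coord.singletonChartedSpace

end TotalCover

/-- The total space `Γ \ (Δ × G)` of the family. -/
abbrev TotalNakamura (L : NakamuraLattice) : Type :=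
  MulAction.orbitRel.Quotient L.Γ TotalCover

/-- The projection of the total space onto `Δ`. -/
def familyProj (L : NakamuraLattice) : TotalNakamura L → unitDisc :=
  Quotient.lift (fun p : TotalCover ↦ (p.1 : unitDisc)) (by
    rintro p q ⟨γ, h⟩
    exact (congrArg Prod.fst h).symm)

/-- The inclusion of `X_t` in the total space, `[g] ↦ [(t, g)]`. -/
def fibreInclusion (L : NakamuraLattice) (t : unitDisc) : DeformedNakamura L t → TotalNakamura L :=
  Quotient.lift
    (fun g : DeformedGroup t ↦
      (Quotient.mk (MulAction.orbitRel L.Γ TotalCover) ((t, g) : unitDisc × NakGroup)))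
    (by
      rintro g h ⟨γ, rfl⟩
      exact Quotient.sound ⟨γ, rfl⟩)

/-- The tensor `t ∂/∂z₁ ⊗ dz̄₁` on `G`, as the field of conjugate-linear endomorphisms
`v ↦ (t v̄₁, 0, 0)`. -/
def nakBeltrami (t : ℂ) (_g : NakGroup) (v : ℂ × (ℂ × ℂ)) : ℂ × (ℂ × ℂ) := (t * conj v.1, 0)

/-- The exterior product of two complex-valued real `1`-forms on a vector space. -/
def wedge {V : Type*} (α β : V → ℂ) (u v : V) : ℂ := α u * β v - α v * β u

/-- The conjugate of a complex-valued form. -/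
def conjForm {V : Type*} (α : V → ℂ) (u : V) : ℂ := conj (α u)

/-- `ω_t¹ = dz₁ - t dz̄₁`. -/
def nakOmega1 (t : ℂ) (u : ℂ × (ℂ × ℂ)) : ℂ := u.1 - t * conj u.1

/-- `ω_t² = e^{-z₁} dz₂` at the point `g = (z₁, z₂, z₃)`. -/
def nakOmega2 (g : NakGroup) (u : ℂ × (ℂ × ℂ)) : ℂ :=
  Complex.exp (-(NakGroup.coord g).1) * u.2.1

/-- `ω_t³ = e^{z₁} dz₃` at the point `g = (z₁, z₂, z₃)`. -/
def nakOmega3 (g : NakGroup) (u : ℂ × (ℂ × ℂ)) : ℂ :=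
  Complex.exp (NakGroup.coord g).1 * u.2.2

/-- The value on `(u, v)`, at the point `g = (z₁, z₂, z₃)` of `G`, of
`i ω_t¹ ∧ ω̄_t¹ + e^{2i Im z₁} ω_t² ∧ ω̄_t³ + e^{-2i Im z₁} ω̄_t² ∧ ω_t³`. -/
def nakMetric (t : ℂ) (g : NakGroup) (u v : ℂ × (ℂ × ℂ)) : ℂ :=
  I * wedge (nakOmega1 t) (conjForm (nakOmega1 t)) u v
    + Complex.exp (2 * I * (NakGroup.coord g).1.im)
        * wedge (nakOmega2 g) (conjForm (nakOmega3 g)) u v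
    + Complex.exp (-(2 * I * (NakGroup.coord g).1.im))
        * wedge (conjForm (nakOmega2 g)) (nakOmega3 g) u v

end

set_option linter.unusedSectionVars false

/-! Every manifold in the statement is the quotient of ℂ³, or of Δ × ℂ³, by a group of complex
affine maps, and its charts are local inverses of the covering (`IsAffineCovering`). In the
coordinate w₁ = z₁ - t z̄₁, left translation by (c, v) ∈ Γ becomes w₁ ↦ w₁ + c - t c̄ together with
diag(e^c, e^{-c}) and a translation on ℂ². This is affine over ℂ for fixed t, and also jointly in
(t, w₁), since c̄ is a constant; hence the holomorphic family. Forms on the quotient are the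
invariant forms on ℂ³ (`pullbackForm_descend`, `descend_pullbackForm`).

In these coordinates F_t has constant coefficients, i dw₁∧dw̄₁ + dw₂∧dw̄₃ + dw̄₂∧dw₃. It is
invariant because e^{c - c̄} = 1 for c ∈ Γ₁ (`exp_mul_conj_exp_neg`), and it is closed, real and
non-degenerate by inspection.

For the Bott-Chern numbers, a closed (1,1)-form is an array a_{jk} of functions on ℂ³, equivariant
under the deck group, with ∂_l a_{jk} = ∂_j a_{lk} and ∂̄_l a_{jk} = ∂̄_k a_{jl}; the indices 0, 1,
2 stand for w₁, w₂, w₃. The part of zero average along the fibre tori is ∂∂̄-exact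
(`exists_eq_fibreAvg_add_ddbar`): a potential F comes from the Poisson equation on the fibres with
the fibre trace a₁₁ + a₂₂ as right side, and what remains is closed, traceless and of zero average,
hence harmonic along the fibres, hence zero. The Poisson equation is solved by Fourier series,
smoothly in the parameters (`exists_torusLaplacian_eq`).

There remain the arrays that depend on w₁ only. Closedness makes a_{jk} with j, k ≠ 0 constant; a₁₁
and a₂₂ then vanish because the deck group scales them by |λ|^{±2}, while a₁₂ and a₂₁ are free. The
coefficient a₀₀ is a function on the base torus and counts modulo ∂₀∂̄₀, so only its mean survives.
This gives three classes for every t. The mixed coefficients a₀ₖ, and the conjugates of aₖ₀, are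
entire in w₁ with multipliers e^{∓c̄} under w₁ ↦ w₁ + c - t c̄. By Liouville such a function is a
multiple of one exponential (`eq_exp_of_multiplier`), and it is nonzero only if certain phases are
trivial on Γ₁ (`exp_multiplierPhase_eq_one`). For t = 0 the phases are trivial and four more classes
appear, 3 + 4 = 7. For small t ≠ 0 the generators 2πi and log λ exclude this
(`exists_multiplierPhase_ne`), and 3 remains. -/

noncomputable section

/-! ## Fourier analysis along a linear family of periods -/

section TorusFourier

open MeasureTheory Set UnitAddTorus

variable {ι : Type} [Fintype ι] {E : Type} [NormedAddCommGroup E] [NormedSpace ℝ E]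
  [FiniteDimensional ℝ E]

/-- Lebesgue measure on the unit cube `(0, 1]^ι`. -/
def cubeMeasure (ι : Type*) [Fintype ι] : Measure (ι → ℝ) :=
  volume.restrict {x | ∀ i, x i ∈ Ioc (0 : ℝ) (0 + 1)}

theorem cube_eq_pi : {x : ι → ℝ | ∀ i, x i ∈ Ioc (0 : ℝ) (0 + 1)} =
    Set.pi univ fun _ ↦ Ioc (0 : ℝ) (0 + 1) := by
  ext x; simp

theorem measurableSet_cube : MeasurableSet {x : ι → ℝ | ∀ i, x i ∈ Ioc (0 : ℝ) (0 + 1)} := by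
  rw [cube_eq_pi]
  exact MeasurableSet.univ_pi fun _ ↦ measurableSet_Ioc

instance : IsProbabilityMeasure (cubeMeasure ι) := by
  constructor
  rw [cubeMeasure, Measure.restrict_apply_univ, cube_eq_pi, Real.volume_pi_Ioc]
  simp

theorem ae_cubeMeasure_norm_le : ∀ᵐ x ∂(cubeMeasure ι), ‖x‖ ≤ 1 := by
  refine (ae_restrict_iff' measurableSet_cube).2 (Filter.Eventually.of_forall fun x hx ↦ ?_)
  rw [pi_norm_le_iff_of_nonneg zero_le_one]
  intro i
  have := hx i
  simp only [zero_add, mem_Ioc] at this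
  rw [Real.norm_eq_abs, abs_le]
  constructor <;> linarith [this.1, this.2]

theorem integrable_cubeMeasure {F : Type*} [NormedAddCommGroup F]
    {f : (ι → ℝ) → F} (hf : Continuous f) :
    Integrable f (cubeMeasure ι) := by
  obtain ⟨C, hC⟩ := (isCompact_closedBall (0 : ι → ℝ) 1).exists_bound_of_continuousOn
    hf.continuousOn
  refine Integrable.of_bound hf.aestronglyMeasurable C ?_
  filter_upwards [ae_cubeMeasure_norm_le] with x hx
  exact hC x (by simpa using hx)

section Smooth

variable {F : Type*} [NormedAddCommGroup F] [NormedSpace ℝ F] [NormedSpace ℂ F]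
  [IsScalarTower ℝ ℂ F]

/-- Differentiation under the integral sign. A constant dominates, since the derivative of the
integrand is continuous on a compact product of balls and the cube lies in the unit ball. -/
theorem hasFDerivAt_cubeIntegral (B : (ι → ℝ) →L[ℝ] E) {K : (ι → ℝ) → ℂ} (hK : Continuous K)
    {h : E → F} (hh : ContDiff ℝ 1 h) (p : E) :
    HasFDerivAt (fun p ↦ ∫ x, K x • h (p + B x) ∂(cubeMeasure ι))
      (∫ x, K x • fderiv ℝ h (p + B x) ∂(cubeMeasure ι)) p := by
  have hd : Continuous (fderiv ℝ h) := hh.continuous_fderiv one_ne_zero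
  have hc := hh.continuous
  have hbd : Continuous fun q : E × (ι → ℝ) ↦ K q.2 • fderiv ℝ h (q.1 + B q.2) := by fun_prop
  obtain ⟨C, hC⟩ := ((isCompact_closedBall p 1).prod
    (isCompact_closedBall (0 : ι → ℝ) 1)).exists_bound_of_continuousOn
      (f := fun q : E × (ι → ℝ) ↦ K q.2 • fderiv ℝ h (q.1 + B q.2)) hbd.continuousOn
  refine hasFDerivAt_integral_of_dominated_of_fderiv_le (𝕜 := ℝ) (bound := fun _ ↦ C)
    (s := Metric.closedBall p 1)
    (F' := fun q x ↦ K x • fderiv ℝ h (q + B x)) (Metric.closedBall_mem_nhds p one_pos)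
    (Filter.Eventually.of_forall fun q ↦ ?_) (integrable_cubeMeasure ?_) ?_ ?_
    (integrable_const _) ?_
  · exact Continuous.aestronglyMeasurable (by fun_prop)
  · fun_prop
  · exact Continuous.aestronglyMeasurable (by fun_prop)
  · filter_upwards [ae_cubeMeasure_norm_le] with x hx q hq
    exact hC (q, x) ⟨hq, by simpa using hx⟩
  · refine Filter.Eventually.of_forall fun x q _ ↦ ?_
    have h1 : HasFDerivAt h (fderiv ℝ h (q + B x)) (q + B x) :=
      (hh.differentiable one_ne_zero _).hasFDerivAt
    exact ((hasFDerivAt_comp_add_right (B x)).2 h1).const_smul (K x)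

end Smooth

/-- Induction on the order. The target `F` is quantified inside the statement because the inductive
step replaces `h` by `fderiv ℝ h`, which has another target. -/
theorem contDiff_cubeIntegral_nat (B : (ι → ℝ) →L[ℝ] E) {K : (ι → ℝ) → ℂ} (hK : Continuous K)
    (n : ℕ) : ∀ {F : Type} [NormedAddCommGroup F] [NormedSpace ℝ F] [NormedSpace ℂ F]
    [IsScalarTower ℝ ℂ F] {h : E → F} (_ : ContDiff ℝ n h),
    ContDiff ℝ n (fun p ↦ ∫ x, K x • h (p + B x) ∂(cubeMeasure ι)) := by
  induction n with
  | zero =>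
    intro F _ _ _ _ h hh
    rw [Nat.cast_zero, contDiff_zero] at hh ⊢
    have := continuous_parametric_integral_of_continuous (μ := cubeMeasure ι)
      (f := fun p x ↦ K x • h (p + B x)) (by unfold Function.uncurry; fun_prop)
      (isCompact_closedBall (0 : ι → ℝ) 1)
    convert this using 2 with p
    refine (setIntegral_eq_integral_of_ae_compl_eq_zero ?_).symm
    filter_upwards [ae_cubeMeasure_norm_le] with x hx hx'
    exact absurd (by simpa using hx) hx'
  | succ n ih =>
    intro F _ _ _ _ h hh
    rw [Nat.cast_succ, contDiff_succ_iff_fderiv]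
    have h1 : ContDiff ℝ 1 h := hh.of_le (by norm_cast; omega)
    refine ⟨fun p ↦ (hasFDerivAt_cubeIntegral B hK h1 p).differentiableAt, by simp, ?_⟩
    have : fderiv ℝ (fun p ↦ ∫ x, K x • h (p + B x) ∂(cubeMeasure ι)) =
        fun p ↦ ∫ x, K x • fderiv ℝ h (p + B x) ∂(cubeMeasure ι) :=
      funext fun p ↦ (hasFDerivAt_cubeIntegral B hK h1 p).fderiv
    rw [this]
    exact ih (hh.fderiv_right (by norm_cast))

theorem contDiff_cubeIntegral (B : (ι → ℝ) →L[ℝ] E) {K : (ι → ℝ) → ℂ} (hK : Continuous K)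
    {h : E → ℂ} (hh : ContDiff ℝ ∞ h) :
    ContDiff ℝ ∞ (fun p ↦ ∫ x, K x * h (p + B x) ∂(cubeMeasure ι)) :=
  contDiff_infty.2 fun n ↦ contDiff_cubeIntegral_nat B hK n (contDiff_infty.1 hh n)

/-- The directional derivative `D_v g`. -/
def dirDeriv (v : E) (g : E → ℂ) (p : E) : ℂ := fderiv ℝ g p v

theorem ContDiff.dirDeriv {g : E → ℂ} (hg : ContDiff ℝ ∞ g) (v : E) :
    ContDiff ℝ ∞ (dirDeriv v g) :=
  (hg.fderiv_right (m := ∞) (by simp)).clm_apply contDiff_const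

theorem dirDeriv_cubeIntegral (B : (ι → ℝ) →L[ℝ] E) {K : (ι → ℝ) → ℂ} (hK : Continuous K)
    {h : E → ℂ} (hh : ContDiff ℝ ∞ h) (v : E) :
    dirDeriv v (fun p ↦ ∫ x, K x * h (p + B x) ∂(cubeMeasure ι)) =
      fun p ↦ ∫ x, K x * dirDeriv v h (p + B x) ∂(cubeMeasure ι) := by
  funext p
  have h1 : ContDiff ℝ 1 h := hh.of_le (by simp)
  have hc : Continuous (fderiv ℝ h) := h1.continuous_fderiv one_ne_zero
  have := (hasFDerivAt_cubeIntegral B hK h1 p).fderiv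
  simp only [smul_eq_mul] at this
  rw [dirDeriv, this, ContinuousLinearMap.integral_apply]
  · rfl
  · exact integrable_cubeMeasure (by fun_prop)

/-- The character `x ↦ exp (2πi n·x)`. -/
def torusChar (n : ι → ℤ) (x : ι → ℝ) : ℂ := mFourier n fun i ↦ (x i : UnitAddCircle)

theorem torusChar_eq (n : ι → ℤ) (x : ι → ℝ) :
    torusChar n x = Complex.exp (2 * Real.pi * I * ((∑ i, n i * x i : ℝ) : ℂ)) := by
  simp only [torusChar, mFourier, ContinuousMap.coe_mk, fourier_coe_apply]
  rw [← Complex.exp_sum]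
  congr 1
  push_cast
  rw [Finset.mul_sum]
  refine Finset.sum_congr rfl fun i _ ↦ ?_
  ring

theorem continuous_torusChar (n : ι → ℤ) : Continuous (torusChar n) := by
  have : torusChar n = fun x ↦ Complex.exp (2 * Real.pi * I * ((∑ i, n i * x i : ℝ) : ℂ)) :=
    funext (torusChar_eq n)
  rw [this]
  fun_prop

theorem norm_torusChar (n : ι → ℤ) (x : ι → ℝ) : ‖torusChar n x‖ = 1 := by
  rw [torusChar_eq, show (2 * Real.pi * I * ((∑ i, n i * x i : ℝ) : ℂ)) =
    ((2 * Real.pi * (∑ i, n i * x i) : ℝ) : ℂ) * I by push_cast; ring, Complex.norm_exp_ofReal_mul_I]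

/-- `g` has the periods `B n`, `n ∈ ℤ^ι`. -/
def IsPeriodic (B : (ι → ℝ) →L[ℝ] E) (g : E → ℂ) : Prop :=
  ∀ (p : E) (n : ι → ℤ), g (p + B fun i ↦ (n i : ℝ)) = g p

theorem IsPeriodic.dirDeriv {B : (ι → ℝ) →L[ℝ] E} {g : E → ℂ} (hg : IsPeriodic B g) (v : E) :
    IsPeriodic B (dirDeriv v g) := by
  intro p n
  have : (fun q ↦ g (q + B fun i ↦ (n i : ℝ))) = g := funext fun q ↦ hg q n
  unfold _root_.dirDeriv
  rw [← fderiv_comp_add_right, this]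

/-- The `n`-th Fourier coefficient of `x ↦ g (p + B x)`. -/
def fcoeff (B : (ι → ℝ) →L[ℝ] E) (n : ι → ℤ) (g : E → ℂ) (p : E) : ℂ :=
  ∫ x, torusChar (-n) x * g (p + B x) ∂(cubeMeasure ι)

/-- Periodicity lets `x ↦ g (p + B x)` descend along the open quotient map from ℝ^ι to the torus.
The Fourier theory of `UnitAddTorus` is applied to the descended function. -/
theorem exists_torus_lift {B : (ι → ℝ) →L[ℝ] E} {g : E → ℂ} (hc : Continuous g)
    (hg : IsPeriodic B g) (p : E) :
    ∃ G : C(UnitAddTorus ι, ℂ), ∀ x : ι → ℝ, G (fun i ↦ (x i : UnitAddCircle)) = g (p + B x) := by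
  have hq : IsOpenQuotientMap (Pi.map fun (_ : ι) (x : ℝ) ↦ (x : UnitAddCircle)) :=
    IsOpenQuotientMap.piMap fun i ↦ QuotientAddGroup.isOpenQuotientMap_mk
  have key : ∀ x y : ι → ℝ, (Pi.map (fun (_ : ι) (x : ℝ) ↦ (x : UnitAddCircle)) x =
      Pi.map (fun (_ : ι) (x : ℝ) ↦ (x : UnitAddCircle)) y) → g (p + B x) = g (p + B y) := by
    intro x y hxy
    have : ∀ i, ∃ n : ℤ, x i = y i + n := by
      intro i
      have h1 : ((x i - y i : ℝ) : UnitAddCircle) = 0 := by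
        rw [AddCircle.coe_sub, sub_eq_zero]
        exact congrFun hxy i
      obtain ⟨n, hn⟩ := (AddCircle.coe_eq_zero_iff (p := (1 : ℝ))).1 h1
      exact ⟨n, by rw [zsmul_one] at hn; linarith⟩
    choose n hn using this
    rw [show x = y + fun i ↦ (n i : ℝ) from funext hn, map_add, ← add_assoc, hg]
  obtain ⟨G, hG⟩ : ∃ G : UnitAddTorus ι → ℂ, ∀ x : ι → ℝ,
      G (fun i ↦ (x i : UnitAddCircle)) = g (p + B x) :=
    ⟨fun y ↦ g (p + B (hq.surjective y).choose), fun x ↦ key _ _ (hq.surjective _).choose_spec⟩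
  refine ⟨⟨G, ?_⟩, hG⟩
  rw [← hq.continuous_comp_iff]
  have : G ∘ (Pi.map fun (_ : ι) (x : ℝ) ↦ (x : UnitAddCircle)) = fun x ↦ g (p + B x) :=
    funext hG
  rw [this]
  fun_prop

local instance : MeasureSpace UnitAddCircle := ⟨AddCircle.haarAddCircle⟩

local instance : Measure.IsAddHaarMeasure (volume : Measure UnitAddCircle) :=
  inferInstanceAs (Measure.IsAddHaarMeasure AddCircle.haarAddCircle)

theorem fcoeff_eq_mFourierCoeff (B : (ι → ℝ) →L[ℝ] E) (g : E → ℂ) (p : E)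
    (G : C(UnitAddTorus ι, ℂ))
    (hG : ∀ x : ι → ℝ, G (fun i ↦ (x i : UnitAddCircle)) = g (p + B x)) (n : ι → ℤ) :
    fcoeff B n g p = mFourierCoeff G n := by
  rw [mFourierCoeff_eq_integral _ _ 0]
  simp only [fcoeff, cubeMeasure, torusChar, smul_eq_mul, hG, Pi.zero_apply]

/-- Invariance of Haar measure. Both the rule for derivatives and the constancy of averages along
the torus follow from it. -/
theorem fcoeff_translate {B : (ι → ℝ) →L[ℝ] E} {g : E → ℂ} (hc : Continuous g)
    (hg : IsPeriodic B g) (n : ι → ℤ) (p : E) (s : ι → ℝ) :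
    fcoeff B n g (p + B s) = torusChar n s * fcoeff B n g p := by
  obtain ⟨G, hG⟩ := exists_torus_lift hc hg p
  let S : UnitAddTorus ι := fun i ↦ (s i : UnitAddCircle)
  let G' : C(UnitAddTorus ι, ℂ) := ⟨fun y ↦ G (y + S), by fun_prop⟩
  have hG' : ∀ x : ι → ℝ, G' (fun i ↦ (x i : UnitAddCircle)) = g (p + B s + B x) := by
    intro x
    have := hG (x + s)
    rw [map_add, add_comm (B x), ← add_assoc] at this
    rw [← this]
    rfl
  rw [fcoeff_eq_mFourierCoeff B g p G hG, fcoeff_eq_mFourierCoeff B g _ G' hG']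
  have h1 := integral_add_right_eq_self (μ := (volume : Measure (UnitAddTorus ι)))
    (fun y ↦ mFourier (-n) y • G y) S
  unfold mFourierCoeff
  rw [← h1, ← integral_const_mul]
  congr 1
  funext y
  have h2 : mFourier (-n) (y + S) = mFourier (-n) y * mFourier (-n) S := by
    simp only [mFourier, ContinuousMap.coe_mk, Pi.add_apply, ← Finset.prod_mul_distrib]
    refine Finset.prod_congr rfl fun i _ ↦ ?_
    simp [fourier_apply, AddCircle.toCircle_add]
  have h3 : mFourier n S * mFourier (-n) S = 1 := by
    rw [← mFourier_add, add_neg_cancel, mFourier_zero]; rfl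
  rw [h2]
  change mFourier (-n) y • G (y + S) = mFourier n S * ((mFourier (-n) y * mFourier (-n) S) • G (y + S))
  simp only [smul_eq_mul]
  linear_combination (-(mFourier (-n) y * G (y + S))) * h3

/-- The Fourier series of the function lifted at `p` is evaluated at the origin of the torus, where
every character is 1. -/
theorem hasSum_fcoeff {B : (ι → ℝ) →L[ℝ] E} {g : E → ℂ} (hc : Continuous g)
    (hg : IsPeriodic B g) (p : E) (hs : Summable fun n ↦ fcoeff B n g p) :
    HasSum (fun n ↦ fcoeff B n g p) (g p) := by
  obtain ⟨G, hG⟩ := exists_torus_lift hc hg p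
  have hco := fcoeff_eq_mFourierCoeff B g p G hG
  have h0 : (fun i : ι ↦ (((0 : ι → ℝ) i : ℝ) : UnitAddCircle)) = 0 := by
    funext i; simp
  have h1 := hasSum_mFourier_series_apply_of_summable (f := G)
    (by simpa only [hco] using hs) (fun i : ι ↦ (((0 : ι → ℝ) i : ℝ) : UnitAddCircle))
  rw [hG, map_zero, add_zero] at h1
  convert h1 using 2 with n
  rw [hco]
  have : mFourier n (fun i : ι ↦ (((0 : ι → ℝ) i : ℝ) : UnitAddCircle)) = 1 := by
    rw [← torusChar, torusChar_eq]; simp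
  rw [this]; simp

/-- No integration by parts is needed: the derivative passes through the integral, and by
`fcoeff_translate` the coefficient is an exponential in `s` along the line `p + s • B x`. -/
theorem fcoeff_dirDeriv {B : (ι → ℝ) →L[ℝ] E} {g : E → ℂ} (hs : ContDiff ℝ ∞ g)
    (hg : IsPeriodic B g) (n : ι → ℤ) (x : ι → ℝ) :
    fcoeff B n (dirDeriv (B x) g) =
      fun p ↦ 2 * Real.pi * I * ((∑ i, n i * x i : ℝ) : ℂ) * fcoeff B n g p := by
  have hD := dirDeriv_cubeIntegral B (continuous_torusChar (-n)) hs (B x)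
  funext p
  change (fun p ↦ ∫ y, torusChar (-n) y * dirDeriv (B x) g (p + B y) ∂(cubeMeasure ι)) p = _
  rw [← hD]
  change fderiv ℝ (fcoeff B n g) p (B x) = _
  have hsm : ContDiff ℝ ∞ (fcoeff B n g) := contDiff_cubeIntegral B (continuous_torusChar (-n)) hs
  have h1 : HasDerivAt (fun s : ℝ ↦ fcoeff B n g (p + s • B x)) (fderiv ℝ (fcoeff B n g) p (B x))
      0 := by
    have h2 : HasFDerivAt (fcoeff B n g) (fderiv ℝ (fcoeff B n g) p) (p + (0 : ℝ) • B x) := by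
      rw [zero_smul, add_zero]
      exact (hsm.differentiable (by simp) p).hasFDerivAt
    have h3 : HasDerivAt (fun s : ℝ ↦ p + s • B x) (B x) 0 := by
      simpa using ((hasDerivAt_id (0 : ℝ)).smul_const (B x)).const_add p
    exact h2.comp_hasDerivAt 0 h3
  have h4 : (fun s : ℝ ↦ fcoeff B n g (p + s • B x)) = fun s : ℝ ↦
      Complex.exp ((s : ℂ) * (2 * Real.pi * I * ((∑ i, n i * x i : ℝ) : ℂ))) * fcoeff B n g p := by
    funext s
    rw [← map_smul, fcoeff_translate hs.continuous hg, torusChar_eq]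
    congr 2
    simp only [Pi.smul_apply, smul_eq_mul]
    rw [show ∑ i, (n i : ℝ) * (s * x i) = s * ∑ i, n i * x i by
      rw [Finset.mul_sum]; exact Finset.sum_congr rfl fun i _ ↦ by ring]
    push_cast
    ring
  rw [h4] at h1
  have h5 : HasDerivAt (fun s : ℝ ↦
      Complex.exp ((s : ℂ) * (2 * Real.pi * I * ((∑ i, n i * x i : ℝ) : ℂ))) * fcoeff B n g p)
      (2 * Real.pi * I * ((∑ i, n i * x i : ℝ) : ℂ) * fcoeff B n g p) 0 := by
    have h6 := ((((hasDerivAt_id (0 : ℝ)).ofReal_comp).mul_const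
      (2 * Real.pi * I * ((∑ i, n i * x i : ℝ) : ℂ))).cexp).mul_const (fcoeff B n g p)
    simpa using h6
  exact h1.unique h5

/-- The average of `g` over the torus through `p` in the directions of `B`. -/
def torusAvg (B : (ι → ℝ) →L[ℝ] E) (g : E → ℂ) (p : E) : ℂ := ∫ x, g (p + B x) ∂(cubeMeasure ι)

theorem torusAvg_eq (B : (ι → ℝ) →L[ℝ] E) (g : E → ℂ) :
    torusAvg B g = fun p ↦ ∫ x, (1 : ℂ) * g (p + B x) ∂(cubeMeasure ι) := by
  simp [torusAvg, funext_iff]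

theorem torusAvg_eq_fcoeff (B : (ι → ℝ) →L[ℝ] E) (g : E → ℂ) : torusAvg B g = fcoeff B 0 g := by
  funext p
  simp [torusAvg, fcoeff, torusChar_eq]

theorem ContDiff.torusAvg (B : (ι → ℝ) →L[ℝ] E) {g : E → ℂ} (hg : ContDiff ℝ ∞ g) :
    ContDiff ℝ ∞ (torusAvg B g) := by
  rw [torusAvg_eq]
  exact contDiff_cubeIntegral B continuous_const hg

theorem dirDeriv_torusAvg (B : (ι → ℝ) →L[ℝ] E) {g : E → ℂ} (hg : ContDiff ℝ ∞ g) (v : E) :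
    dirDeriv v (torusAvg B g) = torusAvg B (dirDeriv v g) := by
  rw [torusAvg_eq, torusAvg_eq]
  exact dirDeriv_cubeIntegral B continuous_const hg v

theorem torusAvg_translate {B : (ι → ℝ) →L[ℝ] E} {g : E → ℂ} (hc : Continuous g)
    (hg : IsPeriodic B g) (p : E) (s : ι → ℝ) : torusAvg B g (p + B s) = torusAvg B g p := by
  rw [torusAvg_eq_fcoeff, fcoeff_translate hc hg]
  simp [torusChar_eq]

theorem torusAvg_of_translate {B : (ι → ℝ) →L[ℝ] E} {g : E → ℂ}
    (hg : ∀ p s, g (p + B s) = g p) : torusAvg B g = g := by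
  funext p
  simp [torusAvg, hg]

theorem torusAvg_add (B : (ι → ℝ) →L[ℝ] E) {f g : E → ℂ} (hf : Continuous f) (hg : Continuous g) :
    torusAvg B (f + g) = torusAvg B f + torusAvg B g := by
  funext p
  exact integral_add (integrable_cubeMeasure (by fun_prop)) (integrable_cubeMeasure (by fun_prop))

theorem torusAvg_smul (B : (ι → ℝ) →L[ℝ] E) (c : ℂ) (g : E → ℂ) :
    torusAvg B (c • g) = c • torusAvg B g := by
  funext p
  exact integral_const_mul c _

/-- The operator `∑ₖ D_{B xₖ}²`. -/
def torusLaplacian {κ : Type} [Fintype κ] (B : (ι → ℝ) →L[ℝ] E) (x : κ → ι → ℝ) (g : E → ℂ) :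
    E → ℂ :=
  ∑ k, dirDeriv (B (x k)) (dirDeriv (B (x k)) g)

/-! ### Laplacians along a torus: eigenvalues, uniqueness and the Poisson equation. -/

section Laplacian

variable {κ : Type} [Fintype κ] (B : (ι → ℝ) →L[ℝ] E) (x : κ → ι → ℝ)

theorem ContDiff.torusLaplacian {g : E → ℂ} (hg : ContDiff ℝ ∞ g) :
    ContDiff ℝ ∞ (torusLaplacian B x g) := by
  have : _root_.torusLaplacian B x g =
      fun p ↦ ∑ k, _root_.dirDeriv (B (x k)) (_root_.dirDeriv (B (x k)) g) p := by
    funext p; simp [_root_.torusLaplacian]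
  rw [this]
  exact ContDiff.sum fun k _ ↦ (hg.dirDeriv _).dirDeriv _

variable {B} in
theorem IsPeriodic.torusLaplacian {g : E → ℂ} (hg : IsPeriodic B g) :
    IsPeriodic B (torusLaplacian B x g) := by
  intro p n
  simp only [_root_.torusLaplacian, Finset.sum_apply]
  exact Finset.sum_congr rfl fun k _ ↦ (hg.dirDeriv _).dirDeriv _ p n

/-- The eigenvalues of `-torusLaplacian`. -/
def torusEigenvalue (x : κ → ι → ℝ) (n : ι → ℤ) : ℝ :=
  (2 * Real.pi) ^ 2 * ∑ k, (∑ i, n i * x k i) ^ 2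

variable {B} in
theorem fcoeff_torusLaplacian {g : E → ℂ} (hs : ContDiff ℝ ∞ g) (hg : IsPeriodic B g)
    (n : ι → ℤ) (p : E) :
    fcoeff B n (torusLaplacian B x g) p = -torusEigenvalue x n * fcoeff B n g p := by
  have h1 : fcoeff B n (torusLaplacian B x g) p =
      ∑ k, fcoeff B n (dirDeriv (B (x k)) (dirDeriv (B (x k)) g)) p := by
    unfold fcoeff torusLaplacian
    rw [← integral_finsetSum]
    · simp only [Finset.sum_apply, Finset.mul_sum]
    · intro k _
      have := (((hs.dirDeriv (B (x k))).dirDeriv (B (x k)))).continuous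
      have := continuous_torusChar (-n)
      exact integrable_cubeMeasure (by fun_prop)
  rw [h1]
  simp only [fcoeff_dirDeriv (hs.dirDeriv _) (hg.dirDeriv _), fcoeff_dirDeriv hs hg,
    torusEigenvalue]
  push_cast
  rw [Finset.mul_sum, ← Finset.sum_neg_distrib, Finset.sum_mul]
  refine Finset.sum_congr rfl fun k _ ↦ ?_
  linear_combination (4 * (Real.pi : ℂ) ^ 2 * (∑ i, (n i : ℂ) * (x k i : ℂ)) ^ 2 * fcoeff B n g p) *
    Complex.I_sq

variable {x}

/-- The hypothesis `hx` says that the vectors `x k` span ℝ^ι. Then y ↦ (y · x k)ₖ is injective,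
hence bounded below, and the eigenvalues grow quadratically. -/
theorem exists_torusEigenvalue_ge
    (hx : ∀ y : ι → ℝ, (∀ k, ∑ i, y i * x k i = 0) → y = 0) :
    ∃ c : ℝ, 0 < c ∧ ∀ n : ι → ℤ, c * ‖(fun i ↦ (n i : ℝ) : ι → ℝ)‖ ^ 2 ≤ torusEigenvalue x n := by
  let f : (ι → ℝ) →ₗ[ℝ] (κ → ℝ) := LinearMap.pi fun k ↦ ∑ i, x k i • LinearMap.proj i
  have hf : ∀ y k, f y k = ∑ i, y i * x k i := by
    intro y k
    simp [f, mul_comm]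
  obtain ⟨K, hK0, hK⟩ := f.exists_antilipschitzWith (by
    rw [LinearMap.ker_eq_bot']
    intro y hy
    exact hx y fun k ↦ by rw [← hf, hy]; rfl)
  have hK0' : (0 : ℝ) < K := hK0
  refine ⟨(2 * Real.pi) ^ 2 * (K ^ 2 : ℝ)⁻¹, by positivity, fun n ↦ ?_⟩
  set y : ι → ℝ := fun i ↦ (n i : ℝ) with hy
  have h1 : ‖y‖ ≤ K * ‖f y‖ := by
    simpa using ZeroHomClass.bound_of_antilipschitz f hK y
  have h2 : ‖f y‖ ≤ √(∑ k, (f y k) ^ 2) := by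
    rw [pi_norm_le_iff_of_nonneg (Real.sqrt_nonneg _)]
    intro k
    refine Real.le_sqrt_of_sq_le ?_
    rw [Real.norm_eq_abs, sq_abs]
    exact Finset.single_le_sum (f := fun k ↦ (f y k) ^ 2) (fun _ _ ↦ sq_nonneg _) (Finset.mem_univ k)
  have h3 : ‖y‖ ^ 2 ≤ K ^ 2 * ∑ k, (f y k) ^ 2 := by
    calc ‖y‖ ^ 2 ≤ (K * √(∑ k, (f y k) ^ 2)) ^ 2 := by
          gcongr
          exact h1.trans (by gcongr)
      _ = _ := by rw [mul_pow, Real.sq_sqrt (Finset.sum_nonneg fun _ _ ↦ sq_nonneg _)]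
  rw [torusEigenvalue, mul_assoc]
  gcongr
  rw [inv_mul_le_iff₀ (by positivity)]
  simpa only [hf] using h3

/-- The cubes of the inverse eigenvalues are at most a multiple of ‖n‖⁻⁶, which is summable over a
lattice of rank below 6. -/
theorem summable_inv_torusEigenvalue_pow (hι : Fintype.card ι < 6)
    (hx : ∀ y : ι → ℝ, (∀ k, ∑ i, y i * x k i = 0) → y = 0) :
    Summable fun n : ι → ℤ ↦ ((torusEigenvalue x n)⁻¹) ^ 3 := by
  obtain ⟨c, hc, h⟩ := exists_torusEigenvalue_ge hx
  let Λ : Submodule ℤ (ι → ℝ) := Submodule.span ℤ (Set.range (Pi.basisFun ℝ ι))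
  have hr : Module.finrank ℤ Λ = Fintype.card ι := by
    rw [ZLattice.rank ℝ Λ, Module.finrank_fintype_fun_eq_card]
  have h1 := ZLattice.summable_norm_pow_inv (L := Λ) 6 (by omega)
  have hmem : ∀ n : ι → ℤ, (fun i ↦ (n i : ℝ)) ∈ Λ := by
    intro n
    rw [(Pi.basisFun ℝ ι).mem_span_iff_repr_mem ℤ]
    intro i
    exact ⟨n i, by simp⟩
  have h2 : Summable fun n : ι → ℤ ↦ (‖(fun i ↦ (n i : ℝ) : ι → ℝ)‖⁻¹) ^ 6 := by
    refine h1.comp_injective (i := fun n : ι → ℤ ↦ (⟨fun i ↦ (n i : ℝ), hmem n⟩ : Λ)) ?_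
    intro n m hnm
    funext i
    have := congrFun (congrArg Subtype.val hnm) i
    exact Int.cast_injective (α := ℝ) this
  refine Summable.of_nonneg_of_le (fun n ↦ ?_) (fun n ↦ ?_) (h2.mul_left ((c⁻¹) ^ 3))
  · have : 0 ≤ torusEigenvalue x n := by unfold torusEigenvalue; positivity
    positivity
  · have h3 : (torusEigenvalue x n)⁻¹ ≤ c⁻¹ * (‖(fun i ↦ (n i : ℝ) : ι → ℝ)‖⁻¹) ^ 2 := by
      -- For `n = 0` the eigenvalue is 0, and so is its inverse by convention.
      by_cases hn : n = 0
      · subst hn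
        simp only [torusEigenvalue, Pi.zero_apply, Int.cast_zero, zero_mul, Finset.sum_const_zero]
        simp only [ne_eq, OfNat.ofNat_ne_zero, not_false_eq_true, zero_pow, Finset.sum_const_zero,
          mul_zero, inv_zero]
        positivity
      · have h4 : 0 < ‖(fun i ↦ (n i : ℝ) : ι → ℝ)‖ := by
          rw [norm_pos_iff]
          intro h0
          exact hn (funext fun i ↦ Int.cast_injective (α := ℝ) (by simpa using congrFun h0 i))
        rw [inv_pow, ← mul_inv]
        exact inv_anti₀ (by positivity) (h n)
    calc ((torusEigenvalue x n)⁻¹) ^ 3 ≤ (c⁻¹ * (‖(fun i ↦ (n i : ℝ) : ι → ℝ)‖⁻¹) ^ 2) ^ 3 := by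
          have : 0 ≤ torusEigenvalue x n := by unfold torusEigenvalue; positivity
          gcongr
      _ = _ := by ring

theorem torusEigenvalue_ne_zero (hx : ∀ y : ι → ℝ, (∀ k, ∑ i, y i * x k i = 0) → y = 0)
    {n : ι → ℤ} (hn : n ≠ 0) : torusEigenvalue x n ≠ 0 := by
  obtain ⟨c, hc, h⟩ := exists_torusEigenvalue_ge hx
  have h4 : 0 < ‖(fun i ↦ (n i : ℝ) : ι → ℝ)‖ := by
    rw [norm_pos_iff]
    intro h0
    exact hn (funext fun i ↦ Int.cast_injective (α := ℝ) (by simpa using congrFun h0 i))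
  exact (lt_of_lt_of_le (by positivity) (h n)).ne'

variable {B} in
/-- A periodic function in the kernel of the Laplacian of the torus is constant along the torus. -/
theorem eq_torusAvg_of_torusLaplacian_eq_zero
    (hx : ∀ y : ι → ℝ, (∀ k, ∑ i, y i * x k i = 0) → y = 0) {g : E → ℂ}
    (hs : ContDiff ℝ ∞ g) (hg : IsPeriodic B g) (h0 : torusLaplacian B x g = 0) :
    g = torusAvg B g := by
  funext p
  have h1 : ∀ n ≠ 0, fcoeff B n g p = 0 := by
    intro n hn
    have h2 := fcoeff_torusLaplacian x hs hg n p
    rw [h0] at h2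
    have h3 : fcoeff B n (0 : E → ℂ) p = 0 := by simp [fcoeff]
    rw [h3] at h2
    have h4 : (-(torusEigenvalue x n : ℂ)) ≠ 0 := by
      rw [neg_ne_zero]
      exact_mod_cast torusEigenvalue_ne_zero hx hn
    exact (mul_eq_zero.1 h2.symm).resolve_left h4
  have h5 := hasSum_fcoeff hs.continuous hg p (summable_of_ne_finset_zero (s := {0})
    fun n hn ↦ h1 n (by simpa using hn))
  rw [torusAvg_eq_fcoeff]
  exact h5.unique (hasSum_single 0 h1)

omit [Fintype ι] [FiniteDimensional ℝ E] in
theorem dirDeriv_add_of_add {g : E → ℂ} {v : E} (hg : ∀ p, g (p + v) = g p) (w : E) (p : E) :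
    dirDeriv w g (p + v) = dirDeriv w g p := by
  have : (fun q ↦ g (q + v)) = g := funext hg
  unfold dirDeriv
  rw [← fderiv_comp_add_right, this]

theorem torusLaplacian_add_of_add {g : E → ℂ} {v : E} (hg : ∀ p, g (p + v) = g p) (p : E) :
    torusLaplacian B x g (p + v) = torusLaplacian B x g p := by
  simp only [torusLaplacian, Finset.sum_apply]
  exact Finset.sum_congr rfl fun k _ ↦ dirDeriv_add_of_add (dirDeriv_add_of_add hg _) _ p

theorem torusLaplacian_cubeIntegral {K : (ι → ℝ) → ℂ} (hK : Continuous K)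
    {h : E → ℂ} (hh : ContDiff ℝ ∞ h) :
    torusLaplacian B x (fun p ↦ ∫ y, K y * h (p + B y) ∂(cubeMeasure ι)) =
      fun p ↦ ∫ y, K y * torusLaplacian B x h (p + B y) ∂(cubeMeasure ι) := by
  funext p
  simp only [torusLaplacian, dirDeriv_cubeIntegral B hK hh, dirDeriv_cubeIntegral B hK
    (hh.dirDeriv _), Finset.sum_apply, Finset.mul_sum]
  rw [← integral_finsetSum]
  intro k _
  have := (((hh.dirDeriv (B (x k))).dirDeriv (B (x k)))).continuous
  exact integrable_cubeMeasure (by fun_prop)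

variable {B} in
/-- The Poisson equation on a torus, with smooth dependence on parameters. -/
theorem exists_torusLaplacian_eq (hι : Fintype.card ι < 6)
    (hx : ∀ y : ι → ℝ, (∀ k, ∑ i, y i * x k i = 0) → y = 0) {g : E → ℂ}
    (hs : ContDiff ℝ ∞ g) (hg : IsPeriodic B g) (h0 : torusAvg B g = 0) :
    ∃ u : E → ℂ, ContDiff ℝ ∞ u ∧ torusAvg B u = 0 ∧ torusLaplacian B x u = g ∧
      ∀ v : E, (∀ p, g (p + v) = g p) → ∀ p, u (p + v) = u p := by
  -- These are the Fourier multipliers of the inverse of Δ³. They are absolutely summable, so they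
  -- define a continuous kernel `K`, and `u` is obtained by integrating `K` against Δ²g. Thus no
  -- decay of the coefficients of `g` has to be estimated, and smoothness in all variables comes
  -- from differentiation under the integral.
  set κ' : (ι → ℤ) → ℂ := fun n ↦ (-(torusEigenvalue x n : ℂ)⁻¹) ^ 3 with hκ
  have hκn : ∀ n, ‖κ' n‖ = ((torusEigenvalue x n)⁻¹) ^ 3 := by
    intro n
    have : 0 ≤ torusEigenvalue x n := by unfold torusEigenvalue; positivity
    simp [hκ, abs_of_nonneg this]
  have hκs : Summable fun n ↦ ‖κ' n‖ := by
    simp only [hκn]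
    exact summable_inv_torusEigenvalue_pow hι hx
  set K : (ι → ℝ) → ℂ := fun y ↦ ∑' n, κ' n * torusChar (-n) y with hK
  have hb : ∀ n y, ‖κ' n * torusChar (-n) y‖ ≤ ‖κ' n‖ := fun n y ↦ by
    rw [norm_mul, norm_torusChar, mul_one]
  have hKc : Continuous K :=
    continuous_tsum (fun n ↦ continuous_const.mul (continuous_torusChar _)) hκs hb
  have hKsum : ∀ {h : E → ℂ}, Continuous h → ∀ p, HasSum (fun n ↦ κ' n * fcoeff B n h p)
      (∫ y, K y * h (p + B y) ∂(cubeMeasure ι)) := by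
    intro h hh p
    have hi : Integrable (fun y ↦ h (p + B y)) (cubeMeasure ι) := integrable_cubeMeasure (by fun_prop)
    have h1 := hasSum_integral_of_summable_integral_norm (μ := cubeMeasure ι)
      (F := fun n y ↦ κ' n * torusChar (-n) y * h (p + B y))
      (fun n ↦ by
        have := continuous_torusChar (-n)
        exact integrable_cubeMeasure (by fun_prop))
      (by
        have : ∀ n : ι → ℤ, ∫ y, ‖κ' n * torusChar (-n) y * h (p + B y)‖ ∂(cubeMeasure ι) =
            ‖κ' n‖ * ∫ y, ‖h (p + B y)‖ ∂(cubeMeasure ι) := by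
          intro n
          rw [← integral_const_mul]
          congr 1
          funext y
          rw [norm_mul, norm_mul, norm_torusChar, mul_one]
        simp only [this]
        exact hκs.mul_right _)
    have h2 : ∀ n, ∫ y, κ' n * torusChar (-n) y * h (p + B y) ∂(cubeMeasure ι) =
        κ' n * fcoeff B n h p := by
      intro n
      rw [fcoeff, ← integral_const_mul]
      simp only [mul_assoc]
    simpa only [h2, tsum_mul_right] using h1
  set h : E → ℂ := torusLaplacian B x (torusLaplacian B x g) with hh
  have hhs : ContDiff ℝ ∞ h := (hs.torusLaplacian B x).torusLaplacian B x
  have hhp : IsPeriodic B h := (hg.torusLaplacian x).torusLaplacian x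
  set u₀ : E → ℂ := fun p ↦ ∫ y, K y * h (p + B y) ∂(cubeMeasure ι) with hu₀
  have hu₀s : ContDiff ℝ ∞ u₀ := contDiff_cubeIntegral B hKc hhs
  -- Every translation symmetry of `g` passes to the solution, also in directions outside the torus.
  -- This gives the periodicity of `u₀`, and later the constancy along the fibres of the potential
  -- on the base.
  have htrans : ∀ v : E, (∀ p, g (p + v) = g p) → ∀ p, u₀ (p + v) = u₀ p := by
    intro v hv p
    have h1 := torusLaplacian_add_of_add (x := x) B (torusLaplacian_add_of_add (x := x) B hv)
    simp only [hu₀]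
    congr 1
    funext y
    rw [add_right_comm, hh, h1]
  have hu₀p : IsPeriodic B u₀ := fun p n ↦ htrans _ (fun q ↦ hg q n) p
  have hΔ : torusLaplacian B x u₀ = g := by
    rw [hu₀, torusLaplacian_cubeIntegral B hKc hhs]
    funext p
    have h1 := hKsum (hhs.torusLaplacian B x).continuous p
    have h2 : (fun n ↦ κ' n * fcoeff B n (torusLaplacian B x h) p) = fun n ↦ fcoeff B n g p := by
      funext n
      by_cases hn : n = 0
      -- At `n = 0` the multiplier is zero, and the coefficient of `g` is its average, which is zero
      -- as well.
      · subst hn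
        rw [← torusAvg_eq_fcoeff B g, h0]
        simp [hκ, torusEigenvalue]
      · have hne : (torusEigenvalue x n : ℂ) ≠ 0 := by
          exact_mod_cast torusEigenvalue_ne_zero hx hn
        rw [fcoeff_torusLaplacian x hhs hhp, hh,
          fcoeff_torusLaplacian x (hs.torusLaplacian B x) (hg.torusLaplacian x),
          fcoeff_torusLaplacian x hs hg]
        simp only [hκ]
        field_simp
    rw [h2] at h1
    exact h1.unique (hasSum_fcoeff hs.continuous hg p h1.summable)
  have hPtrans := fun p s ↦ torusAvg_translate hu₀s.continuous hu₀p p s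
  have hPP : torusAvg B (torusAvg B u₀) = torusAvg B u₀ := torusAvg_of_translate hPtrans
  have hPs := hu₀s.torusAvg B
  -- Subtracting the average normalises the solution; the average is constant along the torus, so
  -- the Laplacian does not see it.
  refine ⟨u₀ + (-1 : ℂ) • torusAvg B u₀, hu₀s.add (hPs.const_smul (-1 : ℂ)), ?_, ?_, ?_⟩
  · rw [torusAvg_add B hu₀s.continuous (hPs.continuous.const_smul (-1 : ℂ)), torusAvg_smul, hPP]
    simp
  · have h1 : ∀ s, dirDeriv (B s) (torusAvg B u₀) = 0 := by
      intro s
      funext p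
      have h2 : HasDerivAt (fun r : ℝ ↦ torusAvg B u₀ (p + r • B s))
          (fderiv ℝ (torusAvg B u₀) p (B s)) 0 := by
        have h2 : HasFDerivAt (torusAvg B u₀) (fderiv ℝ (torusAvg B u₀) p)
            (p + (0 : ℝ) • B s) := by
          rw [zero_smul, add_zero]
          exact (hPs.differentiable (by simp) p).hasFDerivAt
        have h3 : HasDerivAt (fun r : ℝ ↦ p + r • B s) (B s) 0 := by
          simpa using ((hasDerivAt_id (0 : ℝ)).smul_const (B s)).const_add p
        exact h2.comp_hasDerivAt 0 h3
      simp only [← map_smul, hPtrans] at h2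
      exact h2.unique (hasDerivAt_const _ _)
    have h3 : ∀ s, dirDeriv (B s) (u₀ + (-1 : ℂ) • torusAvg B u₀) = dirDeriv (B s) u₀ := by
      intro s
      funext p
      have hd1 : DifferentiableAt ℝ u₀ p := hu₀s.differentiable (by simp) p
      have hd2 : DifferentiableAt ℝ (torusAvg B u₀) p := hPs.differentiable (by simp) p
      have h4 := congrFun (h1 s) p
      unfold dirDeriv at h4 ⊢
      rw [fderiv_add hd1 (hd2.const_smul (-1 : ℂ)), fderiv_const_smul hd2]
      simp [h4]
    rw [← hΔ]
    simp only [torusLaplacian, h3]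
  · intro v hv p
    have h1 := htrans v hv
    simp only [Pi.add_apply, Pi.smul_apply, h1, torusAvg]
    congr 3
    funext y
    rw [add_right_comm, h1]

end Laplacian

end TorusFourier

/-! ## Quotients of open subsets of a vector space by affine transformations -/

section AffineCovering

open Set Filter Topology

variable {E : Type} [NormedAddCommGroup E] [NormedSpace ℂ E]
  {M : Type} [TopologicalSpace M] [ChartedSpace E M]

/-- The map `π : E → M` restricts on `Ω` to the quotient by the relation generated by the complex
affine maps `p ↦ d.1 p + d.2`, `d ∈ D`, and the charts of `M` are local inverses of `π`. -/
structure IsAffineCovering (Ω : Set E) (D : Set ((E →L[ℂ] E) × E)) (π : E → M) : Prop where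
  symm_eq : ∀ e ∈ atlas E M, EqOn e.symm π e.target
  target_subset : ∀ e ∈ atlas E M, e.target ⊆ Ω
  mk_eq_iff : ∀ p ∈ Ω, ∀ q ∈ Ω, π p = π q ↔ ∃ d ∈ D, q = d.1 p + d.2
  mapsTo : ∀ d ∈ D, ∀ p ∈ Ω, d.1 p + d.2 ∈ Ω

namespace IsAffineCovering

variable {Ω : Set E} {D : Set ((E →L[ℂ] E) × E)} {π : E → M}

/-- One deck transformation matches the two charts at `p`. By continuity it maps a neighbourhood of
`p` into `e'.target`, where `e'` inverts `π`, so the same affine map is the transition map near `p`.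
-/
theorem eventually_transition (h : IsAffineCovering Ω D π) {e e' : OpenPartialHomeomorph M E}
    (he : e ∈ atlas E M) (he' : e' ∈ atlas E M) {p : E} (hp : p ∈ e.target)
    (hp' : e.symm p ∈ e'.source) : ∃ d ∈ D, (fun q ↦ e' (e.symm q)) =ᶠ[𝓝 p] fun q ↦ d.1 q + d.2 := by
  have hq : e' (e.symm p) ∈ e'.target := e'.map_source hp'
  have h1 : π p = π (e' (e.symm p)) := by
    rw [← h.symm_eq e he hp, ← h.symm_eq e' he' hq, e'.left_inv hp']
  obtain ⟨d, hd, hdq⟩ := (h.mk_eq_iff _ (h.target_subset e he hp) _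
    (h.target_subset e' he' hq)).1 h1
  refine ⟨d, hd, ?_⟩
  have hc : ContinuousAt (fun q ↦ d.1 q + d.2) p := by fun_prop
  have h2 : ∀ᶠ q in 𝓝 p, d.1 q + d.2 ∈ e'.target :=
    hc.eventually_mem (e'.open_target.mem_nhds (by rw [← hdq]; exact hq))
  filter_upwards [h2, e.open_target.mem_nhds hp] with q hq1 hq2
  have h3 : π q = π (d.1 q + d.2) := (h.mk_eq_iff _ (h.target_subset e he hq2) _
    (h.target_subset e' he' hq1)).2 ⟨d, hd, rfl⟩
  rw [h.symm_eq e he hq2, h3, ← h.symm_eq e' he' hq1, e'.right_inv hq1]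

theorem isManifold {𝕜 : Type} [NontriviallyNormedField 𝕜] [NormedSpace 𝕜 E] (n : ℕ∞ω)
    (h : IsAffineCovering Ω D π)
    (hD : ∀ d ∈ D, ContDiff 𝕜 n (fun p ↦ d.1 p + d.2)) : IsManifold 𝓘(𝕜, E) n M := by
  refine isManifold_of_contDiffOn _ _ _ fun e e' he he' ↦ ?_
  intro p hp
  simp only [mfld_simps] at hp
  obtain ⟨d, hd, hdq⟩ := h.eventually_transition he he' hp.1 hp.2
  refine ContDiffAt.contDiffWithinAt ?_
  exact ((hD d hd).contDiffAt (x := p)).congr_of_eventuallyEq hdq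

theorem contDiff_real (d : (E →L[ℂ] E) × E) (n : ℕ∞ω) : ContDiff ℝ n (fun p ↦ d.1 p + d.2) :=
  ((d.1.restrictScalars ℝ).contDiff).add contDiff_const

theorem isManifold_complex (h : IsAffineCovering Ω D π) : IsManifold 𝓘(ℂ, E) ω M :=
  h.isManifold _ fun d _ ↦ d.1.contDiff.add contDiff_const

theorem isManifold_real (h : IsAffineCovering Ω D π) : IsManifold 𝓘(ℝ, E) ∞ M :=
  h.isManifold _ fun d _ ↦ contDiff_real d _

end IsAffineCovering

/-- The tangent space at `x` is identified with `E` through the preferred chart. This makes the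
value of a form at `x` equal to that of its pull-back at the preferred coordinates of `x`. -/
theorem mfderiv_chartAt_symm [IsManifold 𝓘(ℝ, E) ∞ M] (x : M) :
    (mfderiv 𝓘(ℝ, E) 𝓘(ℝ, E) (chartAt E x).symm (chartAt E x x) : E →L[ℝ] E) =
      ContinuousLinearMap.id ℝ E := by
  have hmd : MDifferentiableAt 𝓘(ℝ, E) 𝓘(ℝ, E) (chartAt E x).symm (chartAt E x x) := by
    have := mdifferentiableOn_atlas_symm (I := 𝓘(ℝ, E)) (chart_mem_atlas E x)
    exact (this _ (mem_chart_target E x)).mdifferentiableAt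
      ((chartAt E x).open_target.mem_nhds (mem_chart_target E x))
  refine hmd.mfderiv.trans ?_
  have : (fun q ↦ (chartAt E ((chartAt E x).symm (chartAt E x x))) ((chartAt E x).symm q))
      =ᶠ[𝓝 (chartAt E x x)] id := by
    rw [(chartAt E x).left_inv (mem_chart_source E x)]
    filter_upwards [(chartAt E x).open_target.mem_nhds (mem_chart_target E x)] with q hq
    exact (chartAt E x).right_inv hq
  have h2 := this.fderiv_eq (𝕜 := ℝ)
  rw [fderiv_id] at h2
  refine Eq.trans ?_ h2
  simp only [mfld_simps]
  rw [fderivWithin_univ]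
  rfl

/-- The complex linear pull-back of an alternating form. -/
def linPullback {k : ℕ} (A : E →L[ℂ] E) (η : CForm E k) : CForm E k :=
  η.compContinuousLinearMap (A.restrictScalars ℝ)

/-- A form on `E` is invariant under the affine maps in `D`. -/
def IsInvariantForm {k : ℕ} (D : Set ((E →L[ℂ] E) × E)) (b : E → CForm E k) : Prop :=
  ∀ d ∈ D, ∀ p, linPullback d.1 (b (d.1 p + d.2)) = b p

/-- The form on `M` whose value at `x` is `b` at the preferred coordinates of `x`. -/
def descend {k : ℕ} (b : E → CForm E k) (x : M) : CForm E k := b (chartAt E x x)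

namespace IsAffineCovering

variable {D : Set ((E →L[ℂ] E) × E)} {π : E → M} {k : ℕ}

theorem map_affine (h : IsAffineCovering univ D π) {d : (E →L[ℂ] E) × E} (hd : d ∈ D) (p : E) :
    π (d.1 p + d.2) = π p :=
  ((h.mk_eq_iff p trivial _ trivial).2 ⟨d, hd, rfl⟩).symm

theorem map_chart (h : IsAffineCovering univ D π) (x : M) : π (chartAt E x x) = x := by
  rw [← h.symm_eq _ (chart_mem_atlas E x) (mem_chart_target E x),
    (chartAt E x).left_inv (mem_chart_source E x)]

theorem eventuallyEq_symm (h : IsAffineCovering univ D π) (x : M) {p : E}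
    (hp : p ∈ (chartAt E x).target) : (chartAt E x).symm =ᶠ[𝓝 p] π := by
  filter_upwards [(chartAt E x).open_target.mem_nhds hp] with q hq
  exact h.symm_eq _ (chart_mem_atlas E x) hq

theorem formInChart_eq (h : IsAffineCovering univ D π) (α : M → CForm E k) (x : M) {p : E}
    (hp : p ∈ (chartAt E x).target) : formInChart α x p = pullbackForm π α p := by
  have h1 := h.eventuallyEq_symm x hp
  rw [formInChart, pullbackForm, pullbackForm, h1.mfderiv_eq, h1.eq_of_nhds]

theorem mfderiv_chart (h : IsAffineCovering univ D π) (x : M) :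
    (mfderiv 𝓘(ℝ, E) 𝓘(ℝ, E) π (chartAt E x x) : E →L[ℝ] E) = ContinuousLinearMap.id ℝ E := by
  have := h.isManifold_real
  rw [← mfderiv_chartAt_symm x]
  exact (h.eventuallyEq_symm x (mem_chart_target E x)).symm.mfderiv_eq

theorem pullbackForm_chart (h : IsAffineCovering univ D π) (α : M → CForm E k) (x : M) :
    pullbackForm π α (chartAt E x x) = α x := by
  rw [pullbackForm, h.mfderiv_chart, h.map_chart]
  ext v
  rfl

/-- Statements are proved at preferred coordinates, where the derivative of `π` is the identity, and
are carried to an arbitrary `q` by this deck transformation. -/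
theorem exists_deck (h : IsAffineCovering univ D π) (q : E) :
    ∃ d ∈ D, chartAt E (π q) (π q) = d.1 q + d.2 :=
  (h.mk_eq_iff q trivial _ trivial).1 (h.map_chart (π q)).symm

theorem mdifferentiableAt (h : IsAffineCovering univ D π) (q : E) :
    MDifferentiableAt 𝓘(ℝ, E) 𝓘(ℝ, E) π q := by
  have := h.isManifold_real
  obtain ⟨d, hd, hdq⟩ := h.exists_deck q
  have h0 : MDifferentiableAt 𝓘(ℝ, E) 𝓘(ℝ, E) π (d.1 q + d.2) := by
    rw [← hdq]
    have h1 := mdifferentiableOn_atlas_symm (I := 𝓘(ℝ, E)) (chart_mem_atlas E (π q))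
    exact ((h1 _ (mem_chart_target E _)).mdifferentiableAt
      ((chartAt E (π q)).open_target.mem_nhds (mem_chart_target E _))).congr_of_eventuallyEq
      (h.eventuallyEq_symm _ (mem_chart_target E _)).symm
  have h2 : π = π ∘ fun p ↦ d.1 p + d.2 := funext fun p ↦ (h.map_affine hd p).symm
  rw [h2]
  exact h0.comp q ((contDiff_real d ∞).differentiable (by simp) q).mdifferentiableAt

theorem fderiv_affine (d : (E →L[ℂ] E) × E) (q : E) :
    fderiv ℝ (fun p ↦ d.1 p + d.2) q = d.1.restrictScalars ℝ := by
  rw [fderiv_add_const]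
  exact (d.1.restrictScalars ℝ).fderiv

theorem mfderiv_affine (h : IsAffineCovering univ D π) {d : (E →L[ℂ] E) × E} (hd : d ∈ D) (q : E) :
    (mfderiv 𝓘(ℝ, E) 𝓘(ℝ, E) π q : E →L[ℝ] E) =
      (mfderiv 𝓘(ℝ, E) 𝓘(ℝ, E) π (d.1 q + d.2) : E →L[ℝ] E).comp (d.1.restrictScalars ℝ) := by
  have h1 := mfderiv_comp q (h.mdifferentiableAt (d.1 q + d.2))
    (((contDiff_real d ∞).differentiable (by simp) q).mdifferentiableAt)
  have h2 : (π ∘ fun p ↦ d.1 p + d.2) = π := funext fun p ↦ h.map_affine hd p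
  rw [h2, mfderiv_eq_fderiv, fderiv_affine] at h1
  exact h1

theorem isInvariantForm_pullbackForm (h : IsAffineCovering univ D π) (α : M → CForm E k) :
    IsInvariantForm D (pullbackForm π α) := by
  intro d hd p
  rw [pullbackForm, pullbackForm, h.mfderiv_affine hd p, h.map_affine hd]
  ext v
  rfl

/-- With `descend_pullbackForm` this identifies the forms on `M` with the invariant forms on `E`. -/
theorem pullbackForm_descend (h : IsAffineCovering univ D π) {b : E → CForm E k}
    (hb : IsInvariantForm D b) : pullbackForm π (descend b : M → CForm E k) = b := by
  funext q
  obtain ⟨d, hd, hdq⟩ := h.exists_deck q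
  rw [pullbackForm, h.mfderiv_affine hd, ← hdq, h.mfderiv_chart, descend, hdq, ← hb d hd q]
  ext v
  rfl

theorem descend_pullbackForm (h : IsAffineCovering univ D π) (α : M → CForm E k) :
    descend (pullbackForm π α) = α :=
  funext fun x ↦ h.pullbackForm_chart α x

theorem contDiffAt_linPullback_affine {b : E → CForm E k} {d : (E →L[ℂ] E) × E} {q : E}
    (hb : ContDiffAt ℝ ∞ b (d.1 q + d.2)) :
    ContDiffAt ℝ ∞ (fun p ↦ linPullback d.1 (b (d.1 p + d.2))) q := by
  have h1 : ContDiffAt ℝ ∞ (fun p ↦ b (d.1 p + d.2)) q :=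
    hb.comp q (contDiff_real d ∞).contDiffAt
  let T : CForm E k →L[ℝ] CForm E k :=
    ContinuousAlternatingMap.compContinuousLinearMapCLM (d.1.restrictScalars ℝ)
  exact (T.contDiff.contDiffAt (x := b (d.1 q + d.2))).comp q h1

theorem isSmoothForm_iff (h : IsAffineCovering univ D π) (α : M → CForm E k) :
    IsSmoothForm α ↔ ContDiff ℝ ∞ (pullbackForm π α : E → CForm E k) := by
  constructor
  · intro hα
    rw [contDiff_iff_contDiffAt]
    intro q
    obtain ⟨d, hd, hdq⟩ := h.exists_deck q
    have h1 : ContDiffAt ℝ ∞ (pullbackForm π α : E → CForm E k) (d.1 q + d.2) := by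
      rw [← hdq]
      have h2 := (hα (π q)).contDiffAt ((chartAt E (π q)).open_target.mem_nhds
        (mem_chart_target E (π q)))
      refine h2.congr_of_eventuallyEq ?_
      filter_upwards [(chartAt E (π q)).open_target.mem_nhds (mem_chart_target E (π q))] with p hp
      exact (h.formInChart_eq α _ hp).symm
    have h3 := contDiffAt_linPullback_affine h1
    have h4 : (fun p ↦ linPullback d.1 (pullbackForm π α (d.1 p + d.2))) = pullbackForm π α :=
      funext fun p ↦ h.isInvariantForm_pullbackForm α d hd p
    rwa [h4] at h3
  · intro hα x
    exact hα.contDiffOn.congr fun p hp ↦ h.formInChart_eq α x hp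

theorem extDerivForm_eq (h : IsAffineCovering univ D π) (α : M → CForm E k) :
    extDerivForm α = descend (extDeriv (pullbackForm π α)) := by
  funext x
  refine Filter.EventuallyEq.extDeriv_eq ?_
  filter_upwards [(chartAt E x).open_target.mem_nhds (mem_chart_target E x)] with p hp
  exact h.formInChart_eq α _ hp

theorem isInvariantForm_extDeriv {b : E → CForm E k} (hb : IsInvariantForm D b)
    (hs : ContDiff ℝ ∞ b) : IsInvariantForm D (extDeriv b) := by
  intro d hd p
  have h1 := extDeriv_pullback (x := p) (r := ∞) (hs.differentiable (by simp) (d.1 p + d.2))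
    (contDiff_real d ∞).contDiffAt (by
      rw [minSmoothness_of_isRCLikeNormedField]; exact ENat.LEInfty.out)
  simp only [fderiv_affine] at h1
  have h2 : (fun p ↦ (b (d.1 p + d.2)).compContinuousLinearMap (d.1.restrictScalars ℝ)) = b :=
    funext fun p ↦ hb d hd p
  rw [h2] at h1
  exact h1.symm

end IsAffineCovering

/-- A complex linear map commutes with the multiplications by roots of unity over which
`typeComponent` averages. -/
theorem typeComponent_linPullback {k : ℕ} (p q : ℕ) (A : E →L[ℂ] E) (η : CForm E k) :
    typeComponent p q (linPullback A η) = linPullback A (typeComponent p q η) := by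
  ext v
  simp only [typeComponent, linPullback, ContinuousAlternatingMap.smul_apply,
    ContinuousAlternatingMap.sum_apply, ContinuousAlternatingMap.compContinuousLinearMap_apply]
  congr 1
  refine Finset.sum_congr rfl fun j _ ↦ ?_
  congr 2
  funext i
  simp

theorem IsInvariantForm.typeComponent {k : ℕ} {D : Set ((E →L[ℂ] E) × E)} {b : E → CForm E k}
    (hb : IsInvariantForm D b) (p q : ℕ) :
    IsInvariantForm D fun x ↦ typeComponent p q (b x) := by
  intro d hd x
  rw [← typeComponent_linPullback, hb d hd]

namespace IsAffineCovering

variable {D : Set ((E →L[ℂ] E) × E)} {π : E → M} {k : ℕ}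

theorem delForm_eq (h : IsAffineCovering univ D π) (p q : ℕ) (α : M → CForm E k) :
    delForm p q α = descend fun x ↦ typeComponent (p + 1) q (extDeriv (pullbackForm π α) x) := by
  funext x
  rw [delForm, h.extDerivForm_eq]
  rfl

theorem delbarForm_eq (h : IsAffineCovering univ D π) (p q : ℕ) (α : M → CForm E k) :
    delbarForm p q α = descend fun x ↦ typeComponent p (q + 1) (extDeriv (pullbackForm π α) x) := by
  funext x
  rw [delbarForm, h.extDerivForm_eq]
  rfl

end IsAffineCovering

end AffineCovering

/-! ## The affine coverings of the Nakamura manifold, of its deformations and of the family -/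

section Coverings

open Set Filter Topology

/-- The quotient of a space with a single chart by an action that is affine in this chart. -/
theorem isAffineCovering_quotient {E : Type} [NormedAddCommGroup E] [NormedSpace ℂ E]
    {G Γ : Type} [TopologicalSpace G] [Group Γ] [MulAction Γ G] [ProperlyDiscontinuousSMul Γ G]
    [ContinuousConstSMul Γ G] [IsCancelSMul Γ G] [T2Space G] [LocallyCompactSpace G]
    [ChartedSpace E G] (e : OpenPartialHomeomorph G E) (he : ∀ x : G, chartAt E x = e)
    (hs : e.source = univ) (D : Set ((E →L[ℂ] E) × E))
    (hD : ∀ γ : Γ, ∃ d ∈ D, ∀ x : G, e (γ • x) = d.1 (e x) + d.2)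
    (hD' : ∀ d ∈ D, ∃ γ : Γ, ∀ x : G, e (γ • x) = d.1 (e x) + d.2) :
    IsAffineCovering (M := MulAction.orbitRel.Quotient Γ G) e.target D
      (fun p ↦ Quotient.mk _ (e.symm p)) where
  symm_eq := by
    rintro _ ⟨q, rfl⟩ p hp
    simp only [he, OpenPartialHomeomorph.coe_trans_symm, Function.comp_apply]
    rw [IsLocalHomeomorph.localInverseAt_symm]
  target_subset := by
    rintro _ ⟨q, rfl⟩ p hp
    rw [OpenPartialHomeomorph.trans_target, he] at hp
    exact hp.1
  mk_eq_iff p hp q hq := by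
    have hsm : ∀ x : G, x ∈ e.source := fun x ↦ by rw [hs]; trivial
    rw [Quotient.eq, MulAction.orbitRel_apply]
    constructor
    · rintro ⟨γ, hγ⟩
      -- The orbit relation provides an element that moves `q` to `p`, whereas the deck
      -- transformation must move `p` to `q`.
      obtain ⟨d, hd, h⟩ := hD γ⁻¹
      refine ⟨d, hd, ?_⟩
      have h1 := h (e.symm p)
      rw [e.right_inv hp] at h1
      rw [← h1, ← hγ]
      simp only [inv_smul_smul, e.right_inv hq]
    · rintro ⟨d, hd, h⟩
      obtain ⟨γ, hγ⟩ := hD' d hd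
      refine ⟨γ⁻¹, ?_⟩
      have h1 := hγ (e.symm p)
      rw [e.right_inv hp, ← h] at h1
      simp only
      rw [inv_smul_eq_iff, ← h1, e.left_inv (hsm _)]
  mapsTo d hd p hp := by
    obtain ⟨γ, hγ⟩ := hD' d hd
    rw [← e.right_inv hp, ← hγ]
    exact e.map_source (by rw [hs]; trivial)

/-- The linear part of the deck transformations. -/
def nakLinear (c : ℂ) : ℂ × (ℂ × ℂ) →L[ℂ] ℂ × (ℂ × ℂ) :=
  (ContinuousLinearMap.fst ℂ ℂ (ℂ × ℂ)).prod
    ((Complex.exp c • (ContinuousLinearMap.fst ℂ ℂ ℂ ∘L ContinuousLinearMap.snd ℂ ℂ (ℂ × ℂ))).prod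
      (Complex.exp (-c) •
        (ContinuousLinearMap.snd ℂ ℂ ℂ ∘L ContinuousLinearMap.snd ℂ ℂ (ℂ × ℂ))))

theorem nakLinear_apply (c : ℂ) (p : ℂ × (ℂ × ℂ)) : nakLinear c p = (p.1, nakPhi c p.2) := by
  simp [nakLinear, nakPhi]

/-- The deck transformation of `ℂ³ → X_t` by the element `(c, v)` of `Γ`, as a pair of a linear
part and a translation. -/
def nakDeck (t c : ℂ) (v : ℂ × ℂ) : (ℂ × (ℂ × ℂ) →L[ℂ] ℂ × (ℂ × ℂ)) × (ℂ × (ℂ × ℂ)) :=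
  (nakLinear c, (c - t * conj c, v))

/-- The deck transformations of `ℂ³ → X_t`. -/
def nakDecks (L : NakamuraLattice) (t : ℂ) :
    Set ((ℂ × (ℂ × ℂ) →L[ℂ] ℂ × (ℂ × ℂ)) × (ℂ × (ℂ × ℂ))) :=
  {d | ∃ c ∈ L.base, ∃ v ∈ L.fibre, d = nakDeck t c v}

/-- The covering `ℂ³ → X_t` by the coordinates `(z₁ - t z̄₁, (z₂, z₃))`. -/
def deformedCover (L : NakamuraLattice) (t : unitDisc) (p : ℂ × (ℂ × ℂ)) : DeformedNakamura L t :=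
  deformedProj L t ((deformedCoord t).symm p)

/-- The covering `ℂ³ → X` by the coordinates `(z₁, (z₂, z₃))`. -/
def nakCover (L : NakamuraLattice) (p : ℂ × (ℂ × ℂ)) : NakamuraManifold L :=
  nakProj L (NakGroup.coord.symm p)

theorem coord_smul (L : NakamuraLattice) (γ : L.Γ) (g : NakGroup) :
    NakGroup.coord (γ • g) = ((NakGroup.coord γ.1).1 + (NakGroup.coord g).1,
      (NakGroup.coord γ.1).2 + nakPhi (NakGroup.coord γ.1).1 (NakGroup.coord g).2) := rfl

theorem deformedCoord_apply (t : unitDisc) (g : NakGroup) :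
    deformedCoord t g = ((NakGroup.coord g).1 - t * conj (NakGroup.coord g).1,
      (NakGroup.coord g).2) := rfl

/-- Left translation changes z₁ by a constant c and hence z₁ - t z̄₁ by the constant c - t c̄. The
linear part is complex and does not depend on t. -/
theorem deformedCoord_smul (L : NakamuraLattice) (t : unitDisc) (γ : L.Γ) (g : NakGroup) :
    deformedCoord t (γ • g) = (nakDeck t (NakGroup.coord γ.1).1 (NakGroup.coord γ.1).2).1
      (deformedCoord t g) + (nakDeck t (NakGroup.coord γ.1).1 (NakGroup.coord γ.1).2).2 := by
  simp only [nakDeck, nakLinear_apply, deformedCoord_apply, coord_smul]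
  ext <;> simp <;> ring

theorem isAffineCovering_deformedCover (L : NakamuraLattice) (t : unitDisc) :
    IsAffineCovering univ (nakDecks L t) (deformedCover L t) := by
  have key := isAffineCovering_quotient (Γ := L.Γ) (G := DeformedGroup t)
    (show DeformedGroup t ≃ₜ _ from deformedCoord t).toOpenPartialHomeomorph (fun x ↦ rfl) rfl (nakDecks L t)
  refine key ?_ ?_
  · intro γ
    exact ⟨_, ⟨_, γ.2.1, _, γ.2.2, rfl⟩, deformedCoord_smul L t γ⟩
  · rintro _ ⟨c, hc, v, hv, rfl⟩
    exact ⟨⟨NakGroup.coord.symm (c, v), hc, hv⟩, deformedCoord_smul L t _⟩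

theorem isAffineCovering_nakCover (L : NakamuraLattice) :
    IsAffineCovering univ (nakDecks L 0) (nakCover L) := by
  have key : ∀ (γ : L.Γ) (g : NakGroup), NakGroup.coord (γ • g) =
      (nakDeck 0 (NakGroup.coord γ.1).1 (NakGroup.coord γ.1).2).1 (NakGroup.coord g) +
        (nakDeck 0 (NakGroup.coord γ.1).1 (NakGroup.coord γ.1).2).2 := by
    intro γ g
    simp only [nakDeck, nakLinear_apply, coord_smul]
    ext <;> simp <;> ring
  refine isAffineCovering_quotient (Γ := L.Γ) (G := NakGroup)
    NakGroup.coord.toOpenPartialHomeomorph (fun x ↦ rfl) rfl (nakDecks L 0) ?_ ?_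
  · intro γ
    exact ⟨_, ⟨_, γ.2.1, _, γ.2.2, rfl⟩, key γ⟩
  · rintro _ ⟨c, hc, v, hv, rfl⟩
    exact ⟨⟨NakGroup.coord.symm (c, v), hc, hv⟩, key _⟩

/-- The deck transformation of `Δ × ℂ³ → Γ \ (Δ × G)` by the element `(c, v)` of `Γ`. -/
def totalDeck (c : ℂ) (v : ℂ × ℂ) :
    (ℂ × (ℂ × (ℂ × ℂ)) →L[ℂ] ℂ × (ℂ × (ℂ × ℂ))) × (ℂ × (ℂ × (ℂ × ℂ))) :=
  ((ContinuousLinearMap.fst ℂ ℂ (ℂ × (ℂ × ℂ))).prod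
    (nakLinear c ∘L ContinuousLinearMap.snd ℂ ℂ (ℂ × (ℂ × ℂ)) -
      (ContinuousLinearMap.inl ℂ ℂ (ℂ × ℂ)) ∘L (conj c • ContinuousLinearMap.fst ℂ ℂ (ℂ × (ℂ × ℂ)))),
    (0, (c, v)))

/-- The chart of `Δ × G`. -/
def totalChart : OpenPartialHomeomorph TotalCover (ℂ × (ℂ × (ℂ × ℂ))) :=
  TotalCover.isOpenEmbedding_coord.toOpenPartialHomeomorph TotalCover.coord

theorem totalChart_apply (p : TotalCover) :
    totalChart p = ((p.1 : ℂ), deformedCoord p.1 p.2) := rfl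

/-- The covering of the total space. -/
def totalCover (L : NakamuraLattice) (p : ℂ × (ℂ × (ℂ × ℂ))) : TotalNakamura L :=
  Quotient.mk _ (totalChart.symm p)

/-- With t as a coordinate, the shift by c - t c̄ consists of a translation and a term linear in t,
because c̄ is a constant. So the deck group stays affine over ℂ, which makes the total space a
complex manifold. -/
theorem isAffineCovering_totalCover (L : NakamuraLattice) :
    IsAffineCovering totalChart.target
      {d | ∃ c ∈ L.base, ∃ v ∈ L.fibre, d = totalDeck c v} (totalCover L) := by
  have key : ∀ (γ : L.Γ) (x : TotalCover), totalChart (γ • x) =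
      (totalDeck (NakGroup.coord γ.1).1 (NakGroup.coord γ.1).2).1 (totalChart x) +
        (totalDeck (NakGroup.coord γ.1).1 (NakGroup.coord γ.1).2).2 := by
    intro γ x
    change ((x.1 : ℂ), deformedCoord x.1 (γ • x.2)) = _
    rw [deformedCoord_smul]
    simp only [totalDeck, nakDeck, totalChart_apply, nakLinear_apply,
      ContinuousLinearMap.prod_apply, sub_apply,
      ContinuousLinearMap.comp_apply]
    ext <;> simp <;> ring
  refine isAffineCovering_quotient (Γ := L.Γ) (G := TotalCover)
    totalChart (fun x ↦ rfl) (by simp [totalChart]) _ ?_ ?_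
  · intro γ
    exact ⟨_, ⟨_, γ.2.1, _, γ.2.2, rfl⟩, key γ⟩
  · rintro _ ⟨c, hc, v, hv, rfl⟩
    exact ⟨⟨NakGroup.coord.symm (c, v), hc, hv⟩, key _⟩

end Coverings

/-! ## Lattice coordinates -/

section Lattices

theorem NakamuraLattice.exists_fibreEquiv (L : NakamuraLattice) :
    ∃ B : (Fin 4 → ℝ) ≃L[ℝ] ℂ × ℂ, ∀ v, v ∈ L.fibre ↔ ∃ n : Fin 4 → ℤ, v = B fun i ↦ (n i : ℝ) := by
  have := L.discrete
  have := L.isLattice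
  have hfr : Module.finrank ℤ L.fibre = 4 := by
    rw [ZLattice.rank ℝ L.fibre, Module.finrank_prod, Complex.finrank_real_complex]
  let b := (Module.finBasisOfFinrankEq ℤ L.fibre hfr)
  let b' := b.ofZLatticeBasis ℝ L.fibre
  refine ⟨b'.equivFun.symm.toContinuousLinearEquiv, fun v ↦ ?_⟩
  have h1 : Submodule.span ℤ (Set.range b') = L.fibre := b.ofZLatticeBasis_span ℝ L.fibre
  rw [← h1, b'.mem_span_iff_repr_mem ℤ]
  constructor
  · intro h
    choose n hn using h
    refine ⟨n, ?_⟩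
    simp only [LinearEquiv.coe_toContinuousLinearEquiv', Module.Basis.equivFun_symm_apply]
    conv_lhs => rw [← b'.sum_repr v]
    refine Finset.sum_congr rfl fun i _ ↦ ?_
    rw [← hn]; rfl
  · rintro ⟨n, rfl⟩ i
    refine ⟨n i, ?_⟩
    rw [← b'.equivFun_apply]
    simp only [LinearEquiv.coe_toContinuousLinearEquiv', LinearEquiv.apply_symm_apply]
    rfl

/-- The coordinates of `ℂ` with respect to `log λ` and `2πi`. -/
def NakamuraLattice.baseLinear (L : NakamuraLattice) : (Fin 2 → ℝ) →ₗ[ℝ] ℂ where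
  toFun x := x 0 * Complex.log L.lam + x 1 * (2 * Real.pi * I)
  map_add' x y := by simp; ring
  map_smul' c x := by simp; ring

/-- The real part of log λ is log |λ| ≠ 0, while 2πi is imaginary. -/
theorem NakamuraLattice.baseLinear_injective (L : NakamuraLattice) :
    Function.Injective L.baseLinear := by
  rw [injective_iff_map_eq_zero]
  intro x hx
  change (x 0 : ℂ) * Complex.log L.lam + x 1 * (2 * Real.pi * I) = 0 at hx
  have h1 := congrArg Complex.re hx
  have h2 := congrArg Complex.im hx
  simp at h1 h2
  have h3 : x 0 = 0 := h1.resolve_right L.log_re_ne_zero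
  rw [h3] at h2
  have h4 : x 1 = 0 := by simpa [Real.pi_ne_zero] using h2
  funext i
  fin_cases i <;> assumption

/-- The coordinates of `ℂ` with respect to `log λ` and `2πi`. -/
def NakamuraLattice.baseEquiv (L : NakamuraLattice) : (Fin 2 → ℝ) ≃L[ℝ] ℂ :=
  (LinearEquiv.ofInjectiveOfFinrankEq L.baseLinear L.baseLinear_injective
    (by simp [Complex.finrank_real_complex])).toContinuousLinearEquiv

theorem NakamuraLattice.baseEquiv_apply (L : NakamuraLattice) (x : Fin 2 → ℝ) :
    L.baseEquiv x = x 0 * Complex.log L.lam + x 1 * (2 * Real.pi * I) := rfl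

theorem NakamuraLattice.mem_base_iff (L : NakamuraLattice) (c : ℂ) :
    c ∈ L.base ↔ ∃ n : Fin 2 → ℤ, c = L.baseEquiv fun i ↦ (n i : ℝ) := by
  constructor
  · rintro ⟨m, n, rfl⟩
    exact ⟨![m, n], by simp [NakamuraLattice.baseEquiv_apply]⟩
  · rintro ⟨n, rfl⟩
    exact ⟨n 0, n 1, by simp [NakamuraLattice.baseEquiv_apply]⟩

theorem exists_int_add_mem_Icc {ι F : Type} [Fintype ι] [NormedAddCommGroup F] [NormedSpace ℝ F]
    (B : (ι → ℝ) ≃L[ℝ] F) (w : F) :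
    ∃ n : ι → ℤ, (B fun i ↦ (n i : ℝ)) + w ∈ B '' Set.Icc 0 1 := by
  obtain ⟨x, rfl⟩ := B.surjective w
  refine ⟨fun i ↦ -⌊x i⌋, fun i ↦ Int.fract (x i), ⟨?_, ?_⟩, ?_⟩
  · intro i; exact Int.fract_nonneg _
  · intro i; exact (Int.fract_lt_one _).le
  · rw [← map_add]
    congr 1
    funext i
    simp only [Pi.add_apply, Int.cast_neg]
    have := Int.floor_add_fract (x i)
    linarith

/-- The base coordinate is moved into a period parallelogram by some `c`. The fibre coordinate,
already changed by `nakPhi c`, is then corrected by a fibre translation. Compactness of the fibres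
and properness of the family both rest on this set. -/
theorem NakamuraLattice.exists_compact (L : NakamuraLattice) :
    ∃ K : Set NakGroup, IsCompact K ∧ ∀ g : NakGroup, ∃ γ : L.Γ, γ • g ∈ K := by
  obtain ⟨B, hB⟩ := L.exists_fibreEquiv
  refine ⟨NakGroup.coord.symm '' ((L.baseEquiv '' Set.Icc 0 1) ×ˢ (B '' Set.Icc 0 1)), ?_, ?_⟩
  · exact ((isCompact_Icc.image L.baseEquiv.continuous).prod
      (isCompact_Icc.image B.continuous)).image NakGroup.coord.symm.continuous
  · intro g
    obtain ⟨n, hn⟩ := exists_int_add_mem_Icc L.baseEquiv (NakGroup.coord g).1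
    set c := L.baseEquiv fun i ↦ (n i : ℝ) with hc
    obtain ⟨m, hm⟩ := exists_int_add_mem_Icc B (nakPhi c (NakGroup.coord g).2)
    refine ⟨⟨NakGroup.coord.symm (c, B fun i ↦ (m i : ℝ)), (L.mem_base_iff c).2 ⟨n, hc⟩,
      (hB _).2 ⟨m, rfl⟩⟩, ?_⟩
    rw [← NakGroup.coord.symm_apply_apply (_ • g)]
    refine Set.mem_image_of_mem _ ?_
    rw [coord_smul]
    exact ⟨hn, hm⟩

end Lattices

/-! ## Smooth maps between affine quotients -/

section SmoothMaps

open Set Filter Topology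

namespace IsAffineCovering

variable {E : Type} [NormedAddCommGroup E] [NormedSpace ℂ E]
  {M : Type} [TopologicalSpace M] [ChartedSpace E M]
  {Ω : Set E} {D : Set ((E →L[ℂ] E) × E)} {π : E → M}
  {𝕜 : Type} [NontriviallyNormedField 𝕜] [NormedSpace 𝕜 E] {n : ℕ∞ω}

theorem eventuallyEq_symm_of_mem (h : IsAffineCovering Ω D π) (x : M) {p : E}
    (hp : p ∈ (chartAt E x).target) : (chartAt E x).symm =ᶠ[𝓝 p] π := by
  filter_upwards [(chartAt E x).open_target.mem_nhds hp] with q hq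
  exact h.symm_eq _ (chart_mem_atlas E x) hq

theorem chart_mem (h : IsAffineCovering Ω D π) (x : M) : chartAt E x x ∈ Ω :=
  h.target_subset _ (chart_mem_atlas E x) (mem_chart_target E x)

theorem map_chart_of_mem (h : IsAffineCovering Ω D π) (x : M) : π (chartAt E x x) = x := by
  rw [← h.symm_eq _ (chart_mem_atlas E x) (mem_chart_target E x),
    (chartAt E x).left_inv (mem_chart_source E x)]

theorem contMDiffAt_cover (h : IsAffineCovering Ω D π) (hΩ : IsOpen Ω)
    (hD : ∀ d ∈ D, ContDiff 𝕜 n (fun p ↦ d.1 p + d.2)) {q : E} (hq : q ∈ Ω) :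
    ContMDiffAt 𝓘(𝕜, E) 𝓘(𝕜, E) n π q := by
  have := h.isManifold n hD
  obtain ⟨d, hd, hdq⟩ := (h.mk_eq_iff q hq _ (h.chart_mem (π q))).1 (h.map_chart_of_mem (π q)).symm
  have h0 : ContMDiffAt 𝓘(𝕜, E) 𝓘(𝕜, E) n π (d.1 q + d.2) := by
    rw [← hdq]
    exact (contMDiffAt_symm_of_mem_maximalAtlas (I := 𝓘(𝕜, E)) (n := n)
      (StructureGroupoid.subset_maximalAtlas _ (chart_mem_atlas E (π q)))
      (mem_chart_target E _)).congr_of_eventuallyEq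
      (h.eventuallyEq_symm_of_mem _ (mem_chart_target E _)).symm
  have h2 : π =ᶠ[𝓝 q] π ∘ fun p ↦ d.1 p + d.2 := by
    filter_upwards [hΩ.mem_nhds hq] with p hp
    exact (h.mk_eq_iff p hp _ (h.mapsTo d hd p hp)).2 ⟨d, hd, rfl⟩
  exact (h0.comp q (hD d hd).contMDiff.contMDiffAt).congr_of_eventuallyEq h2

theorem contMDiff_of_cover {E' : Type} [NormedAddCommGroup E'] [NormedSpace 𝕜 E']
    {N : Type} [TopologicalSpace N] [ChartedSpace E' N] (h : IsAffineCovering univ D π)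
    (hD : ∀ d ∈ D, ContDiff 𝕜 n (fun p ↦ d.1 p + d.2)) {f : M → N}
    (hf : ContMDiff 𝓘(𝕜, E) 𝓘(𝕜, E') n (f ∘ π)) : ContMDiff 𝓘(𝕜, E) 𝓘(𝕜, E') n f := by
  have := h.isManifold n hD
  intro x
  have h1 : f =ᶠ[𝓝 x] (f ∘ π) ∘ chartAt E x := by
    filter_upwards [(chartAt E x).open_source.mem_nhds (mem_chart_source E x)] with y hy
    rw [Function.comp_apply, Function.comp_apply, ← h.symm_eq _ (chart_mem_atlas E x)
      ((chartAt E x).map_source hy), (chartAt E x).left_inv hy]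
  refine ContMDiffAt.congr_of_eventuallyEq ?_ h1
  exact (hf _).comp x (contMDiffAt_of_mem_maximalAtlas
    (StructureGroupoid.subset_maximalAtlas _ (chart_mem_atlas E x)) (mem_chart_source E x))

/-- Local inverses of the covering, composed with a diffeomorphism of the model space, are charts
of the maximal atlas. -/
theorem mem_maximalAtlas (h : IsAffineCovering Ω D π) (hΩ : IsOpen Ω)
    (hD : ∀ d ∈ D, ContDiff 𝕜 n (fun p ↦ d.1 p + d.2)) (e : OpenPartialHomeomorph M E)
    (T : E ≃ₜ E) (hT : ContDiff 𝕜 n T) (hT' : ContDiff 𝕜 n T.symm)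
    (he : EqOn e.symm (π ∘ T) e.target) (heΩ : MapsTo T e.target Ω) :
    e ∈ IsManifold.maximalAtlas 𝓘(𝕜, E) n M := by
  have := h.isManifold n hD
  refine OpenPartialHomeomorph.mem_maximalAtlas_of_contMDiffOn e ?_ ?_
  · intro x hx
    refine ContMDiffAt.contMDiffWithinAt ?_
    have hex := e.map_source hx
    have hx' : π (chartAt E x x) = π (T (e x)) := by
      rw [h.map_chart_of_mem]
      exact ((he hex).symm.trans (e.left_inv hx)).symm
    -- The preferred coordinates of `x` and `T (e x)` lie over the same point, so a deck
    -- transformation joins them. It expresses `e` near `x` as `T.symm` after an affine map after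
    -- the preferred chart.
    obtain ⟨d, hd, hdq⟩ := (h.mk_eq_iff _ (h.chart_mem x) _ (heΩ hex)).1 hx'
    have hcx : ContinuousAt (chartAt E x) x :=
      (chartAt E x).continuousAt (mem_chart_source E x)
    have hc : ContinuousAt (fun y ↦ T.symm (d.1 (chartAt E x y) + d.2)) x := by fun_prop
    have h1 : e =ᶠ[𝓝 x] fun y ↦ T.symm (d.1 (chartAt E x y) + d.2) := by
      have h2 : ∀ᶠ y in 𝓝 x, T.symm (d.1 (chartAt E x y) + d.2) ∈ e.target :=
        hc.eventually_mem (e.open_target.mem_nhds (by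
          rw [← hdq, T.symm_apply_apply]; exact hex))
      filter_upwards [h2, (chartAt E x).open_source.mem_nhds (mem_chart_source E x)] with y hy hy'
      have h3 : π (chartAt E x y) = y := by
        rw [← h.symm_eq _ (chart_mem_atlas E x) ((chartAt E x).map_source hy'),
          (chartAt E x).left_inv hy']
      have h4 := heΩ hy
      rw [T.apply_symm_apply] at h4
      have h5 := (h.mk_eq_iff _ (h.target_subset _ (chart_mem_atlas E x)
        ((chartAt E x).map_source hy')) _ h4).2 ⟨d, hd, rfl⟩
      have h6 := he hy
      rw [Function.comp_apply, T.apply_symm_apply, ← h5, h3] at h6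
      rw [← e.right_inv hy, h6]
    refine ContMDiffAt.congr_of_eventuallyEq ?_ h1
    have hch : ContMDiffAt 𝓘(𝕜, E) 𝓘(𝕜, E) n (chartAt E x) x := contMDiffAt_of_mem_maximalAtlas
      (StructureGroupoid.subset_maximalAtlas _ (chart_mem_atlas E x)) (mem_chart_source E x)
    exact (hT'.comp (hD d hd)).contMDiff.contMDiffAt.comp x hch
  · intro p hp
    refine ContMDiffAt.contMDiffWithinAt ?_
    have h1 : e.symm =ᶠ[𝓝 p] π ∘ T := by
      filter_upwards [e.open_target.mem_nhds hp] with q hq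
      exact he hq
    exact ((h.contMDiffAt_cover hΩ hD (heΩ hp)).comp p
      hT.contMDiff.contMDiffAt).congr_of_eventuallyEq h1

end IsAffineCovering

end SmoothMaps

/-! ## The holomorphic family -/

section Family

open Set Filter Topology

variable (L : NakamuraLattice)

instance : SecondCountableTopology NakGroup :=
  inferInstanceAs (SecondCountableTopology (ℂ × (ℂ × ℂ)))
instance (t : unitDisc) : SecondCountableTopology (DeformedGroup t) :=
  inferInstanceAs (SecondCountableTopology (ℂ × (ℂ × ℂ)))
instance : SecondCountableTopology TotalCover :=
  inferInstanceAs (SecondCountableTopology (unitDisc × (ℂ × (ℂ × ℂ))))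

theorem contDiff_deck {E : Type} [NormedAddCommGroup E] [NormedSpace ℂ E] (d : (E →L[ℂ] E) × E)
    (n : ℕ∞ω) : ContDiff ℂ n (fun p ↦ d.1 p + d.2) := d.1.contDiff.add contDiff_const

theorem isComplexManifold_nakamura : IsComplexManifold (ℂ × (ℂ × ℂ)) (NakamuraManifold L) where
  t2 := inferInstance
  secondCountable := ContinuousConstSMul.secondCountableTopology
  holomorphic := (isAffineCovering_nakCover L).isManifold_complex

theorem isComplexManifold_deformed (t : unitDisc) :
    IsComplexManifold (ℂ × (ℂ × ℂ)) (DeformedNakamura L t) where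
  t2 := inferInstance
  secondCountable := ContinuousConstSMul.secondCountableTopology
  holomorphic := (isAffineCovering_deformedCover L t).isManifold_complex

theorem isComplexManifold_total :
    IsComplexManifold (ℂ × (ℂ × (ℂ × ℂ))) (TotalNakamura L) where
  t2 := inferInstance
  secondCountable := ContinuousConstSMul.secondCountableTopology
  holomorphic := (isAffineCovering_totalCover L).isManifold_complex

theorem isComplexManifold_unitDisc : IsComplexManifold ℂ unitDisc where
  t2 := inferInstance
  secondCountable := inferInstance
  holomorphic := inferInstance

theorem compactSpace_deformed (t : unitDisc) : CompactSpace (DeformedNakamura L t) := by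
  obtain ⟨K, hK, hKg⟩ := L.exists_compact
  have hc : Continuous (deformedProj L t) :=
    (continuous_quotient_mk' : Continuous (Quotient.mk (MulAction.orbitRel L.Γ (DeformedGroup t))))
  have h1 : deformedProj L t '' K = univ := by
    refine eq_univ_of_forall fun x ↦ ?_
    induction x using Quotient.inductionOn with
    | h g =>
      obtain ⟨γ, hγ⟩ := hKg g
      exact ⟨_, hγ, Quotient.sound ⟨γ, rfl⟩⟩
  exact ⟨by rw [← h1]; exact hK.image hc⟩

theorem continuous_familyProj : Continuous (familyProj L) :=
  Continuous.quotient_lift (continuous_fst : Continuous fun p : unitDisc × NakGroup ↦ p.1) _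

/-- The space Δ × K, with K compact and meeting every orbit, maps onto the total space, and its
composite to Δ is the proper first projection. -/
theorem isProperMap_familyProj : IsProperMap (familyProj L) := by
  obtain ⟨K, hK, hKg⟩ := L.exists_compact
  have := isCompact_iff_compactSpace.1 hK
  let Φ : unitDisc × K → TotalNakamura L := fun p ↦
    Quotient.mk (MulAction.orbitRel L.Γ TotalCover) ((p.1, p.2.1) : unitDisc × NakGroup)
  have hc : Continuous Φ := by
    have h1 : Continuous (Quotient.mk (MulAction.orbitRel L.Γ TotalCover)) :=
      continuous_quotient_mk'
    have h2 : Continuous fun p : unitDisc × K ↦ ((p.1, p.2.1) : unitDisc × NakGroup) := by fun_prop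
    exact h1.comp h2
  refine isProperMap_of_comp_of_surj hc (continuous_familyProj L) ?_ ?_
  · exact isProperMap_fst_of_compactSpace
  · intro x
    induction x using Quotient.inductionOn with
    | h p =>
      obtain ⟨γ, hγ⟩ := hKg p.2
      refine ⟨(p.1, ⟨_, hγ⟩), Quotient.sound ⟨γ, rfl⟩⟩

theorem totalChart_target : totalChart.target = {p | p.1 ∈ (unitDisc : Set ℂ)} := by
  have : totalChart.target = range TotalCover.coord := by
    simp [totalChart]
  rw [this]
  ext p
  constructor
  · rintro ⟨q, rfl⟩
    exact q.1.2
  · intro hp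
    refine ⟨((⟨p.1, hp⟩, (deformedCoord ⟨p.1, hp⟩).symm p.2) : unitDisc × NakGroup), ?_⟩
    exact Prod.ext rfl ((deformedCoord ⟨p.1, hp⟩).apply_symm_apply p.2)

theorem totalChart_symm {p : ℂ × (ℂ × (ℂ × ℂ))} (hp : p.1 ∈ (unitDisc : Set ℂ)) :
    totalChart.symm p =
      ((⟨p.1, hp⟩, (deformedCoord ⟨p.1, hp⟩).symm p.2) : unitDisc × NakGroup) := by
  have h1 : p = totalChart
      ((⟨p.1, hp⟩, (deformedCoord ⟨p.1, hp⟩).symm p.2) : unitDisc × NakGroup) :=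
    Prod.ext rfl ((deformedCoord ⟨p.1, hp⟩).apply_symm_apply p.2).symm
  conv_lhs => rw [h1]
  refine totalChart.left_inv ?_
  rw [totalChart, Topology.IsOpenEmbedding.toOpenPartialHomeomorph_source]
  trivial

theorem isOpen_totalChart_target : IsOpen totalChart.target := totalChart.open_target

theorem familyProj_totalCover {p : ℂ × (ℂ × (ℂ × ℂ))} (hp : p ∈ totalChart.target) :
    ((familyProj L (totalCover L p) : unitDisc) : ℂ) = p.1 := by
  rw [totalChart_target] at hp
  rw [totalCover, totalChart_symm hp]
  rfl

theorem fibreInclusion_deformedCover (t : unitDisc) (p : ℂ × (ℂ × ℂ)) :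
    fibreInclusion L t (deformedCover L t p) = totalCover L (t, p) := by
  have hp : ((t : ℂ), p).1 ∈ (unitDisc : Set ℂ) := t.2
  rw [totalCover, totalChart_symm hp]
  rfl

/-- The first coordinate of each chart of the total space is t, so the preferred charts already
exhibit a linear projection. -/
theorem isSubmersion_familyProj :
    Manifold.IsSubmersion 𝓘(ℂ, ℂ × (ℂ × (ℂ × ℂ))) 𝓘(ℂ, ℂ) ω (familyProj L) := by
  have hcov := isAffineCovering_totalCover L
  have := hcov.isManifold_complex
  refine ⟨ℂ × (ℂ × ℂ), inferInstance, inferInstance, fun x ↦ ?_⟩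
  refine Manifold.IsSubmersionAtOfComplement.mk_of_charts (ContinuousLinearEquiv.refl ℂ _)
    (chartAt _ x) (chartAt ℂ (familyProj L x)) (mem_chart_source _ x) (mem_chart_source _ _)
    (IsManifold.chart_mem_maximalAtlas x) (IsManifold.chart_mem_maximalAtlas _) ?_ ?_
  · intro y _
    rw [mem_preimage, TopologicalSpace.Opens.chartAt_eq]
    simp only [chartAt_self_eq, mfld_simps]
  · intro p hp
    simp only [mfld_simps] at hp ⊢
    rw [hcov.symm_eq _ (chart_mem_atlas _ x) hp]
    exact familyProj_totalCover L (hcov.target_subset _ (chart_mem_atlas _ x) hp)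

theorem isHolomorphicFamily :
    IsHolomorphicFamily (E := ℂ × (ℂ × (ℂ × ℂ))) (F := ℂ) (familyProj L) where
  total := isComplexManifold_total L
  base := isComplexManifold_unitDisc
  surjective t :=
    ⟨Quotient.mk (MulAction.orbitRel L.Γ TotalCover) ((t, 1) : unitDisc × NakGroup), rfl⟩
  proper := isProperMap_familyProj L
  submersion := isSubmersion_familyProj L

theorem range_fibreInclusion (t : unitDisc) :
    range (fibreInclusion L t) = familyProj L ⁻¹' {t} := by
  ext x
  constructor
  · rintro ⟨y, rfl⟩
    induction y using Quotient.inductionOn with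
    | h g => rfl
  · intro hx
    induction x using Quotient.inductionOn with
    | h p =>
      obtain ⟨s, g⟩ := p
      have : s = t := hx
      subst this
      exact ⟨Quotient.mk (MulAction.orbitRel L.Γ (DeformedGroup s)) g, rfl⟩

theorem continuous_fibreInclusion (t : unitDisc) : Continuous (fibreInclusion L t) := by
  refine Continuous.quotient_lift ?_ _
  have h1 : Continuous (Quotient.mk (MulAction.orbitRel L.Γ TotalCover)) := continuous_quotient_mk'
  have h2 : Continuous fun g : NakGroup ↦ ((t, g) : unitDisc × NakGroup) := by fun_prop
  exact h1.comp h2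

theorem injective_fibreInclusion (t : unitDisc) : Function.Injective (fibreInclusion L t) := by
  intro x y hxy
  induction x using Quotient.inductionOn with
  | h g =>
    induction y using Quotient.inductionOn with
    | h g' =>
      obtain ⟨γ, hγ⟩ := Quotient.exact hxy
      exact Quotient.sound ⟨γ, congrArg Prod.snd hγ⟩

theorem isSmoothEmbedding_fibreInclusion (t : unitDisc) :
    Manifold.IsSmoothEmbedding 𝓘(ℂ, ℂ × (ℂ × ℂ)) 𝓘(ℂ, ℂ × (ℂ × (ℂ × ℂ))) ω
      (fibreInclusion L t) := by
  have := compactSpace_deformed L t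
  have : T2Space (TotalNakamura L) := (isComplexManifold_total L).t2
  have hcov := isAffineCovering_totalCover L
  have hcov' := isAffineCovering_deformedCover L t
  have := hcov.isManifold_complex
  have := hcov'.isManifold_complex
  -- The topological part holds for an injective continuous map from a compact to a Hausdorff space;
  -- what remains is the immersion.
  refine ⟨⟨ℂ, inferInstance, inferInstance, fun x ↦ ?_⟩,
    ((continuous_fibreInclusion L t).isClosedEmbedding (injective_fibreInclusion L t)).isEmbedding⟩
  have hloc : IsLocalHomeomorph (Quotient.mk (MulAction.orbitRel L.Γ TotalCover)) :=
    isQuotientCoveringMap_quotientMk_of_properlyDiscontinuousSMul.isCoveringMap.isLocalHomeomorph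
  set φ := chartAt (ℂ × (ℂ × ℂ)) x with hφ
  -- The normal form of an immersion is p ↦ (p, 0), so the slice over t has to be shifted to 0. The
  -- chart `ψ` takes the sheet through the lift (t, φ x), which the preferred chart of the total
  -- space need not do.
  let T : ℂ × (ℂ × (ℂ × ℂ)) ≃ₜ ℂ × (ℂ × (ℂ × ℂ)) := Homeomorph.addRight ((t : ℂ), 0)
  have hTt : ∀ p, T (0, p) = ((t : ℂ), p) := fun p ↦ by simp [T]
  let ψ : OpenPartialHomeomorph (TotalNakamura L) (ℂ × (ℂ × (ℂ × ℂ))) :=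
    ((hloc.localInverseAt (totalChart.symm ((t : ℂ), φ x))).trans totalChart).trans
      T.symm.toOpenPartialHomeomorph
  have hψs : ∀ q, ψ.symm q = totalCover L (T q) := by
    intro q
    simp only [ψ, OpenPartialHomeomorph.coe_trans_symm, Function.comp_apply]
    rw [IsLocalHomeomorph.localInverseAt_symm]
    rfl
  have hψt : ∀ q, q ∈ ψ.target ↔ T q ∈ totalChart.target ∧ totalChart.symm (T q) ∈
      (hloc.localInverseAt (totalChart.symm ((t : ℂ), φ x))).target := by
    intro q
    simp [ψ]
  have hU : IsOpen {p | ((0 : ℂ), p) ∈ ψ.target} := ψ.open_target.preimage (by fun_prop)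
  -- The fibre chart is shrunk to the points whose slice lies in the target of `ψ`.
  let φ' := φ.trans (OpenPartialHomeomorph.ofSet _ hU)
  have hφ't : ∀ p ∈ φ'.target, p ∈ φ.target ∧ (0, p) ∈ ψ.target := by
    intro p hp
    simp only [φ', mfld_simps] at hp
    exact ⟨hp.2, hp.1⟩
  have hφx : φ x ∈ φ.target := mem_chart_target _ x
  have h0x : (0, φ x) ∈ ψ.target := by
    rw [hψt, hTt]
    refine ⟨?_, hloc.self_mem_localInverseAt_target⟩
    rw [totalChart_target]
    exact t.2
  have hincl : ∀ p ∈ φ'.target, fibreInclusion L t (φ'.symm p) = ψ.symm (0, p) := by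
    intro p hp
    have h1 : φ'.symm p = deformedCover L t p := hcov'.symm_eq φ (chart_mem_atlas _ x) (hφ't p hp).1
    rw [h1, fibreInclusion_deformedCover, hψs, hTt]
  have hxs : x ∈ φ'.source := by
    simp only [φ', mfld_simps]
    exact ⟨mem_chart_source _ x, h0x⟩
  refine Manifold.IsImmersionAtOfComplement.mk_of_charts (ContinuousLinearEquiv.prodComm ℂ _ _)
    φ' ψ hxs ?_ ?_ ?_ ?_ ?_
  · have h1 := hincl (φ x) (φ'.map_source hxs)
    have h2 : φ'.symm (φ x) = x := φ'.left_inv hxs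
    rw [h2] at h1
    rw [h1]
    exact ψ.map_target h0x
  · refine hcov'.mem_maximalAtlas isOpen_univ (fun d _ ↦ contDiff_deck d _) φ'
      (Homeomorph.refl _) contDiff_id contDiff_id ?_ (fun _ _ ↦ trivial)
    intro p hp
    exact hcov'.symm_eq φ (chart_mem_atlas _ x) (hφ't p hp).1
  · refine hcov.mem_maximalAtlas isOpen_totalChart_target (fun d _ ↦ contDiff_deck d _) ψ T
      (contDiff_id.add contDiff_const) ?_ (fun q _ ↦ hψs q) (fun q hq ↦ ((hψt q).1 hq).1)
    exact contDiff_id.add contDiff_const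
  · intro y hy
    have h1 := hincl (φ' y) (φ'.map_source hy)
    rw [φ'.left_inv hy] at h1
    rw [mem_preimage, h1]
    exact ψ.map_target (hφ't _ (φ'.map_source hy)).2
  · intro p hp
    have hp' : p ∈ φ'.target := by simpa only [mfld_simps] using hp
    simp only [mfld_simps]
    rw [hincl p hp', ψ.right_inv (hφ't p hp').2]
    rfl

end Family

/-! ## The complex structures on the quotient -/

section Comparison

open Set Filter Topology

/-- The real linear map that turns the coordinates of `X` into those of `X_t`. -/
def twist (t : ℂ) : ℂ × (ℂ × ℂ) →L[ℝ] ℂ × (ℂ × ℂ) :=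
  (ContinuousLinearMap.fst ℝ ℂ (ℂ × ℂ) -
    t • (Complex.conjCLE : ℂ →L[ℝ] ℂ) ∘L ContinuousLinearMap.fst ℝ ℂ (ℂ × ℂ)).prod
    (ContinuousLinearMap.snd ℝ ℂ (ℂ × ℂ))

theorem twist_apply (t : ℂ) (v : ℂ × (ℂ × ℂ)) : twist t v = (v.1 - t * conj v.1, v.2) := by
  simp [twist]

/-- The identity map of the quotient, from `X` to `X_t`. -/
def toDeformed (L : NakamuraLattice) (t : unitDisc) : NakamuraManifold L → DeformedNakamura L t :=
  Quotient.lift (deformedProj L t) (by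
    rintro g h ⟨γ, rfl⟩
    exact Quotient.sound ⟨γ, rfl⟩)

/-- The identity map of the quotient, from `X_t` to `X`. -/
def ofDeformed (L : NakamuraLattice) (t : unitDisc) : DeformedNakamura L t → NakamuraManifold L :=
  Quotient.lift (fun g : DeformedGroup t ↦ nakProj L g) (by
    rintro g h ⟨γ, rfl⟩
    exact Quotient.sound ⟨γ, rfl⟩)

/-- The identity map of the quotient, as a diffeomorphism. -/
def deformedDiffeomorph (L : NakamuraLattice) (t : unitDisc) {𝕜 : Type}
    [NontriviallyNormedField 𝕜] [NormedSpace 𝕜 (ℂ × (ℂ × ℂ))] (n : ℕ∞ω)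
    (hD : ∀ (d : (ℂ × (ℂ × ℂ) →L[ℂ] ℂ × (ℂ × ℂ)) × (ℂ × (ℂ × ℂ))),
      ContDiff 𝕜 n (fun p ↦ d.1 p + d.2))
    (h1 : ContDiff 𝕜 n fun p ↦ deformedCoord t (NakGroup.coord.symm p))
    (h2 : ContDiff 𝕜 n fun p ↦ NakGroup.coord ((deformedCoord t).symm p)) :
    NakamuraManifold L ≃ₘ^n⟮𝓘(𝕜, ℂ × (ℂ × ℂ)), 𝓘(𝕜, ℂ × (ℂ × ℂ))⟯ DeformedNakamura L t where
  toFun := toDeformed L t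
  invFun := ofDeformed L t
  left_inv x := by
    induction x using Quotient.inductionOn with
    | h g => rfl
  right_inv x := by
    induction x using Quotient.inductionOn with
    | h g => rfl
  contMDiff_toFun := by
    refine (isAffineCovering_nakCover L).contMDiff_of_cover (fun d _ ↦ hD d) fun q ↦ ?_
    have h3 : toDeformed L t ∘ nakCover L =
        deformedCover L t ∘ fun p ↦ deformedCoord t (NakGroup.coord.symm p) := by
      funext p
      simp only [Function.comp_apply, deformedCover, Homeomorph.symm_apply_apply]
      rfl
    change ContMDiffAt _ _ n (toDeformed L t ∘ nakCover L) q
    rw [h3]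
    exact ((isAffineCovering_deformedCover L t).contMDiffAt_cover isOpen_univ (fun d _ ↦ hD d)
      trivial).comp q h1.contMDiff.contMDiffAt
  contMDiff_invFun := by
    refine (isAffineCovering_deformedCover L t).contMDiff_of_cover (fun d _ ↦ hD d) fun q ↦ ?_
    have h3 : ofDeformed L t ∘ deformedCover L t =
        nakCover L ∘ fun p ↦ NakGroup.coord ((deformedCoord t).symm p) := by
      funext p
      simp only [Function.comp_apply, nakCover, Homeomorph.symm_apply_apply]
      rfl
    change ContMDiffAt _ _ n (ofDeformed L t ∘ deformedCover L t) q
    rw [h3]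
    exact ((isAffineCovering_nakCover L).contMDiffAt_cover isOpen_univ (fun d _ ↦ hD d)
      trivial).comp q h2.contMDiff.contMDiffAt

theorem exists_diffeomorph_discZero (L : NakamuraLattice) :
    ∃ e : NakamuraManifold L ≃ₘ^ω⟮𝓘(ℂ, ℂ × (ℂ × ℂ)), 𝓘(ℂ, ℂ × (ℂ × ℂ))⟯
        DeformedNakamura L discZero,
      ∀ g : NakGroup, e (nakProj L g) = deformedProj L discZero g := by
  have h0 : ((discZero : unitDisc) : ℂ) = 0 := rfl
  refine ⟨deformedDiffeomorph L discZero ω (fun d ↦ contDiff_deck d _) ?_ ?_, fun g ↦ rfl⟩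
  · simp only [deformedCoord_apply, Homeomorph.apply_symm_apply, h0, zero_mul, sub_zero]
    exact contDiff_id
  · have : (fun p : ℂ × (ℂ × ℂ) ↦ NakGroup.coord ((deformedCoord discZero).symm p)) = id := by
      funext p
      change ((p.1 + ((discZero : unitDisc) : ℂ) * conj p.1) /
        (1 - ((discZero : unitDisc) : ℂ) * conj ((discZero : unitDisc) : ℂ)), p.2) = p
      simp [h0]
    rw [this]
    exact contDiff_id

theorem exists_diffeomorph (L : NakamuraLattice) (t : unitDisc) :
    ∃ e : NakamuraManifold L ≃ₘ^∞⟮𝓘(ℝ, ℂ × (ℂ × ℂ)), 𝓘(ℝ, ℂ × (ℂ × ℂ))⟯ DeformedNakamura L t,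
      ∀ g : NakGroup, e (nakProj L g) = deformedProj L t g := by
  have hc : ContDiff ℝ ∞ (fun z : ℂ ↦ conj z) := Complex.conjCLE.contDiff
  refine ⟨deformedDiffeomorph L t ∞ (fun d ↦ IsAffineCovering.contDiff_real d _) ?_ ?_,
    fun g ↦ rfl⟩
  · simp only [deformedCoord_apply, Homeomorph.apply_symm_apply]
    exact (contDiff_fst.sub (contDiff_const.mul (hc.comp contDiff_fst))).prodMk contDiff_snd
  · change ContDiff ℝ ∞ fun p : ℂ × (ℂ × ℂ) ↦
      ((p.1 + (t : ℂ) * conj p.1) / (1 - (t : ℂ) * conj (t : ℂ)), p.2)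
    exact ((contDiff_fst.add (contDiff_const.mul (hc.comp contDiff_fst))).div_const _).prodMk
      contDiff_snd

theorem hasMFDerivAt_coord (g : NakGroup) :
    HasMFDerivAt 𝓘(ℝ, ℂ × (ℂ × ℂ)) 𝓘(ℝ, ℂ × (ℂ × ℂ)) NakGroup.coord g
      (ContinuousLinearMap.id ℝ (ℂ × (ℂ × ℂ))) := by
  refine ⟨NakGroup.coord.continuous.continuousAt, ?_⟩
  have : writtenInExtChartAt 𝓘(ℝ, ℂ × (ℂ × ℂ)) 𝓘(ℝ, ℂ × (ℂ × ℂ)) g NakGroup.coord = id := rfl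
  rw [this]
  exact hasFDerivWithinAt_id _ _

namespace IsAffineCovering

theorem exists_mfderiv_eq {E : Type} [NormedAddCommGroup E] [NormedSpace ℂ E]
    {M : Type} [TopologicalSpace M] [ChartedSpace E M] {D : Set ((E →L[ℂ] E) × E)} {π : E → M}
    (h : IsAffineCovering univ D π) (q : E) : ∃ A : E →L[ℂ] E,
      (mfderiv 𝓘(ℝ, E) 𝓘(ℝ, E) π q : E →L[ℝ] E) = A.restrictScalars ℝ := by
  obtain ⟨d, hd, hdq⟩ := h.exists_deck q
  refine ⟨d.1, ?_⟩
  rw [h.mfderiv_affine hd, ← hdq, h.mfderiv_chart]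
  rfl

end IsAffineCovering

theorem mfderiv_deformedProj (L : NakamuraLattice) (t : unitDisc) (g : NakGroup) :
    (mfderiv 𝓘(ℝ, ℂ × (ℂ × ℂ)) 𝓘(ℝ, ℂ × (ℂ × ℂ)) (deformedProj L t) g :
      ℂ × (ℂ × ℂ) →L[ℝ] ℂ × (ℂ × ℂ)) =
    (mfderiv 𝓘(ℝ, ℂ × (ℂ × ℂ)) 𝓘(ℝ, ℂ × (ℂ × ℂ)) (deformedCover L t) (deformedCoord t g) :
      ℂ × (ℂ × ℂ) →L[ℝ] ℂ × (ℂ × ℂ)).comp (twist t) := by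
  have h1 : (deformedProj L t) = deformedCover L t ∘ (twist t ∘ NakGroup.coord) := by
    funext g
    simp only [Function.comp_apply, deformedCover, twist_apply]
    rw [← deformedCoord_apply, Homeomorph.symm_apply_apply]
  have h2 : deformedCoord t g = (twist t ∘ NakGroup.coord) g := by
    rw [Function.comp_apply, twist_apply, deformedCoord_apply]
  have h3 : HasMFDerivAt 𝓘(ℝ, ℂ × (ℂ × ℂ)) 𝓘(ℝ, ℂ × (ℂ × ℂ)) (twist t ∘ NakGroup.coord) g
      ((twist t).comp (ContinuousLinearMap.id ℝ (ℂ × (ℂ × ℂ)))) :=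
    (twist (t : ℂ)).hasMFDerivAt.comp g (hasMFDerivAt_coord g)
  have h4 := ((isAffineCovering_deformedCover L t).mdifferentiableAt
    ((twist t ∘ NakGroup.coord) g)).hasMFDerivAt.comp g h3
  conv_lhs => rw [h1]
  rw [h2]
  exact h4.mfderiv

/-- The differential is a complex linear map after `twist t`. The antilinear part -t v̄₁ of the
twist cancels its linear part applied to φ(v) = (t v̄₁, 0). -/
theorem satisfiesBeltrami_deformedProj (L : NakamuraLattice) (t : unitDisc) :
    SatisfiesBeltrami (E := ℂ × (ℂ × ℂ)) (E' := ℂ × (ℂ × ℂ)) (nakBeltrami t)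
      (deformedProj L t) := by
  intro g v
  obtain ⟨A, hA⟩ := (isAffineCovering_deformedCover L t).exists_mfderiv_eq (deformedCoord t g)
  have key : ∀ T : ℂ × (ℂ × ℂ) →L[ℝ] ℂ × (ℂ × ℂ), T = (A.restrictScalars ℝ).comp (twist t) →
      ∀ w : ℂ × (ℂ × ℂ), w = (t * conj v.1, 0) →
      (2⁻¹ : ℂ) • (T v + I • T (I • v)) + (2⁻¹ : ℂ) • (T w - I • T (I • w)) = 0 := by
    rintro T rfl w rfl
    simp only [ContinuousLinearMap.comp_apply, ContinuousLinearMap.coe_restrictScalars']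
    rw [← map_smul A I, ← map_smul A I, ← map_add A, ← map_sub A, ← smul_add, ← map_add A]
    convert smul_zero _
    convert map_zero A
    rw [twist_apply, twist_apply, twist_apply, twist_apply]
    ext1
    · simp
      ring_nf
      simp
    · simp [smul_smul]
  refine key _ ((mfderiv_deformedProj L t g).trans ?_) _ rfl
  rw [hA]
  rfl

end Comparison

/-! ## Forms of type `(1, 1)` in coordinates -/

section Coordinates

/-- The exterior product of two `1`-forms. -/
def wedgeForm {E : Type} [NormedAddCommGroup E] [NormedSpace ℂ E] (α β : E →L[ℝ] ℂ) :
    CForm E 2 where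
  toFun v := α (v 0) * β (v 1) - α (v 1) * β (v 0)
  map_update_add' m i x y := by
    fin_cases i <;> simp <;> ring
  map_update_smul' m i c x := by
    fin_cases i <;> simp <;> ring
  map_eq_zero_of_eq' v i j h hij := by
    fin_cases i <;> fin_cases j <;> simp_all
  cont := by fun_prop

/-- The coordinate functions of `ℂ³`. -/
def coordFn : Fin 3 → (ℂ × (ℂ × ℂ) →L[ℂ] ℂ) :=
  ![ContinuousLinearMap.fst ℂ ℂ (ℂ × ℂ),
    ContinuousLinearMap.fst ℂ ℂ ℂ ∘L ContinuousLinearMap.snd ℂ ℂ (ℂ × ℂ),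
    ContinuousLinearMap.snd ℂ ℂ ℂ ∘L ContinuousLinearMap.snd ℂ ℂ (ℂ × ℂ)]

theorem coordFn_zero (v : ℂ × (ℂ × ℂ)) : coordFn 0 v = v.1 := rfl

theorem coordFn_one (v : ℂ × (ℂ × ℂ)) : coordFn 1 v = v.2.1 := rfl

theorem coordFn_two (v : ℂ × (ℂ × ℂ)) : coordFn 2 v = v.2.2 := rfl

/-- The form `dw_j ∧ dw̄_k` on `ℂ³`. -/
def basisForm (j k : Fin 3) : CForm (ℂ × (ℂ × ℂ)) 2 :=
  wedgeForm ((coordFn j).restrictScalars ℝ)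
    ((Complex.conjCLE : ℂ →L[ℝ] ℂ) ∘L (coordFn k).restrictScalars ℝ)

theorem basisForm_apply (j k : Fin 3) (v : Fin 2 → ℂ × (ℂ × ℂ)) : basisForm j k v =
    coordFn j (v 0) * conj (coordFn k (v 1)) - coordFn j (v 1) * conj (coordFn k (v 0)) := rfl

/-- The form `∑ a_{jk} dw_j ∧ dw̄_k` on `ℂ³`. -/
def matrixForm (a : Fin 3 → Fin 3 → ℂ) : CForm (ℂ × (ℂ × ℂ)) 2 :=
  ∑ j, ∑ k, a j k • basisForm j k

theorem matrixForm_apply (a : Fin 3 → Fin 3 → ℂ) (v : Fin 2 → ℂ × (ℂ × ℂ)) : matrixForm a v =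
    ∑ j, ∑ k, a j k * (coordFn j (v 0) * conj (coordFn k (v 1)) -
      coordFn j (v 1) * conj (coordFn k (v 0))) := by
  simp [matrixForm, basisForm_apply]

theorem isOfType_matrixForm (a : Fin 3 → Fin 3 → ℂ) : IsOfType 1 1 (matrixForm a) := by
  intro c v
  simp only [matrixForm_apply, map_smul, smul_eq_mul, map_mul, Finset.mul_sum]
  refine Finset.sum_congr rfl fun j _ ↦ Finset.sum_congr rfl fun k _ ↦ ?_
  ring

/-- The factors by which the deck transformation with base part `c` multiplies the coordinates. -/
def deckFactor (c : ℂ) : Fin 3 → ℂ := ![1, Complex.exp c, Complex.exp (-c)]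

theorem coordFn_nakLinear (c : ℂ) (j : Fin 3) (v : ℂ × (ℂ × ℂ)) :
    coordFn j (nakLinear c v) = deckFactor c j * coordFn j v := by
  rw [nakLinear_apply]
  fin_cases j <;> simp [coordFn, deckFactor, nakPhi]

theorem linPullback_matrixForm (c : ℂ) (a : Fin 3 → Fin 3 → ℂ) :
    linPullback (nakLinear c) (matrixForm a) =
      matrixForm fun j k ↦ deckFactor c j * conj (deckFactor c k) * a j k := by
  ext v
  simp only [linPullback, ContinuousAlternatingMap.compContinuousLinearMap_apply, matrixForm_apply,
    Function.comp_apply, ContinuousLinearMap.coe_restrictScalars', coordFn_nakLinear, map_mul]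
  refine Finset.sum_congr rfl fun j _ ↦ Finset.sum_congr rfl fun k _ ↦ ?_
  ring

/-- The product is e^{c - c̄}, and c - c̄ = 2i Im c lies in 2πiℤ: the imaginary part of log λ is 0
or π, according to the sign of λ. It gives the invariance of the metric and of a₁₂ and a₂₁, and the
resonance at t = 0. -/
theorem exp_mul_conj_exp_neg {L : NakamuraLattice} {c : ℂ} (hc : c ∈ L.base) :
    Complex.exp c * conj (Complex.exp (-c)) = 1 := by
  obtain ⟨m, n, rfl⟩ := hc
  rw [← Complex.exp_conj, ← Complex.exp_add, Complex.exp_eq_one_iff]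
  have harg : ∃ k : ℤ, 2 * Complex.arg L.lam = k * (2 * Real.pi) := by
    rcases le_total 0 L.lam with h | h
    · exact ⟨0, by rw [Complex.arg_ofReal_of_nonneg h]; simp⟩
    · rcases h.lt_or_eq with h | h
      · exact ⟨1, by rw [Complex.arg_ofReal_of_neg h]; simp⟩
      · exact ⟨0, by rw [h]; simp⟩
  obtain ⟨k, hk⟩ := harg
  refine ⟨m * k + 2 * n, ?_⟩
  have hl : Complex.log L.lam - conj (Complex.log L.lam) = k * (2 * Real.pi) * I := by
    rw [Complex.sub_conj, Complex.log_im]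
    have : ((2 * Complex.arg L.lam : ℝ) : ℂ) = ((k * (2 * Real.pi) : ℝ) : ℂ) := by rw [hk]
    push_cast at this ⊢
    rw [this]
  simp only [map_neg, map_add, map_mul, map_intCast, Complex.conj_I, Complex.conj_ofReal,
    map_ofNat]
  push_cast
  linear_combination (m : ℂ) * hl

end Coordinates

/-! ## The pseudo-Kähler metrics -/

section PseudoKahler

open Set

/-- The coefficients of the metric in the coordinates of `X_t`. -/
def metricMatrix : Fin 3 → Fin 3 → ℂ := ![![I, 0, 0], ![0, 0, 1], ![0, -1, 0]]

theorem metricMatrix_apply (v : Fin 2 → ℂ × (ℂ × ℂ)) : matrixForm metricMatrix v =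
    I * ((v 0).1 * conj (v 1).1 - (v 1).1 * conj (v 0).1) +
      ((v 0).2.1 * conj (v 1).2.2 - (v 1).2.1 * conj (v 0).2.2) -
      ((v 0).2.2 * conj (v 1).2.1 - (v 1).2.2 * conj (v 0).2.1) := by
  rw [matrixForm_apply]
  simp only [Fin.sum_univ_three, coordFn_zero, coordFn_one, coordFn_two]
  simp [metricMatrix]
  ring

theorem isInvariantForm_metric (L : NakamuraLattice) (t : ℂ) :
    IsInvariantForm (nakDecks L t) fun _ ↦ matrixForm metricMatrix := by
  rintro _ ⟨c, hc, v, hv, rfl⟩ p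
  simp only [nakDeck]
  rw [linPullback_matrixForm]
  have h1 := exp_mul_conj_exp_neg hc
  have h2 := exp_mul_conj_exp_neg (L.base.neg_mem hc)
  rw [neg_neg] at h2
  congr 1
  funext j k
  fin_cases j <;> fin_cases k <;> simp_all [deckFactor, metricMatrix]

theorem pullbackForm_deformedProj (L : NakamuraLattice) (t : unitDisc) {k : ℕ}
    (F : DeformedNakamura L t → CForm (ℂ × (ℂ × ℂ)) k) (g : NakGroup) :
    pullbackForm (deformedProj L t) F g =
      (pullbackForm (deformedCover L t) F (deformedCoord t g)).compContinuousLinearMap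
        (twist t) := by
  have h1 : deformedProj L t g = deformedCover L t (deformedCoord t g) := by
    rw [deformedCover, Homeomorph.symm_apply_apply]
  rw [pullbackForm, mfderiv_deformedProj, h1]
  rfl

theorem isPseudoKahler_metric (L : NakamuraLattice) (t : unitDisc) :
    IsPseudoKahler (descend fun _ ↦ matrixForm metricMatrix :
      DeformedNakamura L t → CForm (ℂ × (ℂ × ℂ)) 2) := by
  have hcov := isAffineCovering_deformedCover L t
  have hinv := isInvariantForm_metric L t
  refine ⟨?_, ?_, fun x ↦ isOfType_matrixForm _, ?_, ?_⟩
  · rw [hcov.isSmoothForm_iff, hcov.pullbackForm_descend hinv]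
    exact contDiff_const
  · intro x v
    rw [descend, metricMatrix_apply]
    simp only [map_add, map_sub, map_mul, Complex.conj_conj, Complex.conj_I]
    ring
  · intro x
    rw [hcov.extDerivForm_eq, hcov.pullbackForm_descend hinv, descend, extDeriv]
    ext v
    simp [ContinuousAlternatingMap.alternatizeUncurryFin_apply]
  · intro x u hu
    have h : ∀ v : ℂ × (ℂ × ℂ), I * (u.1 * conj v.1 - v.1 * conj u.1) +
      (u.2.1 * conj v.2.2 - v.2.1 * conj u.2.2) - (u.2.2 * conj v.2.1 - v.2.2 * conj u.2.1) = 0 := by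
      intro v
      have := hu v
      rw [descend, metricMatrix_apply] at this
      exact this
    have I2 : I * I = -1 := Complex.I_mul_I
    have h1 : u.1 = 0 := by
      -- Testing on a vector and on `I` times it separates `u.1` from its conjugate; the same is
      -- done for the other two coordinates.
      have ha := h (1, (0, 0))
      have hb := h (I, (0, 0))
      simp only [map_one, map_zero, Complex.conj_I] at ha hb
      linear_combination (-I / 2) * ha + (1 / 2) * hb + u.1 * I2
    have h2 : u.2.1 = 0 := by
      have ha := h (0, (0, 1))
      have hb := h (0, (0, I))
      simp only [map_one, map_zero, Complex.conj_I] at ha hb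
      linear_combination (1 / 2) * ha + (I / 2) * hb + (1 / 2) * (u.2.1 - conj u.2.1) * I2
    have h3 : u.2.2 = 0 := by
      have ha := h (0, (1, 0))
      have hb := h (0, (I, 0))
      simp only [map_one, map_zero, Complex.conj_I] at ha hb
      linear_combination (-1 / 2) * ha + (-I / 2) * hb + (1 / 2) * (u.2.2 - conj u.2.2) * I2
    exact Prod.ext h1 (Prod.ext h2 h3)

/-- The factor e^{2i Im z₁} is the inverse of e^{-z₁} e^{z̄₁}, so in the coordinates of X_t the form
has the constant coefficients `metricMatrix`. -/
theorem exists_isPseudoKahler (L : NakamuraLattice) (t : unitDisc) :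
    ∃ F : DeformedNakamura L t → CForm (ℂ × (ℂ × ℂ)) 2, IsPseudoKahler F ∧
      ∀ (g : NakGroup) (u v : ℂ × (ℂ × ℂ)),
        pullbackForm (deformedProj L t) F g ![u, v] = nakMetric t g u v := by
  refine ⟨_, isPseudoKahler_metric L t, fun g u v ↦ ?_⟩
  rw [pullbackForm_deformedProj, (isAffineCovering_deformedCover L t).pullbackForm_descend
    (isInvariantForm_metric L t), ContinuousAlternatingMap.compContinuousLinearMap_apply,
    metricMatrix_apply]
  simp only [Function.comp_apply, Matrix.cons_val_zero, Matrix.cons_val_one, twist_apply,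
    nakMetric, wedge, conjForm, nakOmega1, nakOmega2, nakOmega3, map_mul]
  set z := (NakGroup.coord g).1
  have h1 : Complex.exp (2 * I * z.im) * (Complex.exp (-z) * conj (Complex.exp z)) = 1 := by
    rw [← Complex.exp_conj, ← Complex.exp_add, ← Complex.exp_add, Complex.exp_eq_one_iff]
    refine ⟨0, ?_⟩
    have := Complex.sub_conj z
    push_cast at this
    rw [Int.cast_zero, zero_mul]
    linear_combination -this
  have h2 : Complex.exp (-(2 * I * z.im)) * (conj (Complex.exp (-z)) * Complex.exp z) = 1 := by
    rw [← Complex.exp_conj, ← Complex.exp_add, ← Complex.exp_add, Complex.exp_eq_one_iff]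
    refine ⟨0, ?_⟩
    have := Complex.sub_conj z
    push_cast at this
    rw [Int.cast_zero, zero_mul, map_neg]
    linear_combination this
  linear_combination (-(u.2.1 * conj v.2.2 - v.2.1 * conj u.2.2)) * h1 +
    (u.2.2 * conj v.2.1 - v.2.2 * conj u.2.1) * h2

end PseudoKahler

/-! ## Wirtinger derivatives and type components -/

section Wirtinger

variable {E : Type} [NormedAddCommGroup E] [NormedSpace ℂ E] [FiniteDimensional ℝ E]

theorem dirDeriv_add_left (u v : E) (F : E → ℂ) :
    dirDeriv (u + v) F = dirDeriv u F + dirDeriv v F := by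
  funext p; simp [dirDeriv]

theorem dirDeriv_smul_left (c : ℝ) (u : E) (F : E → ℂ) (p : E) :
    dirDeriv (c • u) F p = c * dirDeriv u F p := by
  simp [dirDeriv]

theorem dirDeriv_add {F G : E → ℂ} (hF : ContDiff ℝ ∞ F) (hG : ContDiff ℝ ∞ G) (u : E) :
    dirDeriv u (F + G) = dirDeriv u F + dirDeriv u G := by
  funext p
  simp only [dirDeriv, Pi.add_apply]
  rw [fderiv_add (hF.differentiable (by simp) p) (hG.differentiable (by simp) p)]
  rfl

theorem dirDeriv_const_smul {F : E → ℂ} (hF : ContDiff ℝ ∞ F) (c : ℂ) (u : E) :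
    dirDeriv u (c • F) = c • dirDeriv u F := by
  funext p
  simp only [dirDeriv, Pi.smul_apply]
  rw [fderiv_const_smul (hF.differentiable (by simp) p)]
  rfl

theorem dirDeriv_comm {F : E → ℂ} (hF : ContDiff ℝ ∞ F) (u v : E) :
    dirDeriv u (dirDeriv v F) = dirDeriv v (dirDeriv u F) := by
  funext p
  have hd : Differentiable ℝ (fderiv ℝ F) :=
    (hF.fderiv_right (m := ∞) (by simp)).differentiable (by simp)
  have h : ∀ a b : E, dirDeriv a (dirDeriv b F) p = fderiv ℝ (fderiv ℝ F) p a b := by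
    intro a b
    unfold dirDeriv
    rw [fderiv_clm_apply (hd p) (differentiableAt_const _)]
    simp
  rw [h, h]
  exact (hF.contDiffAt.isSymmSndFDerivAt (by
    rw [minSmoothness_of_isRCLikeNormedField]; exact WithTop.coe_le_coe.2 le_top)) u v

/-- The derivative `∂_u F`, the complex linear part of `u ↦ D_u F`. -/
def wirt (u : E) (F : E → ℂ) (p : E) : ℂ := 2⁻¹ * (dirDeriv u F p - I * dirDeriv (I • u) F p)

/-- The derivative `∂̄_u F`, the antilinear part of `u ↦ D_u F`. -/
def wirtBar (u : E) (F : E → ℂ) (p : E) : ℂ := 2⁻¹ * (dirDeriv u F p + I * dirDeriv (I • u) F p)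

theorem wirt_add_wirtBar (u : E) (F : E → ℂ) (p : E) :
    wirt u F p + wirtBar u F p = dirDeriv u F p := by
  simp only [wirt, wirtBar]; ring

theorem dirDeriv_I_smul (u : E) (F : E → ℂ) (p : E) :
    dirDeriv (I • u) F p = I * wirt u F p - I * wirtBar u F p := by
  simp only [wirt, wirtBar]
  linear_combination dirDeriv (I • u) F p * Complex.I_sq

theorem dirDeriv_smul_complex (c : ℂ) (u : E) (F : E → ℂ) (p : E) :
    dirDeriv (c • u) F p = c * wirt u F p + conj c * wirtBar u F p := by
  have h : c • u = c.re • u + c.im • (I • u) := by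
    conv_lhs => rw [← Complex.re_add_im c]
    rw [add_smul, mul_smul]
    rfl
  rw [h, dirDeriv_add_left, Pi.add_apply, dirDeriv_smul_left, dirDeriv_smul_left,
    ← wirt_add_wirtBar, dirDeriv_I_smul]
  have h1 : c = c.re + c.im * I := (Complex.re_add_im c).symm
  have h2 : conj c = c.re - c.im * I := by
    apply Complex.ext <;> simp
  rw [h2]
  conv_rhs => enter [1, 1]; rw [h1]
  ring

theorem wirt_add_left (u v : E) (F : E → ℂ) (p : E) :
    wirt (u + v) F p = wirt u F p + wirt v F p := by
  simp only [wirt, smul_add, dirDeriv_add_left, Pi.add_apply]; ring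

theorem wirtBar_add_left (u v : E) (F : E → ℂ) (p : E) :
    wirtBar (u + v) F p = wirtBar u F p + wirtBar v F p := by
  simp only [wirtBar, smul_add, dirDeriv_add_left, Pi.add_apply]; ring

theorem wirt_smul_left (c : ℂ) (u : E) (F : E → ℂ) (p : E) :
    wirt (c • u) F p = c * wirt u F p := by
  rw [wirt, smul_smul, dirDeriv_smul_complex, dirDeriv_smul_complex]
  simp only [map_mul, Complex.conj_I]
  linear_combination (-2⁻¹ * (c * wirt u F p - conj c * wirtBar u F p)) * Complex.I_sq

theorem wirtBar_smul_left (c : ℂ) (u : E) (F : E → ℂ) (p : E) :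
    wirtBar (c • u) F p = conj c * wirtBar u F p := by
  rw [wirtBar, smul_smul, dirDeriv_smul_complex, dirDeriv_smul_complex]
  simp only [map_mul, Complex.conj_I]
  linear_combination (2⁻¹ * (c * wirt u F p - conj c * wirtBar u F p)) * Complex.I_sq

theorem wirt_eq (u : E) (F : E → ℂ) :
    wirt u F = (2⁻¹ : ℂ) • (dirDeriv u F + (-I) • dirDeriv (I • u) F) := by
  funext p; simp [wirt, sub_eq_add_neg]

theorem wirtBar_eq (u : E) (F : E → ℂ) :
    wirtBar u F = (2⁻¹ : ℂ) • (dirDeriv u F + I • dirDeriv (I • u) F) := by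
  funext p; simp [wirtBar]

theorem contDiff_wirt {F : E → ℂ} (hF : ContDiff ℝ ∞ F) (u : E) : ContDiff ℝ ∞ (wirt u F) := by
  rw [wirt_eq]
  exact ((hF.dirDeriv u).add ((hF.dirDeriv _).const_smul (-I))).const_smul (2⁻¹ : ℂ)

theorem contDiff_wirtBar {F : E → ℂ} (hF : ContDiff ℝ ∞ F) (u : E) :
    ContDiff ℝ ∞ (wirtBar u F) := by
  rw [wirtBar_eq]
  exact ((hF.dirDeriv u).add ((hF.dirDeriv _).const_smul I)).const_smul (2⁻¹ : ℂ)

theorem dirDeriv_wirt {F : E → ℂ} (hF : ContDiff ℝ ∞ F) (u v : E) :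
    dirDeriv u (wirt v F) = wirt v (dirDeriv u F) := by
  rw [wirt_eq, wirt_eq, dirDeriv_const_smul, dirDeriv_add (hF.dirDeriv _), dirDeriv_const_smul,
    dirDeriv_comm hF u, dirDeriv_comm hF u]
  · exact hF.dirDeriv _
  · exact (hF.dirDeriv _).const_smul (-I)
  · exact (hF.dirDeriv v).add ((hF.dirDeriv _).const_smul (-I))

theorem dirDeriv_wirtBar {F : E → ℂ} (hF : ContDiff ℝ ∞ F) (u v : E) :
    dirDeriv u (wirtBar v F) = wirtBar v (dirDeriv u F) := by
  rw [wirtBar_eq, wirtBar_eq, dirDeriv_const_smul, dirDeriv_add (hF.dirDeriv _),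
    dirDeriv_const_smul, dirDeriv_comm hF u, dirDeriv_comm hF u]
  · exact hF.dirDeriv _
  · exact (hF.dirDeriv _).const_smul I
  · exact (hF.dirDeriv v).add ((hF.dirDeriv _).const_smul I)

theorem wirt_add {F G : E → ℂ} (hF : ContDiff ℝ ∞ F) (hG : ContDiff ℝ ∞ G) (u : E) :
    wirt u (F + G) = wirt u F + wirt u G := by
  funext p; simp only [wirt, dirDeriv_add hF hG, Pi.add_apply]; ring

theorem wirtBar_add {F G : E → ℂ} (hF : ContDiff ℝ ∞ F) (hG : ContDiff ℝ ∞ G) (u : E) :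
    wirtBar u (F + G) = wirtBar u F + wirtBar u G := by
  funext p; simp only [wirtBar, dirDeriv_add hF hG, Pi.add_apply]; ring

theorem wirt_const_smul {F : E → ℂ} (hF : ContDiff ℝ ∞ F) (c : ℂ) (u : E) :
    wirt u (c • F) = c • wirt u F := by
  funext p; simp only [wirt, dirDeriv_const_smul hF, Pi.smul_apply, smul_eq_mul]; ring

theorem wirtBar_const_smul {F : E → ℂ} (hF : ContDiff ℝ ∞ F) (c : ℂ) (u : E) :
    wirtBar u (c • F) = c • wirtBar u F := by
  funext p; simp only [wirtBar, dirDeriv_const_smul hF, Pi.smul_apply, smul_eq_mul]; ring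

theorem wirt_comm {F : E → ℂ} (hF : ContDiff ℝ ∞ F) (u v : E) :
    wirt u (wirt v F) = wirt v (wirt u F) := by
  rw [wirt_eq u, dirDeriv_wirt hF, dirDeriv_wirt hF, ← wirt_const_smul (hF.dirDeriv _),
    ← wirt_add (hF.dirDeriv _), ← wirt_const_smul, ← wirt_eq]
  · exact (hF.dirDeriv u).add ((hF.dirDeriv _).const_smul (-I))
  · exact (hF.dirDeriv _).const_smul (-I)

theorem wirt_wirtBar_comm {F : E → ℂ} (hF : ContDiff ℝ ∞ F) (u v : E) :
    wirt u (wirtBar v F) = wirtBar v (wirt u F) := by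
  rw [wirt_eq u, dirDeriv_wirtBar hF, dirDeriv_wirtBar hF, ← wirtBar_const_smul (hF.dirDeriv _),
    ← wirtBar_add (hF.dirDeriv _), ← wirtBar_const_smul, ← wirt_eq]
  · exact (hF.dirDeriv u).add ((hF.dirDeriv _).const_smul (-I))
  · exact (hF.dirDeriv _).const_smul (-I)

theorem wirtBar_comm {F : E → ℂ} (hF : ContDiff ℝ ∞ F) (u v : E) :
    wirtBar u (wirtBar v F) = wirtBar v (wirtBar u F) := by
  rw [wirtBar_eq u, dirDeriv_wirtBar hF, dirDeriv_wirtBar hF,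
    ← wirtBar_const_smul (hF.dirDeriv _),
    ← wirtBar_add (hF.dirDeriv _), ← wirtBar_const_smul, ← wirtBar_eq]
  · exact (hF.dirDeriv u).add ((hF.dirDeriv _).const_smul I)
  · exact (hF.dirDeriv _).const_smul I

/-- Orthogonality of roots of unity. Type components can thus be read off from the dependence of
η(cv) on c, without decomposing the form itself. -/
theorem typeComponent_apply_of_expansion {k p q : ℕ} (hpq : p + q = k) (η : CForm E k)
    (v : Fin k → E) (A : ℕ → ℂ) (h : ∀ c : ℂ, η (fun i ↦ c • v i) =
      ∑ m ∈ Finset.range (k + 1), c ^ m * conj c ^ (k - m) * A m) :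
    typeComponent p q η v = A p := by
  have hN : ((2 * k + 1 : ℕ) : ℂ) ≠ 0 := Nat.cast_ne_zero.2 (by omega)
  set N : ℂ := ((2 * k + 1 : ℕ) : ℂ) with hNdef
  have h1 : ∀ j : ℕ, (η.compContinuousLinearMap
      (Complex.exp (2 * Real.pi * I * j / N) • ContinuousLinearMap.id ℝ E)) v =
      ∑ m ∈ Finset.range (k + 1), Complex.exp (2 * Real.pi * I * j / N) ^ m *
        conj (Complex.exp (2 * Real.pi * I * j / N)) ^ (k - m) * A m := by
    intro j
    rw [← h]
    rfl
  have h2 : ∀ j m : ℕ, m ∈ Finset.range (k + 1) →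
      Complex.exp (-(2 * Real.pi * I * j * ((p : ℂ) - q)) / N) *
        (Complex.exp (2 * Real.pi * I * j / N) ^ m *
        conj (Complex.exp (2 * Real.pi * I * j / N)) ^ (k - m) * A m) =
      Complex.exp (2 * Real.pi * I * (2 * m - 2 * p) / N) ^ j * A m := by
    intro j m hm
    have hm' : m ≤ k := Nat.lt_succ_iff.1 (Finset.mem_range.1 hm)
    rw [← Complex.exp_conj, ← Complex.exp_nat_mul, ← Complex.exp_nat_mul, ← Complex.exp_nat_mul,
      ← mul_assoc, ← mul_assoc, ← Complex.exp_add, ← Complex.exp_add]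
    congr 2
    have hN' : conj N = N := by rw [hNdef, Complex.conj_natCast]
    simp only [map_div₀, map_mul, Complex.conj_I, Complex.conj_ofReal, Complex.conj_natCast, hN',
      map_ofNat]
    rw [Nat.cast_sub hm']
    have hk : (k : ℂ) = p + q := by exact_mod_cast hpq.symm
    rw [hk]
    field_simp
    ring
  have h3 : typeComponent p q η v = N⁻¹ * ∑ j ∈ Finset.range (2 * k + 1),
      ∑ m ∈ Finset.range (k + 1),
        Complex.exp (2 * Real.pi * I * (2 * m - 2 * p) / N) ^ j * A m := by
    simp only [typeComponent, ContinuousAlternatingMap.smul_apply,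
      ContinuousAlternatingMap.sum_apply, smul_eq_mul]
    congr 1
    refine Finset.sum_congr rfl fun j _ ↦ ?_
    rw [← hNdef, h1, Finset.mul_sum]
    exact Finset.sum_congr rfl fun m hm ↦ h2 j m hm
  rw [h3, Finset.sum_comm, Finset.sum_eq_single p]
  · simp only [sub_self, mul_zero, zero_div, Complex.exp_zero, one_pow, one_mul, Finset.sum_const,
      Finset.card_range, nsmul_eq_mul, ← hNdef]
    field_simp
  · intro m hm hmp
    rw [← Finset.sum_mul]
    have hm' : m ≤ k := Nat.lt_succ_iff.1 (Finset.mem_range.1 hm)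
    set ζ := Complex.exp (2 * Real.pi * I * (2 * m - 2 * p) / N) with hζ
    have hζ1 : ζ ≠ 1 := by
      rw [hζ, Ne, Complex.exp_eq_one_iff]
      rintro ⟨n, hn⟩
      have h4 : ((2 * m - 2 * p : ℤ) : ℂ) = ((n * (2 * k + 1 : ℕ) : ℤ) : ℂ) := by
        have h5 : (2 * Real.pi * I : ℂ) ≠ 0 := Complex.two_pi_I_ne_zero
        apply mul_left_cancel₀ h5
        push_cast
        rw [div_eq_iff hN] at hn
        rw [hn, hNdef]
        push_cast
        ring
      have h5 : (2 * m - 2 * p : ℤ) = n * (2 * k + 1 : ℕ) := by exact_mod_cast h4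
      -- Since |2m - 2p| ≤ 2k < 2k + 1, the only possible multiple of 2k + 1 is zero. This is why
      -- the order is 2k + 1.
      have h6 : n = 0 := by
        by_contra hn0
        rcases lt_or_gt_of_ne hn0 with h7 | h7
        · push_cast at h5
          nlinarith
        · push_cast at h5
          nlinarith
      rw [h6] at h5
      omega
    have hζN : ζ ^ (2 * k + 1) = 1 := by
      rw [hζ, ← Complex.exp_nat_mul, Complex.exp_eq_one_iff]
      refine ⟨2 * m - 2 * p, ?_⟩
      rw [← hNdef]
      push_cast
      field_simp
    have h4 : ∑ j ∈ Finset.range (2 * k + 1), ζ ^ j = 0 := by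
      rw [geom_sum_eq hζ1, hζN, sub_self, zero_div]
    rw [h4, zero_mul]
  · intro hp
    exact absurd (Finset.mem_range.2 (by omega)) hp

end Wirtinger

/-! ## The coefficients of forms of type `(1, 1)` on `ℂ³` -/

section Coefficients

theorem CForm.map_add_left {E : Type} [NormedAddCommGroup E] [NormedSpace ℂ E] (η : CForm E 2)
    (u u' v : E) : η ![u + u', v] = η ![u, v] + η ![u', v] := by
  have h : ∀ x, Function.update ![u, v] 0 x = ![x, v] := by
    intro x; funext i; fin_cases i <;> simp
  simpa only [h] using η.map_update_add ![u, v] 0 u u'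

theorem CForm.map_add_right {E : Type} [NormedAddCommGroup E] [NormedSpace ℂ E] (η : CForm E 2)
    (u v v' : E) : η ![u, v + v'] = η ![u, v] + η ![u, v'] := by
  have h : ∀ x, Function.update ![u, v] 1 x = ![u, x] := by
    intro x; funext i; fin_cases i <;> simp
  simpa only [h] using η.map_update_add ![u, v] 1 v v'

theorem CForm.map_smul_left {E : Type} [NormedAddCommGroup E] [NormedSpace ℂ E] (η : CForm E 2)
    (c : ℝ) (u v : E) : η ![c • u, v] = c * η ![u, v] := by
  have h : ∀ x, Function.update ![u, v] 0 x = ![x, v] := by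
    intro x; funext i; fin_cases i <;> simp
  simpa only [h, Complex.real_smul] using η.map_update_smul ![u, v] 0 c u

theorem CForm.map_smul_right {E : Type} [NormedAddCommGroup E] [NormedSpace ℂ E] (η : CForm E 2)
    (c : ℝ) (u v : E) : η ![u, c • v] = c * η ![u, v] := by
  have h : ∀ x, Function.update ![u, v] 1 x = ![u, x] := by
    intro x; funext i; fin_cases i <;> simp
  simpa only [h, Complex.real_smul] using η.map_update_smul ![u, v] 1 c v

theorem CForm.map_swap {E : Type} [NormedAddCommGroup E] [NormedSpace ℂ E] (η : CForm E 2)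
    (u v : E) : η ![v, u] = -η ![u, v] := by
  have h : ![u, v] ∘ Equiv.swap (0 : Fin 2) 1 = ![v, u] := by
    funext i; fin_cases i <;> simp
  rw [← h]
  exact η.toAlternatingMap.map_swap ![u, v] (by decide)

theorem smul_eq_re_im {E : Type} [NormedAddCommGroup E] [NormedSpace ℂ E] (c : ℂ) (u : E) :
    c • u = c.re • u + c.im • (I • u) := by
  conv_lhs => rw [← Complex.re_add_im c]
  rw [add_smul, mul_smul]
  rfl

theorem IsOfType.map_I_I {E : Type} [NormedAddCommGroup E] [NormedSpace ℂ E] {η : CForm E 2}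
    (h : IsOfType 1 1 η) (u v : E) : η ![I • u, I • v] = η ![u, v] := by
  have h1 := h I ![u, v]
  have h2 : (fun i ↦ I • ![u, v] i) = ![I • u, I • v] := by
    funext i; fin_cases i <;> simp
  rw [h2] at h1
  simpa using h1

theorem IsOfType.map_I_left {E : Type} [NormedAddCommGroup E] [NormedSpace ℂ E] {η : CForm E 2}
    (h : IsOfType 1 1 η) (u v : E) : η ![I • u, v] = -η ![u, I • v] := by
  rw [← h.map_I_I u (I • v), smul_smul, Complex.I_mul_I, neg_smul, one_smul]
  have := η.map_smul_right (-1) (I • u) v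
  rw [neg_smul, one_smul] at this
  rw [this]
  simp

theorem CForm.map_neg_right {E : Type} [NormedAddCommGroup E] [NormedSpace ℂ E] (η : CForm E 2)
    (u v : E) : η ![u, -v] = -η ![u, v] := by
  have := η.map_smul_right (-1) u v
  rw [neg_smul, one_smul] at this
  rw [this]
  simp

/-- The sesquilinear form `h` with `η(u, v) = h(u, v) - h(v, u)`, for `η` of type `(1, 1)`. -/
def sesqOfForm {E : Type} [NormedAddCommGroup E] [NormedSpace ℂ E] {η : CForm E 2}
    (h : IsOfType 1 1 η) : E →ₗ[ℂ] E →ₛₗ[starRingEnd ℂ] ℂ :=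
  LinearMap.mk₂'ₛₗ (RingHom.id ℂ) (starRingEnd ℂ)
    (fun u v ↦ 2⁻¹ * (η ![u, v] + I * η ![u, I • v]))
    (fun u u' v ↦ by rw [η.map_add_left, η.map_add_left]; ring)
    (fun c u v ↦ by
      rw [smul_eq_re_im, η.map_add_left, η.map_add_left, η.map_smul_left, η.map_smul_left,
        η.map_smul_left, η.map_smul_left, h.map_I_left, h.map_I_left, smul_smul,
        Complex.I_mul_I, neg_one_smul, η.map_neg_right, RingHom.id_apply, smul_eq_mul]
      conv_rhs => rw [← Complex.re_add_im c]
      linear_combination (-2⁻¹ * c.im * η ![u, I • v]) * Complex.I_sq)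
    (fun u v v' ↦ by rw [smul_add, η.map_add_right, η.map_add_right]; ring)
    (fun c u v ↦ by
      have h1 : I • c • v = c • I • v := smul_comm _ _ _
      rw [h1, smul_eq_re_im, smul_eq_re_im c (I • v), η.map_add_right, η.map_add_right,
        η.map_smul_right, η.map_smul_right,
        η.map_smul_right, η.map_smul_right, smul_smul,
        Complex.I_mul_I, neg_one_smul, η.map_neg_right, smul_eq_mul]
      have h2 : conj c = c.re - c.im * I := by
        apply Complex.ext <;> simp
      rw [h2]
      linear_combination (2⁻¹ * c.im * η ![u, I • v]) * Complex.I_sq)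

theorem sesqOfForm_apply {E : Type} [NormedAddCommGroup E] [NormedSpace ℂ E] {η : CForm E 2}
    (h : IsOfType 1 1 η) (u v : E) :
    sesqOfForm h u v = 2⁻¹ * (η ![u, v] + I * η ![u, I • v]) := rfl

theorem sesqOfForm_sub {E : Type} [NormedAddCommGroup E] [NormedSpace ℂ E] {η : CForm E 2}
    (h : IsOfType 1 1 η) (u v : E) : sesqOfForm h u v - sesqOfForm h v u = η ![u, v] := by
  rw [sesqOfForm_apply, sesqOfForm_apply, η.map_swap u v, η.map_swap (I • u) v, h.map_I_left]
  ring

/-- The standard basis of `ℂ³`. -/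
def basisVec : Fin 3 → ℂ × (ℂ × ℂ) := ![(1, (0, 0)), (0, (1, 0)), (0, (0, 1))]

theorem coordFn_basisVec (j k : Fin 3) : coordFn j (basisVec k) = if j = k then 1 else 0 := by
  fin_cases j <;> fin_cases k <;> simp [coordFn, basisVec]

theorem sum_coordFn_smul (u : ℂ × (ℂ × ℂ)) : ∑ j, coordFn j u • basisVec j = u := by
  rw [Fin.sum_univ_three]
  ext <;> simp [coordFn, basisVec]

/-- The coefficients of a form of type `(1, 1)`. -/
def formCoeff (η : CForm (ℂ × (ℂ × ℂ)) 2) (j k : Fin 3) : ℂ :=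
  2⁻¹ * (η ![basisVec j, basisVec k] + I * η ![basisVec j, I • basisVec k])

theorem sesqOfForm_eq_sum {η : CForm (ℂ × (ℂ × ℂ)) 2} (h : IsOfType 1 1 η) (u v : ℂ × (ℂ × ℂ)) :
    sesqOfForm h u v = ∑ j, ∑ k, formCoeff η j k * (coordFn j u * conj (coordFn k v)) := by
  conv_lhs => rw [← sum_coordFn_smul u, ← sum_coordFn_smul v]
  simp only [map_sum, LinearMap.sum_apply, map_smul, LinearMap.smul_apply, map_smulₛₗ,
    smul_eq_mul, sesqOfForm_apply, Finset.mul_sum, formCoeff]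
  rw [Finset.sum_comm]
  refine Finset.sum_congr rfl fun j _ ↦ Finset.sum_congr rfl fun k _ ↦ ?_
  ring

theorem matrixForm_formCoeff {η : CForm (ℂ × (ℂ × ℂ)) 2} (h : IsOfType 1 1 η) :
    matrixForm (formCoeff η) = η := by
  ext v
  have hv : v = ![v 0, v 1] := by funext i; fin_cases i <;> rfl
  rw [matrixForm_apply]
  conv_rhs => rw [hv, ← sesqOfForm_sub h, sesqOfForm_eq_sum, sesqOfForm_eq_sum]
  simp only [mul_sub, Finset.sum_sub_distrib]

theorem formCoeff_matrixForm (a : Fin 3 → Fin 3 → ℂ) : formCoeff (matrixForm a) = a := by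
  funext j k
  simp only [formCoeff, matrixForm_apply, Matrix.cons_val_zero, Matrix.cons_val_one, map_smul,
    coordFn_basisVec]
  fin_cases j <;> fin_cases k <;> simp [Fin.sum_univ_three] <;> ring_nf <;> simp <;> ring

end Coefficients

/-! ## Exterior derivatives in coordinates -/

section ExteriorDerivative

/-- The coordinates of a vector. -/
def coords (u : ℂ × (ℂ × ℂ)) (j : Fin 3) : ℂ := coordFn j u

/-- The conjugate coordinates of a vector. -/
def conjCoords (u : ℂ × (ℂ × ℂ)) (j : Fin 3) : ℂ := conj (coordFn j u)

theorem coords_smul (c : ℂ) (u : ℂ × (ℂ × ℂ)) : coords (c • u) = c • coords u := by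
  funext j; simp [coords]

theorem conjCoords_smul (c : ℂ) (u : ℂ × (ℂ × ℂ)) :
    conjCoords (c • u) = conj c • conjCoords u := by
  funext j; simp [conjCoords]

theorem coords_basisVec (j : Fin 3) : coords (basisVec j) = Pi.single j 1 := by
  funext k
  rw [coords, coordFn_basisVec, Pi.single_apply]

theorem conjCoords_basisVec (j : Fin 3) : conjCoords (basisVec j) = Pi.single j 1 := by
  funext k
  rw [conjCoords, coordFn_basisVec, Pi.single_apply]
  split_ifs <;> simp

/-- The trilinear form with coefficients `g`. -/
def trilin (g : Fin 3 → Fin 3 → Fin 3 → ℂ) (x y z : Fin 3 → ℂ) : ℂ :=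
  ∑ l, ∑ j, ∑ k, g l j k * (x l * y j * z k)

theorem trilin_smul_left (g : Fin 3 → Fin 3 → Fin 3 → ℂ) (c : ℂ) (x y z : Fin 3 → ℂ) :
    trilin g (c • x) y z = c * trilin g x y z := by
  simp only [trilin, Finset.mul_sum, Pi.smul_apply, smul_eq_mul]
  refine Finset.sum_congr rfl fun l _ ↦ Finset.sum_congr rfl fun j _ ↦
    Finset.sum_congr rfl fun k _ ↦ by ring

theorem trilin_smul_mid (g : Fin 3 → Fin 3 → Fin 3 → ℂ) (c : ℂ) (x y z : Fin 3 → ℂ) :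
    trilin g x (c • y) z = c * trilin g x y z := by
  simp only [trilin, Finset.mul_sum, Pi.smul_apply, smul_eq_mul]
  refine Finset.sum_congr rfl fun l _ ↦ Finset.sum_congr rfl fun j _ ↦
    Finset.sum_congr rfl fun k _ ↦ by ring

theorem trilin_smul_right (g : Fin 3 → Fin 3 → Fin 3 → ℂ) (c : ℂ) (x y z : Fin 3 → ℂ) :
    trilin g x y (c • z) = c * trilin g x y z := by
  simp only [trilin, Finset.mul_sum, Pi.smul_apply, smul_eq_mul]
  refine Finset.sum_congr rfl fun l _ ↦ Finset.sum_congr rfl fun j _ ↦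
    Finset.sum_congr rfl fun k _ ↦ by ring

theorem trilin_single (g : Fin 3 → Fin 3 → Fin 3 → ℂ) (l j k : Fin 3) :
    trilin g (Pi.single l 1) (Pi.single j 1) (Pi.single k 1) = g l j k := by
  simp [trilin, Pi.single_apply]

theorem trilin_comm_left {g : Fin 3 → Fin 3 → Fin 3 → ℂ} (hg : ∀ l j k, g l j k = g j l k)
    (x y z : Fin 3 → ℂ) : trilin g x y z = trilin g y x z := by
  rw [trilin, trilin, Finset.sum_comm]
  refine Finset.sum_congr rfl fun l _ ↦ Finset.sum_congr rfl fun j _ ↦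
    Finset.sum_congr rfl fun k _ ↦ ?_
  rw [hg j l k]; ring

theorem trilin_comm_outer {g : Fin 3 → Fin 3 → Fin 3 → ℂ} (hg : ∀ l j k, g l j k = g k j l)
    (x y z : Fin 3 → ℂ) : trilin g x y z = trilin g z y x := by
  have h1 : trilin g x y z = ∑ k, ∑ j, ∑ l, g l j k * (x l * y j * z k) := by
    have h2 : trilin g x y z = ∑ l, ∑ k, ∑ j, g l j k * (x l * y j * z k) :=
      Finset.sum_congr rfl fun l _ ↦ Finset.sum_comm
    rw [h2, Finset.sum_comm]
    exact Finset.sum_congr rfl fun k _ ↦ Finset.sum_comm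
  rw [h1, trilin]
  refine Finset.sum_congr rfl fun l _ ↦ Finset.sum_congr rfl fun j _ ↦
    Finset.sum_congr rfl fun k _ ↦ ?_
  rw [hg k j l]; ring

/-- The component of type `(2, 1)` of a sum of terms `g_{ljk} dw_l ∧ dw_j ∧ dw̄_k`. -/
def alternate21 (g : Fin 3 → Fin 3 → Fin 3 → ℂ) (v : Fin 3 → ℂ × (ℂ × ℂ)) : ℂ :=
  trilin g (coords (v 0)) (coords (v 1)) (conjCoords (v 2)) -
    trilin g (coords (v 0)) (coords (v 2)) (conjCoords (v 1)) -
    trilin g (coords (v 1)) (coords (v 0)) (conjCoords (v 2)) +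
    trilin g (coords (v 1)) (coords (v 2)) (conjCoords (v 0)) +
    trilin g (coords (v 2)) (coords (v 0)) (conjCoords (v 1)) -
    trilin g (coords (v 2)) (coords (v 1)) (conjCoords (v 0))

/-- The component of type `(1, 2)` of a sum of terms `g_{ljk} dw̄_l ∧ dw_j ∧ dw̄_k`. -/
def alternate12 (g : Fin 3 → Fin 3 → Fin 3 → ℂ) (v : Fin 3 → ℂ × (ℂ × ℂ)) : ℂ :=
  trilin g (conjCoords (v 0)) (coords (v 1)) (conjCoords (v 2)) -
    trilin g (conjCoords (v 0)) (coords (v 2)) (conjCoords (v 1)) -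
    trilin g (conjCoords (v 1)) (coords (v 0)) (conjCoords (v 2)) +
    trilin g (conjCoords (v 1)) (coords (v 2)) (conjCoords (v 0)) +
    trilin g (conjCoords (v 2)) (coords (v 0)) (conjCoords (v 1)) -
    trilin g (conjCoords (v 2)) (coords (v 1)) (conjCoords (v 0))

theorem alternate21_smul (g : Fin 3 → Fin 3 → Fin 3 → ℂ) (c : ℂ) (v : Fin 3 → ℂ × (ℂ × ℂ)) :
    alternate21 g (fun i ↦ c • v i) = c ^ 2 * conj c * alternate21 g v := by
  simp only [alternate21, coords_smul, conjCoords_smul, trilin_smul_left, trilin_smul_mid,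
    trilin_smul_right]
  ring

theorem alternate12_smul (g : Fin 3 → Fin 3 → Fin 3 → ℂ) (c : ℂ) (v : Fin 3 → ℂ × (ℂ × ℂ)) :
    alternate12 g (fun i ↦ c • v i) = c * conj c ^ 2 * alternate12 g v := by
  simp only [alternate12, coords_smul, conjCoords_smul, trilin_smul_left, trilin_smul_mid,
    trilin_smul_right]
  ring

/-- Multiplying the third argument by `I` changes the terms that are antilinear in it by -I and the
others by I. A combination of the two evaluations keeps only the former, g l j k - g j l k. -/
theorem alternate21_eq_zero_iff (g : Fin 3 → Fin 3 → Fin 3 → ℂ) :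
    (∀ v, alternate21 g v = 0) ↔ ∀ l j k, g l j k = g j l k := by
  constructor
  · intro h l j k
    have h1 := h ![basisVec l, basisVec j, basisVec k]
    have h2 := h ![basisVec l, basisVec j, I • basisVec k]
    simp only [alternate21, Matrix.cons_val_zero, Matrix.cons_val_one, Matrix.cons_val_two,
      Matrix.tail_cons, Matrix.head_cons, coords_smul, conjCoords_smul,
      trilin_smul_left, trilin_smul_mid, trilin_smul_right, coords_basisVec, conjCoords_basisVec,
      trilin_single, Complex.conj_I] at h1 h2
    linear_combination 2⁻¹ * h1 + 2⁻¹ * I * h2 + 2⁻¹ * (g l j k - g j l k + g l k j - g j k l - g k l j + g k j l) * Complex.I_sq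
  · intro h v
    have h' := trilin_comm_left h
    rw [alternate21, h' (coords (v 0)) (coords (v 1)), h' (coords (v 0)) (coords (v 2)),
      h' (coords (v 1)) (coords (v 2))]
    ring

theorem alternate12_eq_zero_iff (g : Fin 3 → Fin 3 → Fin 3 → ℂ) :
    (∀ v, alternate12 g v = 0) ↔ ∀ l j k, g l j k = g k j l := by
  constructor
  · intro h l j k
    have h1 := h ![basisVec l, basisVec j, basisVec k]
    have h2 := h ![basisVec l, I • basisVec j, basisVec k]
    simp only [alternate12, Matrix.cons_val_zero, Matrix.cons_val_one, Matrix.cons_val_two,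
      Matrix.tail_cons, Matrix.head_cons, coords_smul, conjCoords_smul,
      trilin_smul_left, trilin_smul_mid, trilin_smul_right, coords_basisVec, conjCoords_basisVec,
      trilin_single, Complex.conj_I] at h1 h2
    linear_combination 2⁻¹ * h1 - 2⁻¹ * I * h2 + 2⁻¹ * (g l j k - g k j l + g l k j + g j l k - g j k l - g k l j) * Complex.I_sq
  · intro h v
    have h' := trilin_comm_outer h
    rw [alternate12, h' (conjCoords (v 0)) (coords (v 1)), h' (conjCoords (v 0)) (coords (v 2)),
      h' (conjCoords (v 1)) (coords (v 0))]
    ring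

theorem wirt_eq_sum (u : ℂ × (ℂ × ℂ)) (F : ℂ × (ℂ × ℂ) → ℂ) (p : ℂ × (ℂ × ℂ)) :
    wirt u F p = ∑ l, coords u l * wirt (basisVec l) F p := by
  conv_lhs => rw [← sum_coordFn_smul u]
  rw [Fin.sum_univ_three, Fin.sum_univ_three, wirt_add_left, wirt_add_left, wirt_smul_left,
    wirt_smul_left, wirt_smul_left]
  rfl

theorem wirtBar_eq_sum (u : ℂ × (ℂ × ℂ)) (F : ℂ × (ℂ × ℂ) → ℂ) (p : ℂ × (ℂ × ℂ)) :
    wirtBar u F p = ∑ l, conjCoords u l * wirtBar (basisVec l) F p := by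
  conv_lhs => rw [← sum_coordFn_smul u]
  rw [Fin.sum_univ_three, Fin.sum_univ_three, wirtBar_add_left, wirtBar_add_left,
    wirtBar_smul_left, wirtBar_smul_left, wirtBar_smul_left]
  rfl

variable {a : Fin 3 → Fin 3 → ℂ × (ℂ × ℂ) → ℂ}

theorem contDiff_matrixForm (ha : ∀ j k, ContDiff ℝ ∞ (a j k)) :
    ContDiff ℝ ∞ fun p ↦ matrixForm fun j k ↦ a j k p :=
  ContDiff.sum fun j _ ↦ ContDiff.sum fun k _ ↦ (ha j k).smul contDiff_const

theorem fderiv_matrixForm_apply (ha : ∀ j k, ContDiff ℝ ∞ (a j k)) (w : Fin 2 → ℂ × (ℂ × ℂ))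
    (p u : ℂ × (ℂ × ℂ)) : fderiv ℝ (fun q ↦ matrixForm (fun j k ↦ a j k q) w) p u =
      trilin (fun l j k ↦ wirt (basisVec l) (a j k) p) (coords u) (coords (w 0))
          (conjCoords (w 1)) -
        trilin (fun l j k ↦ wirt (basisVec l) (a j k) p) (coords u) (coords (w 1))
          (conjCoords (w 0)) +
        (trilin (fun l j k ↦ wirtBar (basisVec l) (a j k) p) (conjCoords u) (coords (w 0))
          (conjCoords (w 1)) -
        trilin (fun l j k ↦ wirtBar (basisVec l) (a j k) p) (conjCoords u) (coords (w 1))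
          (conjCoords (w 0))) := by
  have hd : ∀ j k, DifferentiableAt ℝ (a j k) p := fun j k ↦
    (ha j k).differentiable (by simp) p
  have h1 : (fun q ↦ matrixForm (fun j k ↦ a j k q) w) = fun q ↦ ∑ j, ∑ k, a j k q *
      (coords (w 0) j * conjCoords (w 1) k - coords (w 1) j * conjCoords (w 0) k) := by
    funext q
    rw [matrixForm_apply]
    rfl
  rw [h1, fderiv_fun_sum (fun j _ ↦ DifferentiableAt.fun_sum fun k _ ↦
    (hd j k).mul_const _)]
  rw [sum_apply]
  have h2 : ∀ j, fderiv ℝ (fun q ↦ ∑ k, a j k q *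
      (coords (w 0) j * conjCoords (w 1) k - coords (w 1) j * conjCoords (w 0) k)) p u =
      ∑ k, (coords (w 0) j * conjCoords (w 1) k - coords (w 1) j * conjCoords (w 0) k) *
        dirDeriv u (a j k) p := by
    intro j
    rw [fderiv_fun_sum (fun k _ ↦ (hd j k).mul_const _),
      sum_apply]
    refine Finset.sum_congr rfl fun k _ ↦ ?_
    rw [fderiv_mul_const (hd j k)]
    rfl
  simp only [h2, ← wirt_add_wirtBar, wirt_eq_sum u, wirtBar_eq_sum u, trilin]
  simp only [mul_add, Finset.mul_sum, Finset.sum_add_distrib, ← Finset.sum_sub_distrib]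
  have h3 : ∀ f : Fin 3 → Fin 3 → Fin 3 → ℂ, ∑ j, ∑ k, ∑ l, f j k l = ∑ l, ∑ j, ∑ k, f j k l := by
    intro f
    rw [Finset.sum_comm' (s := Finset.univ) (t' := Finset.univ) (s' := fun _ ↦ Finset.univ)
      (f := fun l j ↦ ∑ k, f j k l) (by simp)]
    exact Finset.sum_congr rfl fun j _ ↦ Finset.sum_comm
  congr 1 <;>
  · refine (h3 _).trans ?_
    refine Finset.sum_congr rfl fun l _ ↦ Finset.sum_congr rfl fun j _ ↦
      Finset.sum_congr rfl fun k _ ↦ by ring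

theorem extDeriv_matrixForm (ha : ∀ j k, ContDiff ℝ ∞ (a j k)) (p : ℂ × (ℂ × ℂ))
    (v : Fin 3 → ℂ × (ℂ × ℂ)) : extDeriv (fun q ↦ matrixForm fun j k ↦ a j k q) p v =
      alternate21 (fun l j k ↦ wirt (basisVec l) (a j k) p) v +
        alternate12 (fun l j k ↦ wirtBar (basisVec l) (a j k) p) v := by
  rw [extDeriv_apply ((contDiff_matrixForm ha).differentiable (by simp) p), Fin.sum_univ_three]
  simp only [fderiv_matrixForm_apply ha, alternate21, alternate12]
  have e0 : (0 : Fin 3).removeNth v = ![v 1, v 2] := by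
    funext i; fin_cases i <;> rfl
  have e1 : (1 : Fin 3).removeNth v = ![v 0, v 2] := by
    funext i; fin_cases i <;> rfl
  have e2 : (2 : Fin 3).removeNth v = ![v 0, v 1] := by
    funext i; fin_cases i <;> rfl
  rw [e0, e1, e2]
  simp
  ring

/-- Under v ↦ cv the two parts of the exterior derivative scale by c²c̄ and cc̄², so they are its
components. With the criteria for `alternate21` and `alternate12`, closedness becomes a symmetry of
first derivatives. -/
theorem typeComponent_extDeriv_matrixForm (ha : ∀ j k, ContDiff ℝ ∞ (a j k)) (p : ℂ × (ℂ × ℂ))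
    (v : Fin 3 → ℂ × (ℂ × ℂ)) :
    typeComponent 2 1 (extDeriv (fun q ↦ matrixForm fun j k ↦ a j k q) p) v =
        alternate21 (fun l j k ↦ wirt (basisVec l) (a j k) p) v ∧
      typeComponent 1 2 (extDeriv (fun q ↦ matrixForm fun j k ↦ a j k q) p) v =
        alternate12 (fun l j k ↦ wirtBar (basisVec l) (a j k) p) v := by
  have h : ∀ c : ℂ, extDeriv (fun q ↦ matrixForm fun j k ↦ a j k q) p (fun i ↦ c • v i) =
      ∑ m ∈ Finset.range (2 + 1 + 1), c ^ m * conj c ^ (2 + 1 - m) *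
        (fun m ↦ if m = 2 then alternate21 (fun l j k ↦ wirt (basisVec l) (a j k) p) v else
          if m = 1 then alternate12 (fun l j k ↦ wirtBar (basisVec l) (a j k) p) v else 0) m := by
    intro c
    rw [extDeriv_matrixForm ha, alternate21_smul, alternate12_smul]
    simp [Finset.sum_range_succ]
    ring
  constructor
  · exact (typeComponent_apply_of_expansion (k := 2 + 1) (p := 2) rfl _ v _ h).trans (by simp)
  · exact (typeComponent_apply_of_expansion (k := 2 + 1) (p := 1) rfl _ v _ h).trans (by simp)

theorem wirt_wirtBar_eq_sum {F : ℂ × (ℂ × ℂ) → ℂ} (hF : ContDiff ℝ ∞ F) (u v p : ℂ × (ℂ × ℂ)) :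
    wirt u (wirtBar v F) p = ∑ j, ∑ k, wirt (basisVec j) (wirtBar (basisVec k) F) p *
      (coords u j * conjCoords v k) := by
  have h1 : wirtBar v F = conjCoords v 0 • wirtBar (basisVec 0) F +
      (conjCoords v 1 • wirtBar (basisVec 1) F + conjCoords v 2 • wirtBar (basisVec 2) F) := by
    funext q
    rw [wirtBar_eq_sum, Fin.sum_univ_three]
    simp only [Pi.add_apply, Pi.smul_apply, smul_eq_mul]
    ring
  have hk : ∀ k, ContDiff ℝ ∞ (conjCoords v k • wirtBar (basisVec k) F) := fun k ↦
    (contDiff_wirtBar hF _).const_smul (conjCoords v k)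
  have hk' : ContDiff ℝ ∞ (conjCoords v 1 • wirtBar (basisVec 1) F +
    conjCoords v 2 • wirtBar (basisVec 2) F) := (hk 1).add (hk 2)
  rw [wirt_eq_sum]
  refine Finset.sum_congr rfl fun j _ ↦ ?_
  rw [h1, wirt_add (hk 0) hk', wirt_add (hk 1) (hk 2),
    wirt_const_smul (contDiff_wirtBar hF _), wirt_const_smul (contDiff_wirtBar hF _),
    wirt_const_smul (contDiff_wirtBar hF _), Fin.sum_univ_three]
  simp only [Pi.add_apply, Pi.smul_apply, smul_eq_mul]
  ring

theorem contDiff_typeComponent {E : Type} [NormedAddCommGroup E] [NormedSpace ℂ E] {k : ℕ}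
    {b : E → CForm E k} (hb : ContDiff ℝ ∞ b) (p q : ℕ) :
    ContDiff ℝ ∞ fun x ↦ typeComponent p q (b x) := by
  unfold typeComponent
  refine ContDiff.const_smul _ (ContDiff.sum fun j _ ↦ ContDiff.const_smul _ ?_)
  exact (ContinuousAlternatingMap.compContinuousLinearMapCLM
    (F := ℂ) (ι := Fin k) (Complex.exp (2 * Real.pi * I * j / (2 * k + 1 : ℕ)) •
      ContinuousLinearMap.id ℝ E)).contDiff.comp hb

theorem contDiff_extDeriv {E : Type} [NormedAddCommGroup E] [NormedSpace ℂ E] {k : ℕ}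
    {b : E → CForm E k} (hb : ContDiff ℝ ∞ b) : ContDiff ℝ ∞ (extDeriv b) := by
  have h : extDeriv b = fun x ↦
      ContinuousAlternatingMap.alternatizeUncurryFinCLM ℝ E ℂ (n := k) (fderiv ℝ b x) := by
    funext x
    rfl
  rw [h]
  exact (ContinuousAlternatingMap.alternatizeUncurryFinCLM ℝ E ℂ).contDiff.comp
    (hb.fderiv_right (m := ∞) (by simp))

/-- The form `∂∂̄ f` in coordinates. -/
theorem typeComponent_ddbar {b : ℂ × (ℂ × ℂ) → CForm (ℂ × (ℂ × ℂ)) 0} (hb : ContDiff ℝ ∞ b)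
    (p : ℂ × (ℂ × ℂ)) :
    typeComponent 1 1 (extDeriv (fun q ↦ typeComponent 0 1 (extDeriv b q)) p) =
      matrixForm fun j k ↦ wirt (basisVec j) (wirtBar (basisVec k) fun q ↦ b q ![]) p := by
  set F : ℂ × (ℂ × ℂ) → ℂ := fun q ↦ b q ![] with hF
  have hFs : ContDiff ℝ ∞ F :=
    (ContinuousAlternatingMap.apply ℝ (ℂ × (ℂ × ℂ)) ℂ ![]).contDiff.comp hb
  have h1 : ∀ q (v : Fin 1 → ℂ × (ℂ × ℂ)), extDeriv b q v = dirDeriv (v 0) F q := by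
    intro q v
    rw [extDeriv_apply (hb.differentiable (by simp) q)]
    simp [dirDeriv, hF, Subsingleton.elim (Fin.removeNth 0 v) ![]]
  have h2 : ∀ q (v : Fin 1 → ℂ × (ℂ × ℂ)),
      typeComponent 0 1 (extDeriv b q) v = wirtBar (v 0) F q := by
    intro q v
    refine (typeComponent_apply_of_expansion (k := 0 + 1) (p := 0) (q := 1) rfl _ v
      (fun m ↦ if m = 0 then wirtBar (v 0) F q else wirt (v 0) F q) ?_).trans (by simp)
    · intro c
      rw [h1, dirDeriv_smul_complex]
      simp [Finset.sum_range_succ]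
      ring
  have hs : ContDiff ℝ ∞ fun q ↦ typeComponent 0 1 (extDeriv b q) :=
    contDiff_typeComponent (contDiff_extDeriv hb) 0 1
  have h3 : ∀ v : Fin 2 → ℂ × (ℂ × ℂ),
      extDeriv (fun q ↦ typeComponent 0 1 (extDeriv b q)) p v =
        dirDeriv (v 0) (wirtBar (v 1) F) p - dirDeriv (v 1) (wirtBar (v 0) F) p := by
    intro v
    rw [extDeriv_apply (hs.differentiable (by simp) p), Fin.sum_univ_two]
    simp only [h2]
    simp [dirDeriv, Fin.removeNth, sub_eq_add_neg]
  ext v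
  -- The derivative of a (0,1)-form has a part scaling by cc̄ and a part scaling by c̄²; the former
  -- is the component sought.
  refine (typeComponent_apply_of_expansion (k := 1 + 1) (p := 1) (q := 1) rfl _ v
      (fun m ↦ if m = 1 then
      wirt (v 0) (wirtBar (v 1) F) p - wirt (v 1) (wirtBar (v 0) F) p else
      if m = 0 then wirtBar (v 0) (wirtBar (v 1) F) p - wirtBar (v 1) (wirtBar (v 0) F) p
      else 0) ?_).trans ?_
  rotate_left
  · rw [matrixForm_apply, if_pos rfl, wirt_wirtBar_eq_sum hFs, wirt_wirtBar_eq_sum hFs]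
    simp only [mul_sub, Finset.sum_sub_distrib]
    rfl
  · intro c
    have h4 : ∀ u : ℂ × (ℂ × ℂ), wirtBar (c • u) F = conj c • wirtBar u F := by
      intro u
      funext q
      rw [wirtBar_smul_left]
      rfl
    rw [h3, h4, h4, dirDeriv_const_smul (contDiff_wirtBar hFs _),
      dirDeriv_const_smul (contDiff_wirtBar hFs _), Pi.smul_apply, Pi.smul_apply,
      dirDeriv_smul_complex, dirDeriv_smul_complex]
    simp [Finset.sum_range_succ]
    ring

end ExteriorDerivative

/-! ## The Bott-Chern number in terms of coefficients -/

section BottChern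

open Set

variable (L : NakamuraLattice) (t : ℂ)

/-- The coefficient arrays of the closed forms of type `(1, 1)` on the quotient of `ℂ³` by
`nakDecks L t`. -/
def bcSpace : Submodule ℂ (Fin 3 → Fin 3 → ℂ × (ℂ × ℂ) → ℂ) where
  carrier := {a | (∀ j k, ContDiff ℝ ∞ (a j k)) ∧
    (∀ c ∈ L.base, ∀ v ∈ L.fibre, ∀ p j k, deckFactor c j * conj (deckFactor c k) *
      a j k (nakLinear c p + (c - t * conj c, v)) = a j k p) ∧
    (∀ l j k, wirt (basisVec l) (a j k) = wirt (basisVec j) (a l k)) ∧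
    ∀ l j k, wirtBar (basisVec l) (a j k) = wirtBar (basisVec k) (a j l)}
  add_mem' := by
    rintro a b ⟨h1, h2, h3, h4⟩ ⟨g1, g2, g3, g4⟩
    refine ⟨fun j k ↦ (h1 j k).add (g1 j k), fun c hc v hv p j k ↦ ?_, fun l j k ↦ ?_,
      fun l j k ↦ ?_⟩
    · simp only [Pi.add_apply]
      rw [mul_add, h2 c hc v hv, g2 c hc v hv]
    · simp only [Pi.add_apply]
      rw [wirt_add (h1 _ _) (g1 _ _), wirt_add (h1 _ _) (g1 _ _), h3, g3]
    · simp only [Pi.add_apply]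
      rw [wirtBar_add (h1 _ _) (g1 _ _), wirtBar_add (h1 _ _) (g1 _ _), h4, g4]
  zero_mem' := by
    have h : ∀ u : ℂ × (ℂ × ℂ), dirDeriv u (0 : ℂ × (ℂ × ℂ) → ℂ) = 0 := by
      intro u; funext p; simp [dirDeriv]
    refine ⟨fun j k ↦ contDiff_const, by simp, fun l j k ↦ ?_, fun l j k ↦ ?_⟩
    · funext p; simp [wirt, h]
    · funext p; simp [wirtBar, h]
  smul_mem' := by
    rintro r a ⟨h1, h2, h3, h4⟩
    refine ⟨fun j k ↦ (h1 j k).const_smul r, fun c hc v hv p j k ↦ ?_, fun l j k ↦ ?_,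
      fun l j k ↦ ?_⟩
    · simp only [Pi.smul_apply, smul_eq_mul]
      rw [← h2 c hc v hv p j k]; ring
    · simp only [Pi.smul_apply]
      rw [wirt_const_smul (h1 _ _), wirt_const_smul (h1 _ _), h3]
    · simp only [Pi.smul_apply]
      rw [wirtBar_const_smul (h1 _ _), wirtBar_const_smul (h1 _ _), h4]

/-- Smooth functions on `ℂ³` that descend to the quotient by `nakDecks L t`. -/
def IsDeckInvariant (F : ℂ × (ℂ × ℂ) → ℂ) : Prop :=
  ContDiff ℝ ∞ F ∧
    ∀ c ∈ L.base, ∀ v ∈ L.fibre, ∀ p, F (nakLinear c p + (c - t * conj c, v)) = F p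

variable {L t} {M : Type} [TopologicalSpace M] [ChartedSpace (ℂ × (ℂ × ℂ)) M]
  {π : ℂ × (ℂ × ℂ) → M}

theorem IsAffineCovering.isOfType_pullbackForm {D} (h : IsAffineCovering univ D π)
    {α : M → CForm (ℂ × (ℂ × ℂ)) 2} (hα : ∀ x, IsOfType 1 1 (α x)) (p : ℂ × (ℂ × ℂ)) :
    IsOfType 1 1 (pullbackForm (E := ℂ × (ℂ × ℂ)) π α p) := by
  obtain ⟨A, hA⟩ := h.exists_mfderiv_eq p
  intro c v
  rw [pullbackForm, hA, ContinuousAlternatingMap.compContinuousLinearMap_apply,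
    ContinuousAlternatingMap.compContinuousLinearMap_apply, ← hα]
  congr 1
  funext i
  simp

theorem IsAffineCovering.descend_eq_zero_iff {E : Type} [NormedAddCommGroup E] [NormedSpace ℂ E]
    {M : Type} [TopologicalSpace M] [ChartedSpace E M] {D : Set ((E →L[ℂ] E) × E)} {π : E → M}
    (h : IsAffineCovering univ D π) {k : ℕ} {b : E → CForm E k} (hb : IsInvariantForm D b) :
    (∀ x : M, descend b x = 0) ↔ ∀ p, b p = 0 := by
  refine ⟨fun h0 p ↦ ?_, fun h0 x ↦ h0 _⟩
  rw [← h.pullbackForm_descend hb]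
  have h1 : (descend b : M → CForm E k) = fun _ ↦ 0 := funext h0
  rw [h1]
  ext v
  rfl

theorem isInvariantForm_matrixForm {a : Fin 3 → Fin 3 → ℂ × (ℂ × ℂ) → ℂ} :
    (IsInvariantForm (nakDecks L t) fun p ↦ matrixForm fun j k ↦ a j k p) ↔
      ∀ c ∈ L.base, ∀ v ∈ L.fibre, ∀ p j k, deckFactor c j * conj (deckFactor c k) *
        a j k (nakLinear c p + (c - t * conj c, v)) = a j k p := by
  constructor
  · intro h c hc v hv p j k
    have h1 := h _ ⟨c, hc, v, hv, rfl⟩ p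
    simp only [nakDeck, linPullback_matrixForm] at h1
    have h2 := congrArg formCoeff h1
    rw [formCoeff_matrixForm, formCoeff_matrixForm] at h2
    exact congrFun (congrFun h2 j) k
  · rintro h _ ⟨c, hc, v, hv, rfl⟩ p
    simp only [nakDeck, linPullback_matrixForm]
    congr 1
    funext j k
    exact h c hc v hv p j k

theorem closed_matrixForm_iff (h : IsAffineCovering univ (nakDecks L t) π)
    {α : M → CForm (ℂ × (ℂ × ℂ)) 2} {a : Fin 3 → Fin 3 → ℂ × (ℂ × ℂ) → ℂ}
    (ha : ∀ j k, ContDiff ℝ ∞ (a j k))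
    (hα : (pullbackForm (E := ℂ × (ℂ × ℂ)) π α : ℂ × (ℂ × ℂ) → CForm (ℂ × (ℂ × ℂ)) 2) =
      fun p ↦ matrixForm fun j k ↦ a j k p) :
    ((∀ x, delForm 1 1 α x = 0) ∧ ∀ x, delbarForm 1 1 α x = 0) ↔
    (∀ l j k, wirt (basisVec l) (a j k) = wirt (basisVec j) (a l k)) ∧
    ∀ l j k, wirtBar (basisVec l) (a j k) = wirtBar (basisVec k) (a j l) := by
  have hinv : IsInvariantForm (nakDecks L t) (extDeriv (pullbackForm (E := ℂ × (ℂ × ℂ)) π α)) :=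
    IsAffineCovering.isInvariantForm_extDeriv (h.isInvariantForm_pullbackForm α)
      (by rw [hα]; exact contDiff_matrixForm ha)
  rw [h.delForm_eq, h.delbarForm_eq, h.descend_eq_zero_iff (hinv.typeComponent _ _),
    h.descend_eq_zero_iff (hinv.typeComponent _ _), hα]
  refine and_congr ?_ ?_
  · have h1 : ∀ p, typeComponent 2 1 (extDeriv (fun q ↦ matrixForm fun j k ↦ a j k q) p) = 0 ↔
        ∀ l j k, wirt (basisVec l) (a j k) p = wirt (basisVec j) (a l k) p := by
      intro p
      rw [← alternate21_eq_zero_iff (fun l j k ↦ wirt (basisVec l) (a j k) p)]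
      constructor
      · intro h2 v
        rw [← (typeComponent_extDeriv_matrixForm ha p v).1, h2]
        rfl
      · intro h2
        ext v
        exact (typeComponent_extDeriv_matrixForm ha p v).1.trans (h2 v)
    refine (forall_congr' h1).trans ⟨fun h2 l j k ↦ funext fun p ↦ h2 p l j k,
      fun h2 p l j k ↦ congrFun (h2 l j k) p⟩
  · have h1 : ∀ p, typeComponent 1 2 (extDeriv (fun q ↦ matrixForm fun j k ↦ a j k q) p) = 0 ↔
        ∀ l j k, wirtBar (basisVec l) (a j k) p = wirtBar (basisVec k) (a j l) p := by
      intro p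
      rw [← alternate12_eq_zero_iff (fun l j k ↦ wirtBar (basisVec l) (a j k) p)]
      constructor
      · intro h2 v
        rw [← (typeComponent_extDeriv_matrixForm ha p v).2, h2]
        rfl
      · intro h2
        ext v
        exact (typeComponent_extDeriv_matrixForm ha p v).2.trans (h2 v)
    refine (forall_congr' h1).trans ⟨fun h2 l j k ↦ funext fun p ↦ h2 p l j k,
      fun h2 p l j k ↦ congrFun (h2 l j k) p⟩

theorem pullbackForm_eq_matrixForm (h : IsAffineCovering univ (nakDecks L t) π)
    {α : M → CForm (ℂ × (ℂ × ℂ)) 2} (hα : ∀ x, IsOfType 1 1 (α x)) :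
    (pullbackForm (E := ℂ × (ℂ × ℂ)) π α : ℂ × (ℂ × ℂ) → CForm (ℂ × (ℂ × ℂ)) 2) =
      fun p ↦ matrixForm fun j k ↦ formCoeff (pullbackForm (E := ℂ × (ℂ × ℂ)) π α p) j k :=
  funext fun p ↦ (matrixForm_formCoeff (h.isOfType_pullbackForm hα p)).symm

theorem formCoeff_mem_bcSpace (h : IsAffineCovering univ (nakDecks L t) π)
    {α : M → CForm (ℂ × (ℂ × ℂ)) 2} (hα : α ∈ closedForms11 (ℂ × (ℂ × ℂ)) M) :
    (fun j k p ↦ formCoeff (pullbackForm (E := ℂ × (ℂ × ℂ)) π α p) j k) ∈ bcSpace L t := by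
  obtain ⟨h1, h2, h3, h4⟩ := hα
  have hb := (h.isSmoothForm_iff α).1 h1
  have hv : ∀ v : Fin 2 → ℂ × (ℂ × ℂ), ContDiff ℝ ∞ fun p ↦ pullbackForm (E := ℂ × (ℂ × ℂ)) π α p v := fun v ↦
    (ContinuousAlternatingMap.apply ℝ (ℂ × (ℂ × ℂ)) ℂ v).contDiff.comp hb
  have hs : ∀ j k, ContDiff ℝ ∞ fun p ↦ formCoeff (pullbackForm (E := ℂ × (ℂ × ℂ)) π α p) j k := fun j k ↦
    contDiff_const.mul ((hv _).add (contDiff_const.mul (hv _)))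
  have heq := pullbackForm_eq_matrixForm h h2
  obtain ⟨h5, h6⟩ := (closed_matrixForm_iff h hs heq).1 ⟨h3, h4⟩
  refine ⟨hs, isInvariantForm_matrixForm
    (a := fun j k p ↦ formCoeff (pullbackForm (E := ℂ × (ℂ × ℂ)) π α p) j k).1 ?_, h5, h6⟩
  rw [← heq]
  exact h.isInvariantForm_pullbackForm α

theorem descend_mem_closedForms11 (h : IsAffineCovering univ (nakDecks L t) π)
    {a : Fin 3 → Fin 3 → ℂ × (ℂ × ℂ) → ℂ} (ha : a ∈ bcSpace L t) :
    (descend fun p ↦ matrixForm fun j k ↦ a j k p) ∈ closedForms11 (ℂ × (ℂ × ℂ)) M := by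
  obtain ⟨h1, h2, h3, h4⟩ := ha
  have heq := h.pullbackForm_descend (isInvariantForm_matrixForm.2 h2)
  obtain ⟨h5, h6⟩ := (closed_matrixForm_iff h h1 heq).2 ⟨h3, h4⟩
  refine ⟨?_, fun x ↦ isOfType_matrixForm _, h5, h6⟩
  rw [h.isSmoothForm_iff, heq]
  exact contDiff_matrixForm h1

/-- The coefficients of closed forms of type `(1, 1)`. -/
def coeffMap (h : IsAffineCovering univ (nakDecks L t) π) :
    closedForms11 (ℂ × (ℂ × ℂ)) M →ₗ[ℂ] bcSpace L t where
  toFun α := ⟨_, formCoeff_mem_bcSpace h α.2⟩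
  map_add' α β := by
    ext j k p
    have hv : ∀ v : Fin 2 → ℂ × (ℂ × ℂ), pullbackForm (E := ℂ × (ℂ × ℂ)) π (α + β).1 p v =
      pullbackForm (E := ℂ × (ℂ × ℂ)) π α.1 p v + pullbackForm (E := ℂ × (ℂ × ℂ)) π β.1 p v :=
      fun v ↦ rfl
    simp only [Submodule.coe_add, Pi.add_apply, formCoeff] at hv ⊢
    rw [hv, hv]
    ring
  map_smul' c α := by
    ext j k p
    have hv : ∀ v : Fin 2 → ℂ × (ℂ × ℂ), pullbackForm (E := ℂ × (ℂ × ℂ)) π (c • α).1 p v =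
      c * pullbackForm (E := ℂ × (ℂ × ℂ)) π α.1 p v := fun v ↦ rfl
    simp only [Submodule.coe_smul, Pi.smul_apply, formCoeff, smul_eq_mul, RingHom.id_apply] at hv ⊢
    rw [hv, hv]
    ring

theorem coeffMap_surjective (h : IsAffineCovering univ (nakDecks L t) π) :
    Function.Surjective (coeffMap h) := by
  rintro ⟨a, ha⟩
  refine ⟨⟨_, descend_mem_closedForms11 h ha⟩, Subtype.ext ?_⟩
  change (fun j k p ↦ formCoeff (pullbackForm (E := ℂ × (ℂ × ℂ)) π (descend fun p ↦ matrixForm fun j k ↦ a j k p) p)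
    j k) = a
  rw [h.pullbackForm_descend (isInvariantForm_matrixForm.2 ha.2.1)]
  funext j k p
  rw [formCoeff_matrixForm]

theorem descend_coeffMap (h : IsAffineCovering univ (nakDecks L t) π)
    (α : closedForms11 (ℂ × (ℂ × ℂ)) M) :
    (descend fun p ↦ matrixForm fun j k ↦ (coeffMap h α).1 j k p) = α.1 := by
  refine Eq.trans ?_ (h.descend_pullbackForm α.1)
  rw [pullbackForm_eq_matrixForm h α.2.2.1]
  rfl

theorem ddbar_eq_descend (h : IsAffineCovering univ (nakDecks L t) π)
    {f : M → CForm (ℂ × (ℂ × ℂ)) 0} (hf : IsSmoothForm f) :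
    delForm 0 1 (delbarForm 0 0 f) = descend fun p ↦ matrixForm fun j k ↦
      wirt (basisVec j) (wirtBar (basisVec k) fun q ↦ pullbackForm (E := ℂ × (ℂ × ℂ)) π f q ![]) p := by
  have hb := (h.isSmoothForm_iff f).1 hf
  have hinv := IsAffineCovering.isInvariantForm_extDeriv (h.isInvariantForm_pullbackForm f) hb
  rw [h.delForm_eq, h.delbarForm_eq, h.pullbackForm_descend (hinv.typeComponent _ _)]
  congr 1
  funext p
  exact typeComponent_ddbar hb p

theorem isDeckInvariant_pullback (h : IsAffineCovering univ (nakDecks L t) π)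
    {f : M → CForm (ℂ × (ℂ × ℂ)) 0} (hf : IsSmoothForm f) :
    IsDeckInvariant L t fun q ↦ pullbackForm (E := ℂ × (ℂ × ℂ)) π f q ![] := by
  refine ⟨(ContinuousAlternatingMap.apply ℝ (ℂ × (ℂ × ℂ)) ℂ ![]).contDiff.comp
    ((h.isSmoothForm_iff f).1 hf), fun c hc v hv p ↦ ?_⟩
  have h1 := congrArg (fun η : CForm (ℂ × (ℂ × ℂ)) 0 ↦ η ![])
    (h.isInvariantForm_pullbackForm f _ ⟨c, hc, v, hv, rfl⟩ p)
  refine Eq.trans ?_ h1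
  exact congrArg _ (Subsingleton.elim _ _)

theorem exists_form_of_isDeckInvariant (h : IsAffineCovering univ (nakDecks L t) π)
    {F : ℂ × (ℂ × ℂ) → ℂ} (hF : IsDeckInvariant L t F) :
    ∃ f : M → CForm (ℂ × (ℂ × ℂ)) 0, IsSmoothForm f ∧ ∀ q, pullbackForm (E := ℂ × (ℂ × ℂ)) π f q ![] = F q := by
  have hinv : IsInvariantForm (nakDecks L t) fun p ↦
      (ContinuousAlternatingMap.constOfIsEmpty ℝ (ℂ × (ℂ × ℂ)) (Fin 0) (F p) :
        CForm (ℂ × (ℂ × ℂ)) 0) := by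
    rintro _ ⟨c, hc, v, hv, rfl⟩ p
    ext w
    exact hF.2 c hc v hv p
  refine ⟨descend fun p ↦ ContinuousAlternatingMap.constOfIsEmpty ℝ (ℂ × (ℂ × ℂ)) (Fin 0) (F p),
    ?_, fun q ↦ ?_⟩
  · rw [h.isSmoothForm_iff, h.pullbackForm_descend hinv]
    exact (ContinuousAlternatingMap.constOfIsEmptyLIE ℝ (ℂ × (ℂ × ℂ)) ℂ
      (Fin 0)).toContinuousLinearEquiv.contDiff.comp hF.1
  · rw [h.pullbackForm_descend hinv]
    rfl

theorem invariant_ddbar (h : IsAffineCovering univ (nakDecks L t) π)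
    {F : ℂ × (ℂ × ℂ) → ℂ} (hF : IsDeckInvariant L t F) :
    (fun j k ↦ wirt (basisVec j) (wirtBar (basisVec k) F)) ∈ bcSpace L t := by
  obtain ⟨f, hf, hfF⟩ := exists_form_of_isDeckInvariant h hF
  have hF' : F = fun q ↦ pullbackForm (E := ℂ × (ℂ × ℂ)) π f q ![] := funext fun q ↦ (hfF q).symm
  refine ⟨fun j k ↦ contDiff_wirt (contDiff_wirtBar hF.1 _) _, ?_, fun l j k ↦ ?_,
    fun l j k ↦ ?_⟩
  · refine isInvariantForm_matrixForm.1 ?_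
    have hb := (h.isSmoothForm_iff f).1 hf
    have hinv := IsAffineCovering.isInvariantForm_extDeriv (h.isInvariantForm_pullbackForm f) hb
    have hinv2 := IsAffineCovering.isInvariantForm_extDeriv (hinv.typeComponent 0 1)
      (contDiff_typeComponent (contDiff_extDeriv hb) 0 1)
    have hinv3 := hinv2.typeComponent 1 1
    rw [hF']
    convert hinv3 using 2 with p
    exact (typeComponent_ddbar hb p).symm
  · exact wirt_comm (contDiff_wirtBar hF.1 _) _ _
  · simp only
    rw [wirt_wirtBar_comm hF.1, wirt_wirtBar_comm hF.1,
      wirtBar_comm (contDiff_wirt hF.1 _)]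

/-- Since every array in `bcSpace` comes from a closed form, any linear map that vanishes exactly on
the arrays ∂∂̄F computes the number as its rank. It will be applied to lists of averages. -/
theorem bottChernNumber11_eq (h : IsAffineCovering univ (nakDecks L t) π) {W : Type}
    [AddCommGroup W] [Module ℂ W] (Φ : bcSpace L t →ₗ[ℂ] W)
    (hΦ : ∀ a, Φ a = 0 ↔ ∃ F, IsDeckInvariant L t F ∧
      ∀ j k, a.1 j k = wirt (basisVec j) (wirtBar (basisVec k) F)) :
    bottChernNumber11 (ℂ × (ℂ × ℂ)) M = Module.finrank ℂ (LinearMap.range Φ) := by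
  have hker : (ddbarExactForms11 (ℂ × (ℂ × ℂ)) M).submoduleOf (closedForms11 (ℂ × (ℂ × ℂ)) M) =
      LinearMap.ker (Φ ∘ₗ coeffMap h) := by
    apply le_antisymm
    · have hle : ddbarExactForms11 (ℂ × (ℂ × ℂ)) M ≤
          (LinearMap.ker (Φ ∘ₗ coeffMap h)).map (closedForms11 (ℂ × (ℂ × ℂ)) M).subtype := by
        refine Submodule.span_le.2 ?_
        rintro α ⟨f, hf, rfl⟩
        have hF := isDeckInvariant_pullback h hf
        have hmem := invariant_ddbar h hF
        have heq := ddbar_eq_descend h hf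
        have hcl := descend_mem_closedForms11 h hmem
        rw [← heq] at hcl
        refine ⟨⟨_, hcl⟩, ?_, rfl⟩
        rw [SetLike.mem_coe, LinearMap.mem_ker, LinearMap.comp_apply, hΦ]
        refine ⟨_, hF, fun j k ↦ ?_⟩
        funext p
        change formCoeff (pullbackForm (E := ℂ × (ℂ × ℂ)) π (delForm 0 1 (delbarForm 0 0 f)) p) j k = _
        rw [heq, h.pullbackForm_descend (isInvariantForm_matrixForm.2 hmem.2.1),
          formCoeff_matrixForm]
      intro α hα
      obtain ⟨β, hβ, hβα⟩ := hle hα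
      rwa [← Subtype.ext hβα]
    · intro α hα
      rw [LinearMap.mem_ker, LinearMap.comp_apply, hΦ] at hα
      obtain ⟨F, hF, hFα⟩ := hα
      obtain ⟨f, hf, hfF⟩ := exists_form_of_isDeckInvariant h hF
      refine Submodule.subset_span ⟨f, hf, ?_⟩
      rw [ddbar_eq_descend h hf]
      refine (descend_coeffMap h α).symm.trans ?_
      simp only [hfF, hFα]
  rw [bottChernNumber11, hker, (LinearMap.quotKerEquivRange (Φ ∘ₗ coeffMap h)).finrank_eq,
    LinearMap.range_comp, LinearMap.range_eq_top.2 (coeffMap_surjective h), Submodule.map_top]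

end BottChern

/-! ## Averages along the fibre tori -/

section Averages

open MeasureTheory Set

section General

variable {ι ι' : Type} [Fintype ι] [Fintype ι'] {E : Type} [NormedAddCommGroup E]
  [NormedSpace ℂ E] [FiniteDimensional ℝ E]

theorem torusAvg_comm (B : (ι → ℝ) →L[ℝ] E) (B' : (ι' → ℝ) →L[ℝ] E) {F : E → ℂ}
    (hF : Continuous F) : torusAvg B (torusAvg B' F) = torusAvg B' (torusAvg B F) := by
  funext p
  have hc : Continuous fun z : (ι → ℝ) × (ι' → ℝ) ↦ F (p + B z.1 + B' z.2) := by fun_prop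
  have hint : Integrable (Function.uncurry fun x y ↦ F (p + B x + B' y))
      ((cubeMeasure ι).prod (cubeMeasure ι')) := by
    obtain ⟨C, hC⟩ := ((isCompact_closedBall (0 : ι → ℝ) 1).prod
      (isCompact_closedBall (0 : ι' → ℝ) 1)).exists_bound_of_continuousOn hc.continuousOn
    refine Integrable.of_bound hc.aestronglyMeasurable C ?_
    filter_upwards [Measure.quasiMeasurePreserving_fst.ae ae_cubeMeasure_norm_le,
      Measure.quasiMeasurePreserving_snd.ae ae_cubeMeasure_norm_le] with z hz hz'
    exact hC z ⟨by simpa using hz, by simpa using hz'⟩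
  have h := integral_integral_swap hint
  simp only [torusAvg]
  rw [h]
  simp only [add_right_comm]

theorem torusAvg_wirt (B : (ι → ℝ) →L[ℝ] E) {F : E → ℂ} (hF : ContDiff ℝ ∞ F) (u : E) :
    torusAvg B (wirt u F) = wirt u (torusAvg B F) := by
  have hc : Continuous ((-I) • dirDeriv (I • u) F) := ((hF.dirDeriv _).const_smul (-I)).continuous
  rw [wirt_eq, wirt_eq, torusAvg_smul, torusAvg_add B (hF.dirDeriv u).continuous hc, torusAvg_smul, dirDeriv_torusAvg B hF,
    dirDeriv_torusAvg B hF]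

theorem torusAvg_wirtBar (B : (ι → ℝ) →L[ℝ] E) {F : E → ℂ} (hF : ContDiff ℝ ∞ F) (u : E) :
    torusAvg B (wirtBar u F) = wirtBar u (torusAvg B F) := by
  have hc : Continuous (I • dirDeriv (I • u) F) := ((hF.dirDeriv _).const_smul I).continuous
  rw [wirtBar_eq, wirtBar_eq, torusAvg_smul, torusAvg_add B (hF.dirDeriv u).continuous hc, torusAvg_smul, dirDeriv_torusAvg B hF,
    dirDeriv_torusAvg B hF]

theorem dirDeriv_eq_zero_of_translate {F : E → ℂ} {u : E} (h : ∀ (p : E) (s : ℝ), F (p + s • u) = F p)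
    (p : E) : dirDeriv u F p = 0 := by
  by_cases hd : DifferentiableAt ℝ F p
  · have h1 : HasDerivAt (fun s : ℝ ↦ F (p + s • u)) (fderiv ℝ F p u) 0 := by
      have h2 : HasDerivAt (fun s : ℝ ↦ p + s • u) u 0 := by
        simpa using ((hasDerivAt_id (0 : ℝ)).smul_const u).const_add p
      have h3 : HasFDerivAt F (fderiv ℝ F p) (p + (0 : ℝ) • u) := by
        simpa using hd.hasFDerivAt
      exact h3.comp_hasDerivAt 0 h2
    simp only [h] at h1
    exact h1.unique (hasDerivAt_const _ _)
  · rw [dirDeriv, fderiv_zero_of_not_differentiableAt hd]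
    rfl

/-- A function is translation invariant along a complex line, in both Wirtinger derivatives. -/
theorem wirt_eq_zero_of_translate {F : E → ℂ} {u : E} (h : ∀ (p : E) (c : ℂ), F (p + c • u) = F p) :
    wirt u F = 0 ∧ wirtBar u F = 0 := by
  have h1 : ∀ p, dirDeriv u F p = 0 := dirDeriv_eq_zero_of_translate fun p s ↦ by
    rw [← h p s, Complex.coe_smul]
  have h2 : ∀ p, dirDeriv (I • u) F p = 0 := dirDeriv_eq_zero_of_translate fun p s ↦ by
    rw [← h p (s * I), mul_smul, Complex.coe_smul]
  constructor <;> funext p <;> simp [wirt, wirtBar, h1, h2]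

/-- On the complex line through `u`, the operator 4∂∂̄ is the real Laplacian. This links Wirtinger
derivatives with `torusLaplacian`. -/
theorem four_wirt_wirtBar {F : E → ℂ} (hF : ContDiff ℝ ∞ F) (u p : E) :
    4 * wirt u (wirtBar u F) p =
      dirDeriv u (dirDeriv u F) p + dirDeriv (I • u) (dirDeriv (I • u) F) p := by
  have hd := hF.dirDeriv u
  have hd' := hF.dirDeriv (I • u)
  have h1 : ∀ v, dirDeriv v (wirtBar u F) p =
      2⁻¹ * (dirDeriv v (dirDeriv u F) p + I * dirDeriv v (dirDeriv (I • u) F) p) := by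
    intro v
    have hI : ContDiff ℝ ∞ (I • dirDeriv (I • u) F) := hd'.const_smul I
    have hs : ContDiff ℝ ∞ (dirDeriv u F + I • dirDeriv (I • u) F) := hd.add hI
    rw [wirtBar_eq, dirDeriv_const_smul hs, dirDeriv_add hd hI, dirDeriv_const_smul hd']
    rfl
  rw [wirt, h1, h1, dirDeriv_comm hF (I • u) u]
  linear_combination (-dirDeriv (I • u) (dirDeriv (I • u) F) p) * Complex.I_sq

end General

variable (L : NakamuraLattice)

/-- Real coordinates of `ℂ²` in which the fibre lattice is `ℤ⁴`. -/
def NakamuraLattice.fibreEquiv : (Fin 4 → ℝ) ≃L[ℝ] ℂ × ℂ := L.exists_fibreEquiv.choose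

theorem NakamuraLattice.mem_fibre_iff (v : ℂ × ℂ) :
    v ∈ L.fibre ↔ ∃ n : Fin 4 → ℤ, v = L.fibreEquiv fun i ↦ (n i : ℝ) :=
  L.exists_fibreEquiv.choose_spec v

/-- The parametrization of the fibres of `X_t → ℂ` by `ℝ⁴`. -/
def NakamuraLattice.fibreMap : (Fin 4 → ℝ) →L[ℝ] ℂ × (ℂ × ℂ) :=
  (ContinuousLinearMap.inr ℝ ℂ (ℂ × ℂ)) ∘L (L.fibreEquiv : (Fin 4 → ℝ) →L[ℝ] ℂ × ℂ)

theorem NakamuraLattice.fibreMap_apply (x : Fin 4 → ℝ) : L.fibreMap x = (0, L.fibreEquiv x) := rfl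

/-- A function on `ℂ³` that only depends on the first coordinate. -/
def IsFibreConstant (F : ℂ × (ℂ × ℂ) → ℂ) : Prop :=
  ∀ p (w : ℂ × ℂ), F (p + (0, w)) = F p

theorem IsFibreConstant.eq {F : ℂ × (ℂ × ℂ) → ℂ} (h : IsFibreConstant F) (p : ℂ × (ℂ × ℂ)) :
    F p = F (p.1, 0) := by
  rw [← h (p.1, 0) p.2]
  congr 1
  ext <;> simp

/-- The average of a function along the fibre tori. -/
def fibreAvg (F : ℂ × (ℂ × ℂ) → ℂ) : ℂ × (ℂ × ℂ) → ℂ := torusAvg L.fibreMap F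

variable {L}

theorem isPeriodic_fibreMap_iff {F : ℂ × (ℂ × ℂ) → ℂ} :
    IsPeriodic L.fibreMap F ↔ ∀ v ∈ L.fibre, ∀ p, F (p + (0, v)) = F p := by
  constructor
  · intro h v hv p
    obtain ⟨n, rfl⟩ := (L.mem_fibre_iff v).1 hv
    exact h p n
  · intro h p n
    exact h _ ((L.mem_fibre_iff _).2 ⟨n, rfl⟩) p

theorem isFibreConstant_fibreAvg {F : ℂ × (ℂ × ℂ) → ℂ} (hc : Continuous F)
    (hF : IsPeriodic L.fibreMap F) : IsFibreConstant (fibreAvg L F) := by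
  intro p w
  have := torusAvg_translate hc hF p (L.fibreEquiv.symm w)
  rwa [L.fibreMap_apply, L.fibreEquiv.apply_symm_apply] at this

theorem IsFibreConstant.fibreAvg {F : ℂ × (ℂ × ℂ) → ℂ} (h : IsFibreConstant F) :
    fibreAvg L F = F :=
  torusAvg_of_translate fun p _ ↦ h p _

theorem IsFibreConstant.wirt {F : ℂ × (ℂ × ℂ) → ℂ} (h : IsFibreConstant F) {j : Fin 3}
    (hj : j ≠ 0) : wirt (basisVec j) F = 0 ∧ wirtBar (basisVec j) F = 0 := by
  refine wirt_eq_zero_of_translate fun p c ↦ ?_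
  have h1 : c • basisVec j = (0, (c • basisVec j).2) := by
    fin_cases j
    · exact absurd rfl hj
    · simp [basisVec]
    · simp [basisVec]
  rw [h1]
  exact h _ _

section Decks

variable {t c : ℂ} {v : ℂ × ℂ} {F : ℂ × (ℂ × ℂ) → ℂ}

theorem dirDeriv_comp_deck (hF : ContDiff ℝ ∞ F) (u p : ℂ × (ℂ × ℂ)) :
    dirDeriv u (fun q ↦ F (nakLinear c q + (c - t * conj c, v))) p =
      dirDeriv (nakLinear c u) F (nakLinear c p + (c - t * conj c, v)) := by
  have h1 : HasFDerivAt (fun q ↦ nakLinear c q + (c - t * conj c, v))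
      ((nakLinear c).restrictScalars ℝ) p :=
    ((nakLinear c).restrictScalars ℝ).hasFDerivAt.add_const _
  have h2 := (hF.differentiable (by simp) (nakLinear c p + (c - t * conj c, v))).hasFDerivAt
  have h3 := h2.comp p h1
  have h4 := h3.fderiv
  unfold dirDeriv
  exact congrArg (fun T : ℂ × (ℂ × ℂ) →L[ℝ] ℂ ↦ T u) h4

theorem nakLinear_basisVec (j : Fin 3) :
    nakLinear c (basisVec j) = deckFactor c j • basisVec j := by
  rw [nakLinear_apply]
  fin_cases j <;> simp [basisVec, deckFactor, nakPhi]

theorem wirt_comp_deck (hF : ContDiff ℝ ∞ F) (j : Fin 3) (p : ℂ × (ℂ × ℂ)) :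
    wirt (basisVec j) (fun q ↦ F (nakLinear c q + (c - t * conj c, v))) p =
      deckFactor c j * wirt (basisVec j) F (nakLinear c p + (c - t * conj c, v)) := by
  rw [← wirt_smul_left, ← nakLinear_basisVec]
  simp only [wirt, dirDeriv_comp_deck hF, map_smul]

theorem wirtBar_comp_deck (hF : ContDiff ℝ ∞ F) (j : Fin 3) (p : ℂ × (ℂ × ℂ)) :
    wirtBar (basisVec j) (fun q ↦ F (nakLinear c q + (c - t * conj c, v))) p =
      conj (deckFactor c j) * wirtBar (basisVec j) F (nakLinear c p + (c - t * conj c, v)) := by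
  rw [← wirtBar_smul_left, ← nakLinear_basisVec]
  simp only [wirtBar, dirDeriv_comp_deck hF, map_smul]

theorem contDiff_comp_deck (hF : ContDiff ℝ ∞ F) :
    ContDiff ℝ ∞ fun q ↦ F (nakLinear c q + (c - t * conj c, v)) :=
  hF.comp (IsAffineCovering.contDiff_real (nakLinear c, (c - t * conj c, v)) _)

theorem ddbar_comp_deck (hF : ContDiff ℝ ∞ F) (j k : Fin 3) (p : ℂ × (ℂ × ℂ)) :
    wirt (basisVec j) (wirtBar (basisVec k)
      fun q ↦ F (nakLinear c q + (c - t * conj c, v))) p =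
      deckFactor c j * conj (deckFactor c k) *
        wirt (basisVec j) (wirtBar (basisVec k) F) (nakLinear c p + (c - t * conj c, v)) := by
  have h1 : (wirtBar (basisVec k) fun q ↦ F (nakLinear c q + (c - t * conj c, v))) =
      conj (deckFactor c k) •
        fun q ↦ wirtBar (basisVec k) F (nakLinear c q + (c - t * conj c, v)) :=
    funext fun q ↦ wirtBar_comp_deck hF k q
  rw [h1, wirt_const_smul (contDiff_comp_deck (contDiff_wirtBar hF _)), Pi.smul_apply,
    wirt_comp_deck (contDiff_wirtBar hF _), smul_eq_mul]
  ring

theorem nakLinear_inr (w : ℂ × ℂ) : nakLinear c (0, w) = (0, nakPhi c w) := nakLinear_apply _ _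

theorem isPeriodic_comp_deck (hF : IsPeriodic L.fibreMap F) (hc : c ∈ L.base) :
    IsPeriodic L.fibreMap fun q ↦ F (nakLinear c q + (c - t * conj c, v)) := by
  rw [isPeriodic_fibreMap_iff] at hF ⊢
  intro w hw p
  rw [map_add, nakLinear_inr, add_right_comm]
  exact hF _ (L.nakPhi_mem hc hw) _

/-- The fibre average commutes with the deck transformations. -/
theorem fibreAvg_comp_deck (hs : Continuous F) (hF : IsPeriodic L.fibreMap F) (hc : c ∈ L.base) :
    fibreAvg L (fun q ↦ F (nakLinear c q + (c - t * conj c, v))) =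
      fun p ↦ fibreAvg L F (nakLinear c p + (c - t * conj c, v)) := by
  -- The image of the fibre parametrization under the linear part. Its average agrees with the fibre
  -- average: each of the two averages is invariant under all fibre translations, so it is fixed by
  -- the other averaging operator, and the operators commute.
  let B' : (Fin 4 → ℝ) →L[ℝ] ℂ × (ℂ × ℂ) := ((nakLinear c).restrictScalars ℝ) ∘L L.fibreMap
  have hB' : ∀ x, B' x = (0, nakPhi c (L.fibreEquiv x)) := fun x ↦ nakLinear_inr _
  have hper : IsPeriodic B' F := by
    intro p n
    rw [hB']
    exact isPeriodic_fibreMap_iff.1 hF _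
      (L.nakPhi_mem hc ((L.mem_fibre_iff _).2 ⟨n, rfl⟩)) p
  have h1 : torusAvg B' F = fibreAvg L F := by
    have h2 : torusAvg L.fibreMap (torusAvg B' F) = torusAvg B' F := by
      refine torusAvg_of_translate fun p s ↦ ?_
      have h3 := torusAvg_translate hs hper p
        (L.fibreEquiv.symm (nakPhi (-c) (L.fibreEquiv s)))
      rwa [hB', L.fibreEquiv.apply_symm_apply, ← nakPhi_add, add_neg_cancel, nakPhi_zero] at h3
    have h4 : torusAvg B' (torusAvg L.fibreMap F) = torusAvg L.fibreMap F :=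
      torusAvg_of_translate fun p s ↦ by
        rw [hB']; exact isFibreConstant_fibreAvg hs hF p _
    rw [← h2, torusAvg_comm _ _ hs, h4]
    rfl
  rw [← h1]
  funext p
  simp only [fibreAvg, torusAvg]
  congr 1
  funext x
  rw [map_add, add_right_comm]
  rfl

end Decks

end Averages

/-! ## The Poisson equation on the fibres and on the base -/

section Poisson

open Set

/-- This supplies the nondegeneracy hypothesis of the torus lemmas: if the directions `d k` span
`V`, no nonzero functional kills all their coordinate vectors. -/
theorem eq_zero_of_sum_symm_eq_zero {ι κ V : Type} [Fintype ι] [Fintype κ] [NormedAddCommGroup V]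
    [NormedSpace ℝ V] (e : (ι → ℝ) ≃L[ℝ] V) (d : κ → V)
    (hd : ∀ w, ∃ r : κ → ℝ, w = ∑ k, r k • d k) (y : ι → ℝ)
    (hy : ∀ k, ∑ i, y i * e.symm (d k) i = 0) : y = 0 := by
  classical
  have h1 : ∀ w, ∑ i, y i * e.symm w i = 0 := by
    intro w
    obtain ⟨r, rfl⟩ := hd w
    simp only [map_sum, map_smul, Finset.sum_apply, Pi.smul_apply, smul_eq_mul, Finset.mul_sum]
    rw [Finset.sum_comm]
    refine Finset.sum_eq_zero fun k _ ↦ ?_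
    rw [← mul_zero (r k), ← hy k, Finset.mul_sum]
    exact Finset.sum_congr rfl fun i _ ↦ by ring
  funext i
  have h2 := h1 (e (Pi.single i 1))
  rw [e.symm_apply_apply] at h2
  simpa [Pi.single_apply] using h2

variable {L : NakamuraLattice} {t : ℂ}

/-- The real directions of `ℂ²`. -/
def fibreDir : Fin 4 → ℂ × ℂ := ![(1, 0), (I, 0), (0, 1), (0, I)]

theorem exists_sum_fibreDir (w : ℂ × ℂ) : ∃ r : Fin 4 → ℝ, w = ∑ k, r k • fibreDir k := by
  refine ⟨![w.1.re, w.1.im, w.2.re, w.2.im], ?_⟩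
  rw [Fin.sum_univ_four]
  apply Prod.ext <;> apply Complex.ext <;> simp [fibreDir]

theorem torusLaplacian_fibreMap {F : ℂ × (ℂ × ℂ) → ℂ} (hF : ContDiff ℝ ∞ F) (p : ℂ × (ℂ × ℂ)) :
    torusLaplacian L.fibreMap (fun k ↦ L.fibreEquiv.symm (fibreDir k)) F p =
      4 * wirt (basisVec 1) (wirtBar (basisVec 1) F) p +
        4 * wirt (basisVec 2) (wirtBar (basisVec 2) F) p := by
  have h1 : I • basisVec 1 = (0, (I, 0)) := by simp [basisVec]
  have h2 : I • basisVec 2 = (0, (0, I)) := by simp [basisVec]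
  rw [four_wirt_wirtBar hF, four_wirt_wirtBar hF, h1, h2]
  simp only [torusLaplacian, L.fibreMap_apply, L.fibreEquiv.apply_symm_apply, Fin.sum_univ_four,
    Pi.add_apply]
  rw [← add_assoc]
  rfl

theorem eq_fibreAvg_of_laplacian_eq_zero {F : ℂ × (ℂ × ℂ) → ℂ} (hF : ContDiff ℝ ∞ F)
    (hper : IsPeriodic L.fibreMap F)
    (h0 : ∀ p, wirt (basisVec 1) (wirtBar (basisVec 1) F) p +
      wirt (basisVec 2) (wirtBar (basisVec 2) F) p = 0) : F = fibreAvg L F :=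
  eq_torusAvg_of_torusLaplacian_eq_zero
    (eq_zero_of_sum_symm_eq_zero L.fibreEquiv fibreDir exists_sum_fibreDir) hF hper
    (funext fun p ↦ by rw [torusLaplacian_fibreMap hF, ← mul_add, h0, mul_zero]; rfl)

theorem exists_fibre_laplacian_eq {g : ℂ × (ℂ × ℂ) → ℂ} (hs : ContDiff ℝ ∞ g)
    (hper : IsPeriodic L.fibreMap g) (h0 : fibreAvg L g = 0) :
    ∃ F, ContDiff ℝ ∞ F ∧ IsPeriodic L.fibreMap F ∧ fibreAvg L F = 0 ∧
      ∀ p, wirt (basisVec 1) (wirtBar (basisVec 1) F) p +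
        wirt (basisVec 2) (wirtBar (basisVec 2) F) p = g p := by
  have hg4 : ContDiff ℝ ∞ ((4 : ℂ) • g) := hs.const_smul (4 : ℂ)
  obtain ⟨F, h1, h2, h3, h4⟩ := exists_torusLaplacian_eq (by simp)
    (eq_zero_of_sum_symm_eq_zero L.fibreEquiv fibreDir exists_sum_fibreDir) hg4
    (fun p n ↦ congrArg ((4 : ℂ) • ·) (hper p n)) (B := L.fibreMap) (by
      rw [torusAvg_smul]
      exact (congrArg _ h0).trans (smul_zero _))
  refine ⟨F, h1, fun p n ↦ h4 _ (fun q ↦ congrArg ((4 : ℂ) • ·) (hper q n)) p, h2, fun p ↦ ?_⟩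
  have h5 := congrFun h3 p
  rw [torusLaplacian_fibreMap h1, ← mul_add, Pi.smul_apply, smul_eq_mul] at h5
  exact mul_left_cancel₀ (by norm_num) h5

variable {a : Fin 3 → Fin 3 → ℂ × (ℂ × ℂ) → ℂ}

theorem deckFactor_zero (j : Fin 3) : deckFactor 0 j = 1 := by
  fin_cases j <;> simp [deckFactor]

theorem isPeriodic_of_mem_bcSpace (ha : a ∈ bcSpace L t) (j k : Fin 3) :
    IsPeriodic L.fibreMap (a j k) := by
  rw [isPeriodic_fibreMap_iff]
  intro v hv p
  have h1 := ha.2.1 0 L.base.zero_mem v hv p j k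
  rw [deckFactor_zero, deckFactor_zero, nakLinear_apply, nakPhi_zero] at h1
  simpa using h1

theorem fibreAvg_mem_bcSpace (ha : a ∈ bcSpace L t) : (fun j k ↦ fibreAvg L (a j k)) ∈ bcSpace L t := by
  have hper := isPeriodic_of_mem_bcSpace ha
  obtain ⟨h1, h2, h3, h4⟩ := ha
  refine ⟨fun j k ↦ (h1 j k).torusAvg _, fun c hc v hv p j k ↦ ?_, fun l j k ↦ ?_,
    fun l j k ↦ ?_⟩
  · have h5 : a j k = (deckFactor c j * conj (deckFactor c k)) •
        fun q ↦ a j k (nakLinear c q + (c - t * conj c, v)) :=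
      funext fun q ↦ (h2 c hc v hv q j k).symm
    have h6 := fibreAvg_comp_deck (t := t) (v := v) (h1 j k).continuous (hper j k) hc
    change _ = fibreAvg L (a j k) p
    conv_rhs => rw [h5, fibreAvg, torusAvg_smul]
    exact congrArg _ (congrFun h6 p).symm
  · change wirt _ (torusAvg _ _) = wirt _ (torusAvg _ _)
    rw [← torusAvg_wirt _ (h1 _ _), ← torusAvg_wirt _ (h1 _ _), h3]
  · change wirtBar _ (torusAvg _ _) = wirtBar _ (torusAvg _ _)
    rw [← torusAvg_wirtBar _ (h1 _ _), ← torusAvg_wirtBar _ (h1 _ _), h4]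

/-- A closed array with zero fibre averages and zero trace along the fibres vanishes. -/
theorem eq_zero_of_trace_eq_zero (hs : ∀ j k, ContDiff ℝ ∞ (a j k))
    (hper : ∀ j k, IsPeriodic L.fibreMap (a j k)) (h0 : ∀ j k, fibreAvg L (a j k) = 0)
    (hd : ∀ l j k, wirt (basisVec l) (a j k) = wirt (basisVec j) (a l k))
    (hd' : ∀ l j k, wirtBar (basisVec l) (a j k) = wirtBar (basisVec k) (a j l))
    (htr : a 1 1 + a 2 2 = 0) (j k : Fin 3) : a j k = 0 := by
  rw [eq_fibreAvg_of_laplacian_eq_zero (hs j k) (hper j k), h0]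
  intro p
  -- The closedness relations turn (∂₁∂̄₁ + ∂₂∂̄₂) a_{jk} into ∂̄_k ∂_j (a₁₁ + a₂₂) = 0. So a_{jk}
  -- is harmonic along the fibres and equals its average.
  rw [hd' 1 j k, hd' 2 j k, wirt_wirtBar_comm (hs _ _), wirt_wirtBar_comm (hs _ _), hd 1 j 1,
    hd 2 j 2, ← Pi.add_apply, ← wirtBar_add (contDiff_wirt (hs _ _) _) (contDiff_wirt (hs _ _) _),
    ← wirt_add (hs _ _) (hs _ _), htr]
  have h1 : ∀ u : ℂ × (ℂ × ℂ), dirDeriv u (0 : ℂ × (ℂ × ℂ) → ℂ) = 0 := by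
    intro u; funext p; simp [dirDeriv]
  simp [wirt_eq, wirtBar_eq, h1]

/-- Modulo `∂∂̄`-exact arrays, closed arrays are constant along the fibres. -/
theorem exists_eq_fibreAvg_add_ddbar (ha : a ∈ bcSpace L t) : ∃ F, IsDeckInvariant L t F ∧
    ∀ j k, a j k = fibreAvg L (a j k) + wirt (basisVec j) (wirtBar (basisVec k) F) := by
  have hPa := fibreAvg_mem_bcSpace ha
  set b : Fin 3 → Fin 3 → ℂ × (ℂ × ℂ) → ℂ := a - fun j k ↦ fibreAvg L (a j k) with hb
  have hbm : b ∈ bcSpace L t := (bcSpace L t).sub_mem ha hPa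
  have hbper := isPeriodic_of_mem_bcSpace hbm
  have hbs := hbm.1
  have hb0 : ∀ j k, fibreAvg L (b j k) = 0 := by
    intro j k
    have h1 : b j k = a j k + (-1 : ℂ) • fibreAvg L (a j k) := by
      rw [hb]; funext p; simp [sub_eq_add_neg]
    have h2 : fibreAvg L (fibreAvg L (a j k)) = fibreAvg L (a j k) :=
      (isFibreConstant_fibreAvg (ha.1 j k).continuous (isPeriodic_of_mem_bcSpace ha j k)).fibreAvg
    have hc : Continuous ((-1 : ℂ) • fibreAvg L (a j k)) :=
      ((hPa.1 j k).const_smul (-1 : ℂ)).continuous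
    rw [h1, fibreAvg, torusAvg_add _ (ha.1 j k).continuous hc, torusAvg_smul]
    change fibreAvg L (a j k) + (-1 : ℂ) • fibreAvg L (fibreAvg L (a j k)) = 0
    rw [h2]
    simp
  have htr0 : fibreAvg L (b 1 1 + b 2 2) = 0 := by
    rw [fibreAvg, torusAvg_add _ (hbs _ _).continuous (hbs _ _).continuous]
    change fibreAvg L (b 1 1) + fibreAvg L (b 2 2) = 0
    rw [hb0, hb0, add_zero]
  have htrp : IsPeriodic L.fibreMap (b 1 1 + b 2 2) := fun p n ↦ by
    rw [Pi.add_apply, Pi.add_apply, hbper, hbper]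
  obtain ⟨F, hFs, hFp, hF0, hFg⟩ := exists_fibre_laplacian_eq ((hbs 1 1).add (hbs 2 2)) htrp htr0
  have hdd : ∀ j k, ContDiff ℝ ∞ (wirt (basisVec j) (wirtBar (basisVec k) F)) := fun j k ↦
    contDiff_wirt (contDiff_wirtBar hFs _) _
  have hneg : ∀ j k, ContDiff ℝ ∞ ((-1 : ℂ) • wirt (basisVec j) (wirtBar (basisVec k) F)) :=
    fun j k ↦ (hdd j k).const_smul (-1 : ℂ)
  -- The potential was chosen to match only the fibre trace of `b`. The difference is closed, of
  -- zero average and traceless, so all nine coefficients agree.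
  have hbF : ∀ j k, b j k = wirt (basisVec j) (wirtBar (basisVec k) F) := by
    intro j k
    have h1 := eq_zero_of_trace_eq_zero (L := L)
      (a := fun j k ↦ b j k + (-1 : ℂ) • wirt (basisVec j) (wirtBar (basisVec k) F))
      (fun j k ↦ (hbs j k).add (hneg j k)) ?_ ?_ ?_ ?_ ?_ j k
    · funext p
      have h2 := congrFun h1 p
      simp only [Pi.add_apply, Pi.smul_apply, smul_eq_mul, Pi.zero_apply] at h2
      linear_combination h2
    · intro j k p n
      have hp2 : IsPeriodic L.fibreMap (wirtBar (basisVec k) F) := fun q n ↦ by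
        simp only [wirtBar, hFp.dirDeriv _ q n]
      have hp3 : IsPeriodic L.fibreMap (wirt (basisVec j) (wirtBar (basisVec k) F)) := fun q n ↦ by
        simp only [wirt, hp2.dirDeriv _ q n]
      simp only [Pi.add_apply, Pi.smul_apply, hbper j k p n, hp3 p n]
    · intro j k
      rw [fibreAvg, torusAvg_add _ (hbs _ _).continuous (hneg j k).continuous, torusAvg_smul,
        torusAvg_wirt _ (contDiff_wirtBar hFs _), torusAvg_wirtBar _ hFs]
      change fibreAvg L (b j k) + (-1 : ℂ) • wirt _ (wirtBar _ (fibreAvg L F)) = 0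
      have h1 : ∀ u : ℂ × (ℂ × ℂ), dirDeriv u (0 : ℂ × (ℂ × ℂ) → ℂ) = 0 := by
        intro u; funext p; simp [dirDeriv]
      rw [hb0, hF0]
      simp [wirt_eq, wirtBar_eq, h1]
    · intro l j k
      rw [wirt_add (hbs _ _) (hneg _ _), wirt_add (hbs _ _) (hneg _ _), hbm.2.2.1 l j k,
        wirt_const_smul (hdd _ _), wirt_const_smul (hdd _ _), wirt_comm (contDiff_wirtBar hFs _)]
    · intro l j k
      rw [wirtBar_add (hbs _ _) (hneg _ _), wirtBar_add (hbs _ _) (hneg _ _), hbm.2.2.2 l j k,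
        wirtBar_const_smul (hdd _ _), wirtBar_const_smul (hdd _ _), wirt_wirtBar_comm hFs,
        wirt_wirtBar_comm hFs, wirtBar_comm (contDiff_wirt hFs _)]
    · funext p
      have h1 := hFg p
      simp only [Pi.add_apply, Pi.smul_apply, smul_eq_mul, Pi.zero_apply] at h1 ⊢
      linear_combination -h1
  refine ⟨F, ⟨hFs, fun c hc v hv ↦ ?_⟩, fun j k ↦ ?_⟩
  -- The flat fibre Laplacian does not commute with the deck group, so uniqueness for the Poisson
  -- equation does not give invariance directly. But each ∂_j∂̄_j F equals b_{jj}, which transforms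
  -- with the right factor. Hence F∘γ - F is harmonic along the fibres with zero average, and
  -- vanishes.
  · have hGs := contDiff_comp_deck (c := c) (t := t) (v := v) hFs
    have hGp := isPeriodic_comp_deck (t := t) (v := v) hFp hc
    have hn : ContDiff ℝ ∞ ((-1 : ℂ) • F) := hFs.const_smul (-1 : ℂ)
    have hdn : ContDiff ℝ ∞ ((fun q ↦ F (nakLinear c q + (c - t * conj c, v))) + (-1 : ℂ) • F) :=
      hGs.add hn
    have h1 := eq_fibreAvg_of_laplacian_eq_zero (L := L) hdn
      (fun p n ↦ by simp only [Pi.add_apply, Pi.smul_apply, hGp p n, hFp p n]) ?_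
    · rw [fibreAvg, torusAvg_add _ hGs.continuous hn.continuous, torusAvg_smul] at h1
      change _ = fibreAvg L _ + (-1 : ℂ) • fibreAvg L F at h1
      rw [fibreAvg_comp_deck hFs.continuous hFp hc, hF0] at h1
      intro p
      have h2 := congrFun h1 p
      simp only [Pi.add_apply, Pi.smul_apply, smul_eq_mul, Pi.zero_apply] at h2
      linear_combination h2
    · intro p
      have h2 : ∀ j, wirt (basisVec j) (wirtBar (basisVec j)
          ((fun q ↦ F (nakLinear c q + (c - t * conj c, v))) + (-1 : ℂ) • F)) p = 0 := by
        intro j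
        have hnb : ContDiff ℝ ∞ ((-1 : ℂ) • wirtBar (basisVec j) F) :=
          (contDiff_wirtBar hFs _).const_smul (-1 : ℂ)
        rw [wirtBar_add hGs hn, wirtBar_const_smul hFs, wirt_add (contDiff_wirtBar hGs _) hnb,
          wirt_const_smul (contDiff_wirtBar hFs _), Pi.add_apply, ddbar_comp_deck hFs, ← hbF,
          hbm.2.1 c hc v hv p j j]
        simp
      rw [h2, h2, add_zero]
  · rw [← hbF, hb]
    funext p
    simp

/-- The real linear map `c ↦ c - t c̄`. -/
def shiftMap (t : ℂ) : ℂ →L[ℝ] ℂ :=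
  ContinuousLinearMap.id ℝ ℂ - t • (Complex.conjCLE : ℂ →L[ℝ] ℂ)

theorem shiftMap_apply (t c : ℂ) : shiftMap t c = c - t * conj c := by
  simp [shiftMap]

/-- For `|t| ≠ 1` the map `c ↦ c - t c̄` is invertible. -/
def shiftEquiv (t : ℂ) (ht : 1 - t * conj t ≠ 0) : ℂ ≃L[ℝ] ℂ :=
  ContinuousLinearEquiv.equivOfInverse (shiftMap t)
    ((1 - t * conj t)⁻¹ • (ContinuousLinearMap.id ℝ ℂ + t • (Complex.conjCLE : ℂ →L[ℝ] ℂ)))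
    (fun c ↦ by
      simp only [shiftMap_apply, smul_apply, add_apply,
        ContinuousLinearMap.id_apply, ContinuousLinearEquiv.coe_coe, Complex.conjCLE_apply,
        smul_eq_mul, map_sub, map_mul, Complex.conj_conj]
      field_simp
      ring)
    (fun c ↦ by
      have ht' : 1 - conj t * t ≠ 0 := by rwa [mul_comm]
      simp only [shiftMap_apply, smul_apply, add_apply,
        ContinuousLinearMap.id_apply, ContinuousLinearEquiv.coe_coe, Complex.conjCLE_apply,
        smul_eq_mul, map_sub, map_mul, map_add, map_inv₀, map_one, Complex.conj_conj]
      field_simp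
      ring)

theorem shiftEquiv_apply (ht : 1 - t * conj t ≠ 0) (c : ℂ) :
    shiftEquiv t ht c = c - t * conj c := shiftMap_apply t c

variable (L t)

/-- The parametrization of the base of `X_t` by `ℝ²`. -/
def baseMap : (Fin 2 → ℝ) →L[ℝ] ℂ × (ℂ × ℂ) :=
  (ContinuousLinearMap.inl ℝ ℂ (ℂ × ℂ)) ∘L shiftMap t ∘L (L.baseEquiv : (Fin 2 → ℝ) →L[ℝ] ℂ)

theorem baseMap_apply (x : Fin 2 → ℝ) :
    baseMap L t x = (L.baseEquiv x - t * conj (L.baseEquiv x), 0) := by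
  rw [← shiftMap_apply]
  rfl

/-- The average of a function along the base. -/
def baseAvg (F : ℂ × (ℂ × ℂ) → ℂ) : ℂ × (ℂ × ℂ) → ℂ := torusAvg (baseMap L t) F

variable {L t}

theorem isPeriodic_baseMap_iff {F : ℂ × (ℂ × ℂ) → ℂ} : IsPeriodic (baseMap L t) F ↔
    ∀ c ∈ L.base, ∀ p, F (p + (c - t * conj c, 0)) = F p := by
  constructor
  · intro h c hc p
    obtain ⟨n, rfl⟩ := (L.mem_base_iff c).1 hc
    rw [← baseMap_apply]
    exact h p n
  · intro h p n
    rw [baseMap_apply]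
    exact h _ ((L.mem_base_iff _).2 ⟨n, rfl⟩) p

/-- Since c ↦ c - t c̄ is invertible, the periods still span ℂ over ℝ, and the averaging torus fills
the base. -/
theorem baseAvg_translate (ht : 1 - t * conj t ≠ 0) {F : ℂ × (ℂ × ℂ) → ℂ} (hc : Continuous F)
    (hF : IsPeriodic (baseMap L t) F) (p : ℂ × (ℂ × ℂ)) (z : ℂ) :
    baseAvg L t F (p + (z, 0)) = baseAvg L t F p := by
  have h := torusAvg_translate hc hF p (L.baseEquiv.symm ((shiftEquiv t ht).symm z))
  rwa [baseMap_apply, L.baseEquiv.apply_symm_apply, ← shiftEquiv_apply ht,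
    (shiftEquiv t ht).apply_symm_apply] at h

theorem baseAvg_eq (ht : 1 - t * conj t ≠ 0) {F : ℂ × (ℂ × ℂ) → ℂ} (hc : Continuous F)
    (hF : IsPeriodic (baseMap L t) F) (hfc : IsFibreConstant F) (p : ℂ × (ℂ × ℂ)) :
    baseAvg L t F p = baseAvg L t F 0 := by
  have h1 : baseAvg L t F ((p.1, 0) + (0, p.2)) = baseAvg L t F (p.1, 0) := by
    simp only [baseAvg, torusAvg, add_right_comm _ ((0 : ℂ), p.2), hfc _ p.2]
  have h2 := baseAvg_translate ht hc hF 0 p.1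
  rw [zero_add] at h2
  rw [← h2, ← h1]
  congr 1
  ext <;> simp

theorem IsFibreConstant.isDeckInvariant {F : ℂ × (ℂ × ℂ) → ℂ} (h : IsFibreConstant F)
    (hs : ContDiff ℝ ∞ F) (hF : IsPeriodic (baseMap L t) F) : IsDeckInvariant L t F := by
  refine ⟨hs, fun c hc v hv p ↦ ?_⟩
  rw [h.eq, ← isPeriodic_baseMap_iff.1 hF c hc p, h.eq (p + _)]
  simp [nakLinear_apply]

/-- The solution on the base torus inherits the translation symmetries of `g`: it is constant along
the fibres, so only its (0, 0) coefficient survives, and periodic, so it descends to the quotient.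
-/
theorem exists_base_laplacian_eq (ht : 1 - t * conj t ≠ 0) {g : ℂ × (ℂ × ℂ) → ℂ}
    (hs : ContDiff ℝ ∞ g) (hfc : IsFibreConstant g) (hper : IsPeriodic (baseMap L t) g)
    (h0 : baseAvg L t g = 0) : ∃ F, IsDeckInvariant L t F ∧
      ∀ j k, wirt (basisVec j) (wirtBar (basisVec k) F) = if j = 0 ∧ k = 0 then g else 0 := by
  have hg4 : ContDiff ℝ ∞ ((4 : ℂ) • g) := hs.const_smul (4 : ℂ)
  let e := L.baseEquiv.trans (shiftEquiv t ht)
  have hspan : ∀ w : ℂ, ∃ r : Fin 2 → ℝ, w = ∑ k, r k • (![1, I] : Fin 2 → ℂ) k := fun w ↦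
    ⟨![w.re, w.im], by rw [Fin.sum_univ_two]; apply Complex.ext <;> simp⟩
  obtain ⟨F, h1, h2, h3, h4⟩ := exists_torusLaplacian_eq (by simp)
    (eq_zero_of_sum_symm_eq_zero e ![1, I] hspan) hg4
    (fun p n ↦ congrArg ((4 : ℂ) • ·) (hper p n)) (B := baseMap L t) (by
      rw [torusAvg_smul]
      exact (congrArg _ h0).trans (smul_zero _))
  have hFc : IsFibreConstant F := fun p w ↦ h4 _ (fun q ↦ congrArg ((4 : ℂ) • ·) (hfc q w)) p
  refine ⟨F, hFc.isDeckInvariant h1 fun p n ↦ h4 _ (fun q ↦ congrArg ((4 : ℂ) • ·) (hper q n)) p,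
    fun j k ↦ ?_⟩
  by_cases hk : k = 0
  · by_cases hj : j = 0
    · rw [if_pos ⟨hj, hk⟩, hj, hk]
      funext p
      have h5 := congrFun h3 p
      have hb : ∀ w, baseMap L t (e.symm w) = (w, 0) := by
        intro w
        rw [baseMap_apply, ← shiftEquiv_apply ht]
        exact congrArg (fun z ↦ (z, 0)) (e.apply_symm_apply w)
      simp only [torusLaplacian, hb, Fin.sum_univ_two, Pi.add_apply, Pi.smul_apply,
        smul_eq_mul] at h5
      refine mul_left_cancel₀ (by norm_num : (4 : ℂ) ≠ 0) ?_
      rw [← h5, four_wirt_wirtBar h1]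
      have h6 : I • basisVec 0 = (I, 0) := by simp [basisVec]
      rw [h6]
      rfl
    · rw [if_neg (fun h ↦ hj h.1), wirt_wirtBar_comm h1, (hFc.wirt hj).1]
      funext p
      simp [wirtBar, dirDeriv]
  · rw [if_neg (fun h ↦ hk h.2), (hFc.wirt hk).2]
    funext p
    simp [wirt, dirDeriv]

end Poisson

/-! ## Entire functions with multipliers -/

section Multipliers

open Set

variable {L : NakamuraLattice} {t : ℂ}

/-- The exponent of the entire functions with the multipliers `e^{-c̄}`. -/
def multiplierExponent (t : ℂ) : ℂ := (1 + conj t) / (1 - t * conj t)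

/-- The phase by which `e^{κ τ}` and `e^{c̄}` differ, where `κ = multiplierExponent t` and
`τ = c - t c̄`. -/
def multiplierPhase (t c : ℂ) : ℝ := 2 * (c.im + (conj t * c).im) / (1 - Complex.normSq t)

/-- The exponent is chosen so that the difference is imaginary: over the denominator 1 - tt̄ its
numerator is (c - c̄) + (t̄c - tc̄). -/
theorem multiplierExponent_mul (ht : 1 - t * conj t ≠ 0) (c : ℂ) :
    multiplierExponent t * (c - t * conj c) - conj c = multiplierPhase t c * I := by
  have h1 : (2 * (c.im + (conj t * c).im) : ℂ) * I = (c - conj c) + (conj t * c - t * conj c) := by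
    have h2 := Complex.sub_conj c
    have h3 := Complex.sub_conj (conj t * c)
    rw [map_mul, Complex.conj_conj] at h3
    push_cast at h2 h3
    linear_combination -h2 - h3
  have h4 : (1 - (Complex.normSq t : ℂ)) = 1 - t * conj t := by rw [Complex.mul_conj]
  rw [multiplierPhase, multiplierExponent]
  push_cast
  rw [h4, div_mul_eq_mul_div, div_mul_eq_mul_div, h1, sub_eq_iff_eq_add, div_eq_iff ht, add_mul (_ / _),
    div_mul_cancel₀ _ ht]
  ring

/-- An entire function with the multipliers `e^{-s c̄}`, `s` real, under the translations by
`c - t c̄` is an exponential. -/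
theorem eq_exp_of_multiplier (ht : 1 - t * conj t ≠ 0) (s : ℝ) {f : ℂ → ℂ}
    (hf : Differentiable ℂ f) (hm : ∀ c ∈ L.base, ∀ z,
      Complex.exp (s * conj c) * f (z + (c - t * conj c)) = f z) (z : ℂ) :
    f z * Complex.exp (s * multiplierExponent t * z) = f 0 := by
  -- The exponential factor makes the multipliers unimodular, so |g| is periodic, `g` is bounded,
  -- and Liouville's theorem applies.
  set g : ℂ → ℂ := fun z ↦ f z * Complex.exp (s * multiplierExponent t * z) with hg
  have hgd : Differentiable ℂ g := by fun_prop
  have hper : ∀ c ∈ L.base, ∀ z, ‖g (z + (c - t * conj c))‖ = ‖g z‖ := by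
    intro c hc z
    have h1 : g (z + (c - t * conj c)) = g z * Complex.exp ((s * multiplierPhase t c : ℝ) * I) := by
      simp only [hg]
      rw [← hm c hc z]
      have h2 : Complex.exp (s * multiplierExponent t * (z + (c - t * conj c))) =
          Complex.exp (s * conj c) * Complex.exp (s * multiplierExponent t * z) *
            Complex.exp ((s * multiplierPhase t c : ℝ) * I) := by
        rw [← Complex.exp_add, ← Complex.exp_add]
        congr 1
        push_cast
        linear_combination (s : ℂ) * multiplierExponent_mul ht c
      rw [h2]
      ring
    rw [h1, norm_mul, Complex.norm_exp_ofReal_mul_I, mul_one]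
  let e := L.baseEquiv.trans (shiftEquiv t ht)
  have hK : IsCompact (e '' Icc 0 1) := isCompact_Icc.image e.continuous
  obtain ⟨C, hC⟩ := hK.exists_bound_of_continuousOn hgd.continuous.continuousOn
  have hb : Bornology.IsBounded (range g) := by
    rw [isBounded_iff_forall_norm_le]
    refine ⟨C, ?_⟩
    rintro _ ⟨w, rfl⟩
    obtain ⟨n, hn⟩ := exists_int_add_mem_Icc e w
    have h1 := hC _ hn
    have h2 : (e fun i ↦ (n i : ℝ)) = L.baseEquiv (fun i ↦ (n i : ℝ)) -
        t * conj (L.baseEquiv fun i ↦ (n i : ℝ)) := shiftEquiv_apply ht _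
    rwa [add_comm, h2, hper _ ((L.mem_base_iff _).2 ⟨n, rfl⟩)] at h1
  have h := hgd.apply_eq_apply_of_bounded hb z 0
  simpa [hg] using h

/-- By `eq_exp_of_multiplier` the function is a multiple of an exponential. Comparing the multiplier
of the exponential with the prescribed one leaves the phase, which must be 1. -/
theorem exp_multiplierPhase_eq_one (ht : 1 - t * conj t ≠ 0) (s : ℝ) {f : ℂ → ℂ}
    (hf : Differentiable ℂ f) (hm : ∀ c ∈ L.base, ∀ z,
      Complex.exp (s * conj c) * f (z + (c - t * conj c)) = f z) (h0 : f 0 ≠ 0) {c : ℂ}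
    (hc : c ∈ L.base) : Complex.exp ((s * multiplierPhase t c : ℝ) * I) = 1 := by
  have h1 := eq_exp_of_multiplier ht s hf hm (c - t * conj c)
  have h2 := hm c hc 0
  rw [zero_add] at h2
  have h3 : Complex.exp (s * multiplierExponent t * (c - t * conj c)) =
      Complex.exp (s * conj c) * Complex.exp ((s * multiplierPhase t c : ℝ) * I) := by
    rw [← Complex.exp_add]
    congr 1
    push_cast
    linear_combination (s : ℂ) * multiplierExponent_mul ht c
  rw [h3, ← mul_assoc, mul_comm (f _), h2] at h1
  exact mul_left_cancel₀ h0 (h1.trans (mul_one _).symm)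

/-- For small `t ≠ 0` the multipliers `e^{-s c̄}`, `s = ± 1`, are not those of an exponential. -/
theorem exists_multiplierPhase_ne (L : NakamuraLattice) : ∃ ε : ℝ, 0 < ε ∧ ε ≤ 1 ∧ ∀ t : ℂ, t ≠ 0 →
    ‖t‖ < ε → ∀ s : ℝ, s = 1 ∨ s = -1 →
      ∃ c ∈ L.base, Complex.exp ((s * multiplierPhase t c : ℝ) * I) ≠ 1 := by
  set ℓ := (Complex.log L.lam).re with hℓ
  have hℓ0 : ℓ ≠ 0 := L.log_re_ne_zero
  have hℓp : 0 < |ℓ| := abs_pos.2 hℓ0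
  -- The bound 1/10 isolates the integer found at c = 2πi; the bound 1/|ℓ| gives |ℓ Im t| < 1 for c
  -- = log λ.
  refine ⟨min (1 / 10) (1 / |ℓ|), by positivity, (min_le_left _ _).trans (by norm_num), ?_⟩
  intro t ht0 hts s hs
  have ht1 : ‖t‖ < 1 / 10 := hts.trans_le (min_le_left _ _)
  have ht2 : ‖t‖ * |ℓ| < 1 := by
    have := hts.trans_le (min_le_right _ _)
    rwa [lt_div_iff₀ hℓp] at this
  by_contra hcon
  push Not at hcon
  have hint : ∀ c ∈ L.base, ∃ n : ℤ, multiplierPhase t c = n * (2 * Real.pi) := by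
    intro c hc
    obtain ⟨n, hn⟩ := Complex.exp_eq_one_iff.1 (hcon c hc)
    have h1 : ((s * multiplierPhase t c : ℝ) : ℂ) = ((n * (2 * Real.pi) : ℝ) : ℂ) := by
      apply mul_right_cancel₀ Complex.I_ne_zero
      rw [hn]; push_cast; ring
    have h2 : s * multiplierPhase t c = n * (2 * Real.pi) := by exact_mod_cast h1
    rcases hs with rfl | rfl
    · exact ⟨n, by linarith⟩
    · exact ⟨-n, by push_cast; linarith⟩
  have hre : |t.re| ≤ ‖t‖ := Complex.abs_re_le_norm t
  have him : |t.im| ≤ ‖t‖ := Complex.abs_im_le_norm t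
  have hre' := abs_le.1 hre
  have hns : Complex.normSq t = t.re ^ 2 + t.im ^ 2 := by rw [Complex.normSq_apply]; ring
  have hnn : Complex.normSq t = ‖t‖ ^ 2 := Complex.normSq_eq_norm_sq t
  have hn0 := norm_nonneg t
  have hD : 0 < 1 - Complex.normSq t := by rw [hnn]; nlinarith
  have hπ := Real.pi_pos
  -- At c = 2πi the phase is 4π(1 + Re t)/(1 - |t|²). It is a multiple of 2π and near 4π, so it
  -- equals 4π.
  have hkey : 1 + t.re = 1 - Complex.normSq t := by
    obtain ⟨n, hn⟩ := hint (2 * Real.pi * I) ⟨0, 1, by simp⟩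
    have h1 : multiplierPhase t (2 * Real.pi * I) =
        2 * (2 * Real.pi) * (1 + t.re) / (1 - Complex.normSq t) := by
      rw [multiplierPhase]
      congr 1
      simp
      ring
    rw [h1, div_eq_iff hD.ne'] at hn
    have h2 : 2 * (1 + t.re) = n * (1 - Complex.normSq t) := by
      have h3 : (2 * Real.pi) * (2 * (1 + t.re)) = (2 * Real.pi) * (n * (1 - Complex.normSq t)) := by
        linarith
      exact mul_left_cancel₀ (by positivity) h3
    have h3 : n = 2 := by
      have h4 : (1 : ℝ) < n := by
        by_contra h5
        push Not at h5
        nlinarith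
      have h5 : (n : ℝ) < 3 := by
        by_contra h5
        push Not at h5
        nlinarith
      have h6 : 1 < n := by exact_mod_cast h4
      have h7 : n < 3 := by exact_mod_cast h5
      omega
    rw [h3] at h2
    push_cast at h2
    linarith
  -- At c = log λ, whose imaginary part is a multiple of π, the relation `hkey` leaves ℓ Im t as an
  -- integer multiple of π(1 - |t|²) > 1. As |ℓ Im t| < 1, it is zero.
  have him0 : t.im = 0 := by
    obtain ⟨n, hn⟩ := hint (Complex.log L.lam) ⟨1, 0, by simp⟩
    have h1 : multiplierPhase t (Complex.log L.lam) * (1 - Complex.normSq t) =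
        2 * ((Complex.log L.lam).im * (1 + t.re) - ℓ * t.im) := by
      rw [multiplierPhase, div_mul_cancel₀ _ hD.ne', Complex.mul_im, Complex.conj_re,
        Complex.conj_im, ← hℓ]
      ring
    have harg : ∃ k : ℤ, (Complex.log L.lam).im = k * Real.pi := by
      rw [Complex.log_im]
      rcases le_or_gt 0 L.lam with h | h
      · exact ⟨0, by rw [Complex.arg_ofReal_of_nonneg h]; simp⟩
      · exact ⟨1, by rw [Complex.arg_ofReal_of_neg h]; simp⟩
    obtain ⟨k, hk⟩ := harg
    rw [hn, hk, hkey] at h1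
    have h2 : ℓ * t.im = ((k - n : ℤ) : ℝ) * (Real.pi * (1 - Complex.normSq t)) := by
      push_cast
      linarith
    have h3 : |ℓ * t.im| < 1 := by
      rw [abs_mul]
      nlinarith
    have h4 : k - n = 0 := by
      by_contra h5
      have h6 : (1 : ℝ) ≤ |((k - n : ℤ) : ℝ)| := by exact_mod_cast Int.one_le_abs h5
      have h7 : 0 < Real.pi * (1 - Complex.normSq t) := mul_pos hπ hD
      rw [h2, abs_mul, abs_of_pos h7] at h3
      have h8 : 1 ≤ Real.pi * (1 - Complex.normSq t) := by
        rw [hnn]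
        nlinarith [Real.pi_gt_three]
      nlinarith
    rw [h4] at h2
    simpa [hℓ0] using h2
  -- For real t the relation `hkey` reads t(1 + t) = 0, which has no small solution but 0.
  rw [hns, him0] at hkey
  have h1 : t.re * (1 + t.re) = 0 := by linear_combination hkey
  have h2 : 1 + t.re ≠ 0 := by linarith
  have h3 : t.re = 0 := (mul_eq_zero.1 h1).resolve_right h2
  exact ht0 (Complex.ext h3 him0)

end Multipliers

/-! ## Closed arrays that are constant along the fibres -/

section FibreConstant

open Set

variable {L : NakamuraLattice} {t : ℂ} {a : Fin 3 → Fin 3 → ℂ × (ℂ × ℂ) → ℂ}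

theorem dirDeriv_inl {F : ℂ × (ℂ × ℂ) → ℂ} (hF : ContDiff ℝ ∞ F) (z u : ℂ) :
    fderiv ℝ (fun z ↦ F (z, 0)) z u = dirDeriv (u, 0) F (z, 0) := by
  have h1 : HasFDerivAt (fun z : ℂ ↦ ((z, 0) : ℂ × (ℂ × ℂ)))
      (ContinuousLinearMap.inl ℝ ℂ (ℂ × ℂ)) z :=
    (ContinuousLinearMap.inl ℝ ℂ (ℂ × ℂ)).hasFDerivAt
  have h2 := ((hF.differentiable (by simp) (z, 0)).hasFDerivAt.comp z h1).fderiv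
  exact congrArg (fun T : ℂ →L[ℝ] ℂ ↦ T u) h2

theorem differentiable_inl {F : ℂ × (ℂ × ℂ) → ℂ} (hF : ContDiff ℝ ∞ F) :
    Differentiable ℝ fun z : ℂ ↦ F (z, 0) :=
  (hF.comp (contDiff_id.prodMk contDiff_const)).differentiable (by simp)

theorem differentiable_of_wirtBar_eq_zero {F : ℂ × (ℂ × ℂ) → ℂ} (hF : ContDiff ℝ ∞ F)
    (h : wirtBar (basisVec 0) F = 0) : Differentiable ℂ fun z : ℂ ↦ F (z, 0) := by
  intro z
  rw [differentiableAt_complex_iff_differentiableAt_real]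
  refine ⟨differentiable_inl hF z, ?_⟩
  rw [dirDeriv_inl hF, dirDeriv_inl hF]
  have h1 := congrFun h (z, 0)
  have h2 : I • basisVec 0 = (I, 0) := by simp [basisVec]
  have h3 : basisVec 0 = (1, 0) := rfl
  simp only [wirtBar, h2, Pi.zero_apply] at h1
  rw [h3] at h1
  rw [smul_eq_mul]
  linear_combination (-2 * I) * h1 + dirDeriv (I, 0) F (z, 0) * Complex.I_sq

/-- Passing to the conjugate lets the coefficients a_{j0}, which are antiholomorphic in w₁, use the
results on entire functions. -/
theorem differentiable_of_wirt_eq_zero {F : ℂ × (ℂ × ℂ) → ℂ} (hF : ContDiff ℝ ∞ F)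
    (h : wirt (basisVec 0) F = 0) : Differentiable ℂ fun z : ℂ ↦ conj (F (z, 0)) := by
  intro z
  rw [differentiableAt_complex_iff_differentiableAt_real]
  have h0 : HasFDerivAt (fun z : ℂ ↦ conj (F (z, 0)))
      ((Complex.conjCLE : ℂ →L[ℝ] ℂ) ∘L fderiv ℝ (fun z : ℂ ↦ F (z, 0)) z) z :=
    (Complex.conjCLE : ℂ →L[ℝ] ℂ).hasFDerivAt.comp z (differentiable_inl hF z).hasFDerivAt
  refine ⟨h0.differentiableAt, ?_⟩
  rw [h0.fderiv]
  simp only [ContinuousLinearMap.comp_apply, ContinuousLinearEquiv.coe_coe, Complex.conjCLE_apply,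
    dirDeriv_inl hF]
  have h1 := congrArg conj (congrFun h (z, 0))
  have h2 : I • basisVec 0 = (I, 0) := by simp [basisVec]
  have h3 : basisVec 0 = (1, 0) := rfl
  simp only [wirt, h2, Pi.zero_apply, map_mul, map_sub, map_zero, Complex.conj_I, map_inv₀,
    map_ofNat] at h1
  rw [h3] at h1
  rw [smul_eq_mul]
  linear_combination (-2 * I) * h1 + conj (dirDeriv (I, 0) F (z, 0)) * Complex.I_sq

theorem eq_zero_apply_of_wirt_eq_zero {F : ℂ × (ℂ × ℂ) → ℂ} (hF : ContDiff ℝ ∞ F)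
    (hfc : IsFibreConstant F) (h : wirt (basisVec 0) F = 0) (h' : wirtBar (basisVec 0) F = 0)
    (p : ℂ × (ℂ × ℂ)) : F p = F 0 := by
  refine is_const_of_fderiv_eq_zero (𝕜 := ℝ) (hF.differentiable (by simp)) (fun q ↦ ?_) p 0
  refine ContinuousLinearMap.ext fun u ↦ ?_
  change dirDeriv u F q = 0
  rw [← wirt_add_wirtBar, wirt_eq_sum, wirtBar_eq_sum, Fin.sum_univ_three, Fin.sum_univ_three, h,
    h', (hfc.wirt one_ne_zero).1, (hfc.wirt one_ne_zero).2, (hfc.wirt (by decide : (2 : Fin 3) ≠ 0)).1,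
    (hfc.wirt (by decide : (2 : Fin 3) ≠ 0)).2]
  simp

theorem translate_of_mem_bcSpace (ha : a ∈ bcSpace L t) {c : ℂ} (hc : c ∈ L.base) (z : ℂ) (j k : Fin 3) :
    deckFactor c j * conj (deckFactor c k) * a j k (z + (c - t * conj c), 0) = a j k (z, 0) := by
  have h1 := ha.2.1 c hc 0 L.fibre.zero_mem (z, 0) j k
  rw [nakLinear_apply] at h1
  rw [← h1]
  congr 2
  ext <;> simp [nakPhi]

/-- Closedness trades ∂₀ a_{jk} for ∂_j a_{0k}, a derivative along the fibre. -/
theorem wirt_eq_zero_of_mem_bcSpace (ha : a ∈ bcSpace L t) (hfc : ∀ j k, IsFibreConstant (a j k))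
    {j : Fin 3} (hj : j ≠ 0) (k : Fin 3) : wirt (basisVec 0) (a j k) = 0 := by
  rw [ha.2.2.1, ((hfc 0 k).wirt hj).1]

theorem wirtBar_eq_zero_of_mem_bcSpace (ha : a ∈ bcSpace L t)
    (hfc : ∀ j k, IsFibreConstant (a j k)) (j : Fin 3) {k : Fin 3} (hk : k ≠ 0) :
    wirtBar (basisVec 0) (a j k) = 0 := by
  rw [ha.2.2.2, ((hfc j 0).wirt hk).2]

theorem eq_const_of_mem_bcSpace (ha : a ∈ bcSpace L t) (hfc : ∀ j k, IsFibreConstant (a j k))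
    {j k : Fin 3} (hj : j ≠ 0) (hk : k ≠ 0) (p : ℂ × (ℂ × ℂ)) : a j k p = a j k 0 :=
  eq_zero_apply_of_wirt_eq_zero (ha.1 j k) (hfc j k) (wirt_eq_zero_of_mem_bcSpace ha hfc hj k)
    (wirtBar_eq_zero_of_mem_bcSpace ha hfc j hk) p

/-- The diagonal coefficients along the fibres vanish, since the deck transformations scale
them by `|λ|^{± 2}`. -/
theorem diag_eq_zero_of_mem_bcSpace (ha : a ∈ bcSpace L t) (hfc : ∀ j k, IsFibreConstant (a j k))
    {j : Fin 3} (hj : j ≠ 0) : a j j = 0 := by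
  have hb : Complex.log L.lam ∈ L.base := ⟨1, 0, by simp⟩
  have h1 := translate_of_mem_bcSpace ha hb 0 j j
  rw [eq_const_of_mem_bcSpace ha hfc hj hj, eq_const_of_mem_bcSpace ha hfc hj hj (0, 0)] at h1
  have h2 : deckFactor (Complex.log L.lam) j * conj (deckFactor (Complex.log L.lam) j) ≠ 1 := by
    rw [Complex.mul_conj, Complex.normSq_eq_norm_sq]
    intro h3
    have h4 : ‖deckFactor (Complex.log L.lam) j‖ ^ 2 = 1 := by exact_mod_cast h3
    have h5 : ‖deckFactor (Complex.log L.lam) j‖ = 1 := by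
      have := norm_nonneg (deckFactor (Complex.log L.lam) j)
      nlinarith
    have h6 := L.log_re_ne_zero
    fin_cases j
    · exact hj rfl
    · simp only [deckFactor, Fin.mk_one, Matrix.cons_val_one, Matrix.cons_val_zero,
        Complex.norm_exp, Real.exp_eq_one_iff] at h5
      exact h6 h5
    · simp [deckFactor, Complex.norm_exp, Real.exp_eq_one_iff] at h5 h6
      tauto
  have h3 : a j j 0 = 0 := by
    have h4 : (deckFactor (Complex.log L.lam) j * conj (deckFactor (Complex.log L.lam) j) - 1) *
        a j j 0 = 0 := by rw [sub_mul, h1]; ring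
    exact (mul_eq_zero.1 h4).resolve_left (sub_ne_zero.2 h2)
  funext p
  rw [eq_const_of_mem_bcSpace ha hfc hj hj p, h3]
  rfl

/-- The sign with which the base coordinate enters `deckFactor`. -/
def deckSign : Fin 3 → ℝ := ![0, 1, -1]

theorem conj_deckFactor (c : ℂ) (j : Fin 3) :
    conj (deckFactor c j) = Complex.exp (deckSign j * conj c) := by
  fin_cases j <;> simp [deckFactor, deckSign, ← Complex.exp_conj]

/-- In row 0 only the conjugate factor is left. The conjugated column 0 obeys the same rule, so
`eq_exp_of_multiplier` serves both. -/
theorem multiplier_row (ha : a ∈ bcSpace L t) (k : Fin 3) {c : ℂ} (hc : c ∈ L.base) (z : ℂ) :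
    Complex.exp (deckSign k * conj c) * a 0 k (z + (c - t * conj c), 0) = a 0 k (z, 0) := by
  have h := translate_of_mem_bcSpace ha hc z 0 k
  rwa [conj_deckFactor, show deckFactor c 0 = 1 from rfl, one_mul] at h

theorem multiplier_column (ha : a ∈ bcSpace L t) (j : Fin 3) {c : ℂ} (hc : c ∈ L.base) (z : ℂ) :
    Complex.exp (deckSign j * conj c) * conj (a j 0 (z + (c - t * conj c), 0)) =
      conj (a j 0 (z, 0)) := by
  have h := congrArg conj (translate_of_mem_bcSpace ha hc z j 0)
  rwa [map_mul, map_mul, conj_deckFactor, show deckFactor c 0 = 1 from rfl, map_one, map_one,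
    mul_one] at h

/-- The coefficient is a fixed exponential times its value at the origin, so that single value
decides. -/
theorem row_eq_zero (ht : 1 - t * conj t ≠ 0) (ha : a ∈ bcSpace L t)
    (hfc : ∀ j k, IsFibreConstant (a j k)) {k : Fin 3} (hk : k ≠ 0) (h0 : a 0 k 0 = 0) :
    a 0 k = 0 := by
  funext p
  have h := eq_exp_of_multiplier ht (deckSign k) (differentiable_of_wirtBar_eq_zero (ha.1 0 k)
    (wirtBar_eq_zero_of_mem_bcSpace ha hfc 0 hk)) (fun c hc z ↦ multiplier_row ha k hc z) p.1
  rw [(hfc 0 k).eq p]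
  refine (mul_eq_zero.1 (h.trans h0)).resolve_right (Complex.exp_ne_zero _)

theorem column_eq_zero (ht : 1 - t * conj t ≠ 0) (ha : a ∈ bcSpace L t)
    (hfc : ∀ j k, IsFibreConstant (a j k)) {j : Fin 3} (hj : j ≠ 0) (h0 : a j 0 0 = 0) :
    a j 0 = 0 := by
  funext p
  have h := eq_exp_of_multiplier ht (deckSign j) (differentiable_of_wirt_eq_zero (ha.1 j 0)
    (wirt_eq_zero_of_mem_bcSpace ha hfc hj 0)) (fun c hc z ↦ multiplier_column ha j hc z) p.1
  rw [(hfc j 0).eq p]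
  have h1 : conj (a j 0 (0, 0)) = 0 := by
    change conj (a j 0 0) = 0
    rw [h0, map_zero]
  have h2 := (mul_eq_zero.1 (h.trans h1)).resolve_right (Complex.exp_ne_zero _)
  rwa [map_eq_zero] at h2

/-- Without a resonance the mixed coefficients of fibre constant closed arrays vanish. -/
theorem mixed_apply_zero_of_nonresonant (ht : 1 - t * conj t ≠ 0) (ha : a ∈ bcSpace L t)
    (hfc : ∀ j k, IsFibreConstant (a j k)) {j : Fin 3} (hj : j ≠ 0)
    (hn : ∃ c ∈ L.base, Complex.exp ((deckSign j * multiplierPhase t c : ℝ) * I) ≠ 1) :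
    a 0 j 0 = 0 ∧ a j 0 0 = 0 := by
  obtain ⟨c, hc, hcn⟩ := hn
  constructor
  · by_contra h0
    exact hcn (exp_multiplierPhase_eq_one ht (deckSign j) (differentiable_of_wirtBar_eq_zero
      (ha.1 0 j) (wirtBar_eq_zero_of_mem_bcSpace ha hfc 0 hj))
      (fun c hc z ↦ multiplier_row ha j hc z) h0 hc)
  · by_contra h0
    refine hcn (exp_multiplierPhase_eq_one ht (deckSign j) (differentiable_of_wirt_eq_zero
      (ha.1 j 0) (wirt_eq_zero_of_mem_bcSpace ha hfc hj 0))
      (fun c hc z ↦ multiplier_column ha j hc z) ?_ hc)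
    exact (map_ne_zero conj).2 h0

end FibreConstant

/-! ## Averages of closed arrays and the Bott-Chern numbers -/

section Averages

open Set

variable (L : NakamuraLattice) (t : ℂ)

/-- The average along the fibres of a coefficient, at the origin. -/
def fibreCoeff (j k : Fin 3) : bcSpace L t →ₗ[ℂ] ℂ where
  toFun a := fibreAvg L (a.1 j k) 0
  map_add' a b := congrFun (torusAvg_add _ (a.2.1 j k).continuous (b.2.1 j k).continuous) 0
  map_smul' c a := congrFun (torusAvg_smul _ c (a.1 j k)) 0

/-- The total average of the coefficient of `dz₁ ∧ dz̄₁`. -/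
def totalCoeff : bcSpace L t →ₗ[ℂ] ℂ where
  toFun a := baseAvg L t (fibreAvg L (a.1 0 0)) 0
  map_add' a b := by
    have h1 : fibreAvg L ((a + b).1 0 0) = fibreAvg L (a.1 0 0) + fibreAvg L (b.1 0 0) :=
      torusAvg_add _ (a.2.1 0 0).continuous (b.2.1 0 0).continuous
    rw [h1]
    exact congrFun (torusAvg_add _ ((a.2.1 0 0).torusAvg _).continuous
      ((b.2.1 0 0).torusAvg _).continuous) 0
  map_smul' c a := by
    have h1 : fibreAvg L ((c • a).1 0 0) = c • fibreAvg L (a.1 0 0) := torusAvg_smul _ c (a.1 0 0)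
    rw [h1]
    exact congrFun (torusAvg_smul _ c _) 0

variable {L t} {F : ℂ × (ℂ × ℂ) → ℂ}

theorem wirt_zero (u : ℂ × (ℂ × ℂ)) : wirt u (0 : ℂ × (ℂ × ℂ) → ℂ) = 0 := by
  funext p; simp [wirt, dirDeriv]

theorem wirtBar_const (u : ℂ × (ℂ × ℂ)) (c : ℂ) : wirtBar u (fun _ : ℂ × (ℂ × ℂ) ↦ c) = 0 := by
  funext p; simp [wirtBar, dirDeriv]

theorem IsDeckInvariant.isPeriodic (h : IsDeckInvariant L t F) : IsPeriodic L.fibreMap F := by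
  rw [isPeriodic_fibreMap_iff]
  intro v hv p
  have h1 := h.2 0 L.base.zero_mem v hv p
  rw [nakLinear_apply, nakPhi_zero] at h1
  simpa using h1

theorem IsDeckInvariant.isFibreConstant_fibreAvg (h : IsDeckInvariant L t F) :
    IsFibreConstant (fibreAvg L F) :=
  _root_.isFibreConstant_fibreAvg h.1.continuous h.isPeriodic

theorem IsDeckInvariant.isPeriodic_fibreAvg (h : IsDeckInvariant L t F) :
    IsPeriodic (baseMap L t) (fibreAvg L F) := by
  rw [isPeriodic_baseMap_iff]
  intro c hc p
  have h1 := congrFun (fibreAvg_comp_deck (t := t) (v := 0) h.1.continuous h.isPeriodic hc) p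
  have h2 : (fun q ↦ F (nakLinear c q + (c - t * conj c, 0))) = F :=
    funext fun q ↦ h.2 c hc 0 L.fibre.zero_mem q
  rw [h2, h.isFibreConstant_fibreAvg.eq (nakLinear c p + _)] at h1
  rw [h1, h.isFibreConstant_fibreAvg.eq (p + _)]
  simp [nakLinear_apply]

theorem fibreAvg_ddbar (hF : ContDiff ℝ ∞ F) (u v : ℂ × (ℂ × ℂ)) :
    fibreAvg L (wirt u (wirtBar v F)) = wirt u (wirtBar v (fibreAvg L F)) := by
  rw [fibreAvg, torusAvg_wirt _ (contDiff_wirtBar hF _), torusAvg_wirtBar _ hF]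
  rfl

theorem IsDeckInvariant.fibreAvg_ddbar_eq_zero (h : IsDeckInvariant L t F) {j k : Fin 3}
    (hjk : j ≠ 0 ∨ k ≠ 0) : fibreAvg L (wirt (basisVec j) (wirtBar (basisVec k) F)) = 0 := by
  have hs : ContDiff ℝ ∞ (fibreAvg L F) := h.1.torusAvg _
  have hfc := h.isFibreConstant_fibreAvg
  rw [fibreAvg_ddbar h.1]
  rcases hjk with hj | hk
  · rw [wirt_wirtBar_comm hs, (hfc.wirt hj).1]
    exact wirtBar_const _ 0
  · rw [(hfc.wirt hk).2, wirt_zero]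

/-- Averages commute with the derivatives, and the average of `F` over fibre and base is a constant.
-/
theorem IsDeckInvariant.baseAvg_ddbar_eq_zero (ht : 1 - t * conj t ≠ 0)
    (h : IsDeckInvariant L t F) (u v : ℂ × (ℂ × ℂ)) :
    baseAvg L t (fibreAvg L (wirt u (wirtBar v F))) = 0 := by
  have hs : ContDiff ℝ ∞ (fibreAvg L F) := h.1.torusAvg _
  have h1 : torusAvg (baseMap L t) (fibreAvg L F) = fun _ ↦ baseAvg L t (fibreAvg L F) 0 :=
    funext fun p ↦ baseAvg_eq ht hs.continuous h.isPeriodic_fibreAvg h.isFibreConstant_fibreAvg p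
  rw [fibreAvg_ddbar h.1, baseAvg, torusAvg_wirt _ (contDiff_wirtBar hs _), torusAvg_wirtBar _ hs,
    h1, wirtBar_const, wirt_zero]

/-- A closed array is of the form `∂ ∂̄ F` if and only if its averages vanish. -/
theorem averages_eq_zero_iff (ht : 1 - t * conj t ≠ 0) (a : bcSpace L t) :
    (totalCoeff L t a = 0 ∧ fibreCoeff L t 1 2 a = 0 ∧ fibreCoeff L t 2 1 a = 0 ∧
      ∀ j ≠ 0, fibreCoeff L t 0 j a = 0 ∧ fibreCoeff L t j 0 a = 0) ↔
    ∃ F, IsDeckInvariant L t F ∧ ∀ j k, a.1 j k = wirt (basisVec j) (wirtBar (basisVec k) F) := by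
  constructor
  · rintro ⟨h00, h12, h21, h0⟩
    obtain ⟨F, hF, haF⟩ := exists_eq_fibreAvg_add_ddbar a.2
    have hb := fibreAvg_mem_bcSpace a.2
    have hfc : ∀ j k, IsFibreConstant (fibreAvg L (a.1 j k)) := fun j k ↦
      isFibreConstant_fibreAvg (a.2.1 j k).continuous (isPeriodic_of_mem_bcSpace a.2 j k)
    have hper : IsPeriodic (baseMap L t) (fibreAvg L (a.1 0 0)) := by
      rw [isPeriodic_baseMap_iff]
      intro c hc p
      have h1 := translate_of_mem_bcSpace hb hc p.1 0 0
      simp only [deckFactor, Matrix.cons_val_zero, map_one, one_mul] at h1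
      rw [(hfc 0 0).eq p, ← h1, (hfc 0 0).eq]
      simp
    have hconst : baseAvg L t (fibreAvg L (a.1 0 0)) = 0 :=
      funext fun p ↦ (baseAvg_eq ht (hb.1 0 0).continuous hper (hfc 0 0) p).trans h00
    -- A second potential, on the base, accounts for the averaged (0, 0) coefficient, whose mean is
    -- zero.
    obtain ⟨G, hG, haG⟩ := exists_base_laplacian_eq ht (hb.1 0 0) (hfc 0 0) hper hconst
    -- The values at the origin determine the constant and the mixed coefficients; the diagonal ones
    -- vanish without any hypothesis on averages.
    have hz : ∀ j k : Fin 3, ¬ (j = 0 ∧ k = 0) → fibreAvg L (a.1 j k) = 0 := by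
      have h1 : ∀ j : Fin 3, j ≠ 0 → ∀ k, k ≠ 0 → fibreAvg L (a.1 j k) 0 = 0 →
          fibreAvg L (a.1 j k) = 0 := fun j hj k hk h ↦
        funext fun p ↦ (eq_const_of_mem_bcSpace hb hfc hj hk p).trans h
      have h2 : ∀ k : Fin 3, k ≠ 0 → fibreAvg L (a.1 0 k) = 0 := fun k hk ↦
        row_eq_zero ht hb hfc hk (h0 k hk).1
      have h3 : ∀ j : Fin 3, j ≠ 0 → fibreAvg L (a.1 j 0) = 0 := fun j hj ↦
        column_eq_zero ht hb hfc hj (h0 j hj).2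
      have h4 : ∀ j : Fin 3, j ≠ 0 → fibreAvg L (a.1 j j) = 0 := fun j hj ↦
        diag_eq_zero_of_mem_bcSpace hb hfc hj
      intro j k hjk
      fin_cases j <;> fin_cases k
      · exact absurd ⟨rfl, rfl⟩ hjk
      · exact h2 1 (by decide)
      · exact h2 2 (by decide)
      · exact h3 1 (by decide)
      · exact h4 1 (by decide)
      · exact h1 1 (by decide) 2 (by decide) h12
      · exact h3 2 (by decide)
      · exact h1 2 (by decide) 1 (by decide) h21
      · exact h4 2 (by decide)
    refine ⟨F + G, ⟨hF.1.add hG.1, fun c hc v hv p ↦ ?_⟩, fun j k ↦ ?_⟩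
    · rw [Pi.add_apply, Pi.add_apply, hF.2 c hc v hv, hG.2 c hc v hv]
    · rw [wirtBar_add hF.1 hG.1, wirt_add (contDiff_wirtBar hF.1 _) (contDiff_wirtBar hG.1 _),
        haG, haF j k, add_comm]
      congr 1
      split_ifs with hjk
      · rw [hjk.1, hjk.2]
      · rw [hz j k hjk]
  · rintro ⟨F, hF, haF⟩
    have h1 : ∀ j k : Fin 3, j ≠ 0 ∨ k ≠ 0 → fibreCoeff L t j k a = 0 := by
      intro j k hjk
      change fibreAvg L (a.1 j k) 0 = 0
      rw [haF, hF.fibreAvg_ddbar_eq_zero hjk, Pi.zero_apply]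
    refine ⟨?_, h1 _ _ (by decide), h1 _ _ (by decide), fun j hj ↦ ⟨h1 _ _ (.inr hj),
      h1 _ _ (.inl hj)⟩⟩
    change baseAvg L t (fibreAvg L (a.1 0 0)) 0 = 0
    rw [haF, hF.baseAvg_ddbar_eq_zero ht, Pi.zero_apply]

theorem mixed_fibreCoeff_eq_zero (ht : 1 - t * conj t ≠ 0) (a : bcSpace L t) {j : Fin 3}
    (hj : j ≠ 0)
    (hn : ∃ c ∈ L.base, Complex.exp ((deckSign j * multiplierPhase t c : ℝ) * I) ≠ 1) :
    fibreCoeff L t 0 j a = 0 ∧ fibreCoeff L t j 0 a = 0 :=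
  mixed_apply_zero_of_nonresonant ht (fibreAvg_mem_bcSpace a.2) (fun j k ↦
    isFibreConstant_fibreAvg (a.2.1 j k).continuous (isPeriodic_of_mem_bcSpace a.2 j k)) hj hn

end Averages

/-! ### Explicit representatives of the Bott-Chern classes. -/

section InvariantArrays

variable {L : NakamuraLattice} {t : ℂ} {F : ℂ × (ℂ × ℂ) → ℂ}

theorem dirDeriv_I_smul_of_differentiable (hF : Differentiable ℂ F) (u p : ℂ × (ℂ × ℂ)) :
    dirDeriv (I • u) F p = I * dirDeriv u F p := by
  simp only [dirDeriv, (hF p).fderiv_restrictScalars ℝ, ContinuousLinearMap.coe_restrictScalars',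
    map_smul, smul_eq_mul]

theorem wirtBar_eq_zero_of_differentiable (hF : Differentiable ℂ F) (u : ℂ × (ℂ × ℂ)) :
    wirtBar u F = 0 := by
  funext p
  simp only [wirtBar, dirDeriv_I_smul_of_differentiable hF, Pi.zero_apply]
  linear_combination 2⁻¹ * dirDeriv u F p * Complex.I_sq

theorem dirDeriv_conj (hF : Differentiable ℝ F) (u p : ℂ × (ℂ × ℂ)) :
    dirDeriv u (fun q ↦ conj (F q)) p = conj (dirDeriv u F p) := by
  have h := ((Complex.conjCLE : ℂ →L[ℝ] ℂ).hasFDerivAt.comp p (hF p).hasFDerivAt).fderiv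
  exact congrArg (fun T : ℂ × (ℂ × ℂ) →L[ℝ] ℂ ↦ T u) h

theorem wirt_conj_eq_zero_of_differentiable (hF : Differentiable ℂ F) (u : ℂ × (ℂ × ℂ)) :
    wirt u (fun q ↦ conj (F q)) = 0 := by
  funext p
  have hR : Differentiable ℝ F := hF.restrictScalars ℝ
  simp only [wirt, dirDeriv_conj hR, dirDeriv_I_smul_of_differentiable hF, Pi.zero_apply, map_mul, Complex.conj_I]
  linear_combination 2⁻¹ * conj (dirDeriv u F p) * Complex.I_sq

/-- Fibre derivatives vanish, so closedness only restricts ∂₀ outside row 0 and ∂̄₀ outside column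
0. -/
theorem mem_bcSpace_of_isFibreConstant {a : Fin 3 → Fin 3 → ℂ × (ℂ × ℂ) → ℂ}
    (hs : ∀ j k, ContDiff ℝ ∞ (a j k)) (hfc : ∀ j k, IsFibreConstant (a j k))
    (hinv : ∀ c ∈ L.base, ∀ p : ℂ × (ℂ × ℂ), ∀ j k, deckFactor c j * conj (deckFactor c k) *
      a j k (p.1 + (c - t * conj c), 0) = a j k p)
    (h : ∀ j ≠ 0, ∀ k, wirt (basisVec 0) (a j k) = 0)
    (h' : ∀ j, ∀ k ≠ 0, wirtBar (basisVec 0) (a j k) = 0) : a ∈ bcSpace L t := by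
  have h1 : ∀ l j k, l ≠ j → wirt (basisVec l) (a j k) = 0 := by
    intro l j k hlj
    by_cases hl : l = 0
    · subst hl; exact h j hlj.symm k
    · exact ((hfc j k).wirt hl).1
  have h2 : ∀ l j k, l ≠ k → wirtBar (basisVec l) (a j k) = 0 := by
    intro l j k hlk
    by_cases hl : l = 0
    · subst hl; exact h' j k hlk.symm
    · exact ((hfc j k).wirt hl).2
  refine ⟨hs, fun c hc v hv p j k ↦ ?_, fun l j k ↦ ?_, fun l j k ↦ ?_⟩
  · rw [← hinv c hc p, (hfc j k).eq]
    simp [nakLinear_apply]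
  · by_cases hlj : l = j
    · rw [hlj]
    · rw [h1 l j k hlj, h1 j l k (Ne.symm hlj)]
  · by_cases hlk : l = k
    · rw [hlk]
    · rw [h2 l j k hlk, h2 k j l (Ne.symm hlk)]

/-- The coefficient arrays of a basis of the Bott-Chern cohomology. -/
def invariantArray (x : Fin 7 → ℂ) (j k : Fin 3) (p : ℂ × (ℂ × ℂ)) : ℂ :=
  !![x 0, x 3 * Complex.exp (-p.1), x 4 * Complex.exp p.1;
    -- The double conjugation keeps the entry linear in `x` and displays it as the conjugate of a
    -- holomorphic function.
    conj (conj (x 5) * Complex.exp (-p.1)), 0, x 1;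
    conj (conj (x 6) * Complex.exp p.1), x 2, 0] j k

theorem isFibreConstant_invariantArray (x : Fin 7 → ℂ) (j k : Fin 3) :
    IsFibreConstant (invariantArray x j k) := by
  intro p w
  simp [invariantArray]

theorem contDiff_invariantArray (x : Fin 7 → ℂ) (j k : Fin 3) :
    ContDiff ℝ ∞ (invariantArray x j k) := by
  have hc : ContDiff ℝ ∞ (conj : ℂ → ℂ) := Complex.conjCLE.contDiff
  have h1 : ContDiff ℝ ∞ fun p : ℂ × (ℂ × ℂ) ↦ Complex.exp p.1 := contDiff_fst.cexp
  have h2 : ContDiff ℝ ∞ fun p : ℂ × (ℂ × ℂ) ↦ Complex.exp (-p.1) := contDiff_fst.neg.cexp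
  fin_cases j <;> fin_cases k
  · exact contDiff_const
  · exact contDiff_const.mul h2
  · exact contDiff_const.mul h1
  · exact hc.comp (contDiff_const.mul h2)
  · exact contDiff_const
  · exact contDiff_const
  · exact hc.comp (contDiff_const.mul h1)
  · exact contDiff_const
  · exact contDiff_const

/-- At t = 0 the exponentials e^{∓w₁} have multipliers e^{∓c}, and these cancel the required
conjugate factors e^{±c̄} because e^{c - c̄} = 1. For other t only the constant entries are used. -/
theorem invariantArray_mem_bcSpace {x : Fin 7 → ℂ}
    (hx : t = 0 ∨ x 3 = 0 ∧ x 4 = 0 ∧ x 5 = 0 ∧ x 6 = 0) : invariantArray x ∈ bcSpace L t := by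
  refine mem_bcSpace_of_isFibreConstant (contDiff_invariantArray x)
    (isFibreConstant_invariantArray x) (fun c hc p ↦ ?_) (fun j hj k ↦ ?_) fun j k hk ↦ ?_
  · have h1 := exp_mul_conj_exp_neg hc
    have h2 := exp_mul_conj_exp_neg (L.base.neg_mem hc)
    rw [neg_neg] at h2
    intro j k
    fin_cases j <;> fin_cases k
    · simp [deckFactor, invariantArray]
    · rcases hx with rfl | ⟨h3, -⟩
      · simp only [deckFactor, invariantArray]
        simp [Complex.exp_add]
        linear_combination x 3 * Complex.exp (-p.1) * h2
      · simp [invariantArray, h3]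
    · rcases hx with rfl | ⟨-, h3, -⟩
      · simp only [deckFactor, invariantArray]
        simp [Complex.exp_add]
        linear_combination x 4 * Complex.exp p.1 * h1
      · simp [invariantArray, h3]
    · rcases hx with rfl | ⟨-, -, h3, -⟩
      · simp only [deckFactor, invariantArray]
        simp [Complex.exp_add]
        linear_combination x 5 * conj (Complex.exp (-p.1)) * h1
      · simp [invariantArray, h3]
    · simp [invariantArray]
    · simp [deckFactor, invariantArray]
      linear_combination x 1 * h1
    · rcases hx with rfl | ⟨-, -, -, h3⟩
      · simp only [deckFactor, invariantArray]
        simp [Complex.exp_add]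
        linear_combination x 6 * conj (Complex.exp p.1) * h2
      · simp [invariantArray, h3]
    · simp [deckFactor, invariantArray]
      linear_combination x 2 * h2
    · simp [invariantArray]
  · have hd1 : Differentiable ℂ fun p : ℂ × (ℂ × ℂ) ↦ conj (x 5) * Complex.exp (-p.1) := by fun_prop
    have hd2 : Differentiable ℂ fun p : ℂ × (ℂ × ℂ) ↦ conj (x 6) * Complex.exp p.1 := by fun_prop
    have hd : ∀ y : ℂ, wirt (basisVec 0) (fun _ ↦ y) = 0 := fun y ↦ by
      funext p; simp [wirt, dirDeriv]
    fin_cases j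
    · exact absurd rfl hj
    · fin_cases k
      · exact wirt_conj_eq_zero_of_differentiable hd1 _
      · exact hd _
      · exact hd _
    · fin_cases k
      · exact wirt_conj_eq_zero_of_differentiable hd2 _
      · exact hd _
      · exact hd _
  · have hd1 : Differentiable ℂ fun p : ℂ × (ℂ × ℂ) ↦ x 3 * Complex.exp (-p.1) := by fun_prop
    have hd2 : Differentiable ℂ fun p : ℂ × (ℂ × ℂ) ↦ x 4 * Complex.exp p.1 := by fun_prop
    fin_cases k
    · exact absurd rfl hk
    · fin_cases j
      · exact wirtBar_eq_zero_of_differentiable hd1 _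
      · exact wirtBar_const _ _
      · exact wirtBar_const _ _
    · fin_cases j
      · exact wirtBar_eq_zero_of_differentiable hd2 _
      · exact wirtBar_const _ _
      · exact wirtBar_const _ _

theorem fibreCoeff_invariantArray {x : Fin 7 → ℂ} (h : invariantArray x ∈ bcSpace L t)
    (j k : Fin 3) : fibreCoeff L t j k ⟨invariantArray x, h⟩ = invariantArray x j k 0 :=
  congrFun (isFibreConstant_invariantArray x j k).fibreAvg 0

theorem totalCoeff_invariantArray {x : Fin 7 → ℂ} (h : invariantArray x ∈ bcSpace L t) :
    totalCoeff L t ⟨invariantArray x, h⟩ = x 0 := by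
  change baseAvg L t (fibreAvg L (invariantArray x 0 0)) 0 = x 0
  rw [(isFibreConstant_invariantArray x 0 0).fibreAvg]
  exact congrFun (torusAvg_of_translate fun _ _ ↦ rfl) 0

end InvariantArrays

/-! ### The Bott-Chern numbers 7 and 3. -/

section BottChernNumbers

open Set

variable {L : NakamuraLattice} {t : ℂ} {M : Type} [TopologicalSpace M]
  [ChartedSpace (ℂ × (ℂ × ℂ)) M] {π : ℂ × (ℂ × ℂ) → M}

/-- The seven averages detect exactness by `averages_eq_zero_iff`, and `invariantArray` realises
every value of them. -/
theorem bottChernNumber11_eq_seven (h : IsAffineCovering univ (nakDecks L 0) π) :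
    bottChernNumber11 (ℂ × (ℂ × ℂ)) M = 7 := by
  let Φ : bcSpace L 0 →ₗ[ℂ] (Fin 7 → ℂ) := LinearMap.pi ![totalCoeff L 0, fibreCoeff L 0 1 2,
    fibreCoeff L 0 2 1, fibreCoeff L 0 0 1, fibreCoeff L 0 0 2, fibreCoeff L 0 1 0,
    fibreCoeff L 0 2 0]
  rw [bottChernNumber11_eq h Φ, LinearMap.range_eq_top.2, finrank_top, Module.finrank_fin_fun]
  · intro x
    have hx : invariantArray x ∈ bcSpace L 0 := invariantArray_mem_bcSpace (.inl rfl)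
    refine ⟨⟨invariantArray x, hx⟩, ?_⟩
    funext i
    fin_cases i
    · exact totalCoeff_invariantArray hx
    all_goals
      refine (fibreCoeff_invariantArray hx _ _).trans ?_
      simp [invariantArray]
  · intro a
    rw [← averages_eq_zero_iff (by simp), funext_iff, Fin.forall_fin_succ]
    simp only [Fin.forall_fin_succ, Φ, LinearMap.pi_apply]
    simp
    tauto

/-- Without resonance the four mixed averages vanish identically, so three averages detect
exactness, and constant arrays realise all their values. -/
theorem bottChernNumber11_eq_three (ht : 1 - t * conj t ≠ 0)
    (hn : ∀ s : ℝ, s = 1 ∨ s = -1 →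
      ∃ c ∈ L.base, Complex.exp ((s * multiplierPhase t c : ℝ) * I) ≠ 1)
    (h : IsAffineCovering univ (nakDecks L t) π) : bottChernNumber11 (ℂ × (ℂ × ℂ)) M = 3 := by
  let Φ : bcSpace L t →ₗ[ℂ] (Fin 3 → ℂ) :=
    LinearMap.pi ![totalCoeff L t, fibreCoeff L t 1 2, fibreCoeff L t 2 1]
  have hmixed : ∀ a, ∀ j : Fin 3, j ≠ 0 → fibreCoeff L t 0 j a = 0 ∧ fibreCoeff L t j 0 a = 0 := by
    intro a j hj
    refine mixed_fibreCoeff_eq_zero ht a hj (hn _ ?_)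
    fin_cases j
    · exact absurd rfl hj
    · exact .inl rfl
    · exact .inr rfl
  rw [bottChernNumber11_eq h Φ, LinearMap.range_eq_top.2, finrank_top, Module.finrank_fin_fun]
  · intro x
    have hx : invariantArray ![x 0, x 1, x 2, 0, 0, 0, 0] ∈ bcSpace L t :=
      invariantArray_mem_bcSpace (.inr ⟨rfl, rfl, rfl, rfl⟩)
    refine ⟨⟨_, hx⟩, ?_⟩
    funext i
    fin_cases i
    · exact totalCoeff_invariantArray hx
    · exact fibreCoeff_invariantArray hx 1 2
    · exact fibreCoeff_invariantArray hx 2 1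
  · intro a
    have h1 := hmixed a 1 (by decide)
    have h2 := hmixed a 2 (by decide)
    rw [← averages_eq_zero_iff ht, funext_iff]
    simp only [Fin.forall_fin_succ, Φ, LinearMap.pi_apply]
    simp
    tauto

end BottChernNumbers

end

theorem proposition2p7 (L : NakamuraLattice) :
    -- `Γ \ (Δ × G) → Δ` is a holomorphic family of compact complex manifolds ...
    IsHolomorphicFamily (E := ℂ × (ℂ × (ℂ × ℂ))) (F := ℂ) (familyProj L) ∧
    -- ... whose fibre over `t` is `X_t`
    (∀ t : unitDisc,
      IsComplexManifold (ℂ × (ℂ × ℂ)) (DeformedNakamura L t) ∧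
      CompactSpace (DeformedNakamura L t) ∧
      Manifold.IsSmoothEmbedding 𝓘(ℂ, ℂ × (ℂ × ℂ)) 𝓘(ℂ, ℂ × (ℂ × (ℂ × ℂ))) ω
        (fibreInclusion L t) ∧
      Set.range (fibreInclusion L t) = familyProj L ⁻¹' {t}) ∧
    -- `X_0` is the Nakamura manifold
    IsComplexManifold (ℂ × (ℂ × ℂ)) (NakamuraManifold L) ∧
    (∃ e : NakamuraManifold L ≃ₘ^ω⟮𝓘(ℂ, ℂ × (ℂ × ℂ)), 𝓘(ℂ, ℂ × (ℂ × ℂ))⟯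
        DeformedNakamura L discZero,
      ∀ g : NakGroup, e (nakProj L g) = deformedProj L discZero g) ∧
    -- `X_t` is the smooth manifold `X` with the complex structure given by `t ∂/∂z₁ ⊗ dz̄₁`
    (∀ t : unitDisc,
      (∃ e : NakamuraManifold L ≃ₘ^∞⟮𝓘(ℝ, ℂ × (ℂ × ℂ)), 𝓘(ℝ, ℂ × (ℂ × ℂ))⟯
          DeformedNakamura L t,
        ∀ g : NakGroup, e (nakProj L g) = deformedProj L t g) ∧
      SatisfiesBeltrami (E := ℂ × (ℂ × ℂ)) (E' := ℂ × (ℂ × ℂ)) (nakBeltrami t)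
        (deformedProj L t)) ∧
    -- the explicit form on `G` descends to a pseudo-Kähler metric on `X_t`, for every `t`
    (∀ t : unitDisc, ∃ F : DeformedNakamura L t → CForm (ℂ × (ℂ × ℂ)) 2,
      IsPseudoKahler F ∧
      ∀ (g : NakGroup) (u v : ℂ × (ℂ × ℂ)),
        pullbackForm (deformedProj L t) F g ![u, v] = nakMetric t g u v) ∧
    -- `h^{1,1}_BC` is `7` on `X` and `3` on its small deformations `X_t`, `t ≠ 0`
    bottChernNumber11 (ℂ × (ℂ × ℂ)) (NakamuraManifold L) = 7 ∧
    ∃ ε : ℝ, 0 < ε ∧ ∀ t : unitDisc, (t : ℂ) ≠ 0 → ‖(t : ℂ)‖ < ε →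
      bottChernNumber11 (ℂ × (ℂ × ℂ)) (DeformedNakamura L t) = 3 := by
  refine ⟨isHolomorphicFamily L, fun t ↦ ⟨isComplexManifold_deformed L t, compactSpace_deformed L t,
    isSmoothEmbedding_fibreInclusion L t, range_fibreInclusion L t⟩, isComplexManifold_nakamura L,
    exists_diffeomorph_discZero L, fun t ↦ ⟨exists_diffeomorph L t,
    satisfiesBeltrami_deformedProj L t⟩, exists_isPseudoKahler L,
    bottChernNumber11_eq_seven (isAffineCovering_nakCover L), ?_⟩
  obtain ⟨ε, hε, -, h⟩ := exists_multiplierPhase_ne L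
  exact ⟨ε, hε, fun t ht hte ↦ bottChernNumber11_eq_three (unitDisc_ne t) (h t ht hte)
    (isAffineCovering_deformedCover L t)⟩
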